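/- Let $K$ be a field, $m\ge 1$, $n=2m$, and let $R=K[x_{ij}:1\le i\le j\le n]$, with $x_{ji}:=x_{ij}$. Let $J(2,n)\subset R$ be the ideal generated by the $2$-minors of the generic symmetric matrix $(x_{ij})$, and let $CP=\{x_{1,n},x_{2,n-1},\dots,x_{m,m+1}\}$. Let $K(2,n)$ be the monomial ideal generated by the products $x_{ij}x_{hk}$ ($i\le j$, $h\le k$) of variables not in $CP$ such that (1) $a+b=n+1$ for some $a\in\{i,j\}$ and $b\in\{h,k\}$, or (2) $i<h$ and $j<k$. Let $\Delta$ be the simplicial complex of the sets of variables whose product is not in $K(2,n)$. A cone point of $\Delta$ is a vertex lying in all its facets, and $\operatorname{core}(\Delta)$ is the restriction of $\Delta$ to the vertices that are not cone points. Then: (a) The set of cone points of $\Delta$ is $CP$. The complex $\operatorname{core}(\Delta)$ is pure and has exactly $2^{n-1}$ facets, each with $m$ vertices. (b) For every $m$-element set $A\subset\{1,\dots,n\}$ in which no two elements sum to $n+1$, the faces of $\operatorname{core}(\Delta)$ contained in the triangle $T_A=\{(i,j): i\le j,\ i,j\in A\}$ form the classical path complex over $A$, whose facets are exactly the paths in $T_A$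 from $(\min A,\max A)$ to a box $(a,a)$ on the diagonal, each step going to the next box of $T_A$ on the left or below. The set of facets of $\operatorname{core}(\Delta)$ is the disjoint union, over all such $A$, of the sets of facets of these path complexes. (c) Let $\succ$ be a degree reverse lexicographic order on $R$ for which the variables in $CP$ are smaller than all the others and, for $x_{ij},x_{hk}\notin CP$, $x_{ij}\succ x_{hk}$ whenever $|i-j|<|h-k|$. Then $\operatorname{in}_\succ(J(2,n))=K(2,n)$. (d) $K(2,n)$ is generated by squarefree monomials of degree $2$, and $R/K(2,n)$ is a Gorenstein ring. Thus $K(2,n)$ is a squarefree quadratic Gorenstein initial ideal of $J(2,n)$. -/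

import Mathlib

open MvPolynomial

universe u

/-! ### Gorenstein rings -/

/-- A commutative ring is Gorenstein if it is Noetherian and each of its localizations at a maximal
ideal has finite injective dimension as a module over itself. -/
def IsGorensteinRing (R : Type u) [CommRing R] : Prop :=
  IsNoetherianRing R ∧
    ∀ (p : Ideal R) [p.IsMaximal], ∃ d : ℕ,
      CategoryTheory.HasInjectiveDimensionLE
        (ModuleCat.of (Localization.AtPrime p) (Localization.AtPrime p)) d

/-! ### The (degree) reverse lexicographic term order -/

/-- Type synonym for the exponent vectors in the variables `σ`, to carry the (degree) reverse
lexicographic order given by the linear order `ord` of the variables. -/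
def RevLexMonomial {σ : Type} (_ord : LinearOrder σ) : Type := σ →₀ ℕ

noncomputable instance {σ : Type} (ord : LinearOrder σ) : AddCommMonoid (RevLexMonomial ord) :=
  inferInstanceAs (AddCommMonoid (σ →₀ ℕ))

/-- The identity, as an additive equivalence to the type synonym. -/
noncomputable def toRevLex {σ : Type} (ord : LinearOrder σ) : (σ →₀ ℕ) ≃+ RevLexMonomial ord where
  toFun a := a
  invFun a := a
  left_inv _ := rfl
  right_inv _ := rfl
  map_add' _ _ := rfl

/-- Comparison key: first the total degree, then the exponents from the smallest variable upwards,
compared in the opposite direction. -/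
noncomputable def revLexKey {σ : Type} (ord : LinearOrder σ) (a : RevLexMonomial ord) :
    ℕ ×ₗ Lex (σ → ℕᵒᵈ) :=
  toLex (((toRevLex ord).symm a).degree,
    toLex fun v => OrderDual.toDual ((toRevLex ord).symm a v))

theorem revLexKey_injective {σ : Type} (ord : LinearOrder σ) :
    Function.Injective (revLexKey ord) := by
  intro a b h
  have h2 := congrArg (fun z => (ofLex (ofLex z).2)) h
  exact (toRevLex ord).symm.injective (Finsupp.ext fun v => congrFun h2 v)

noncomputable instance {σ : Type} [Finite σ] (ord : LinearOrder σ) :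
    LinearOrder (RevLexMonomial ord) :=
  letI := ord
  LinearOrder.lift' (revLexKey ord) (revLexKey_injective ord)

/-- Of two monomials of the same degree, the smaller one has the larger exponent at the smallest
variable at which the exponents differ. -/
theorem toRevLex_lt_iff {σ : Type} [Finite σ] (ord : LinearOrder σ) (a b : σ →₀ ℕ) :
    toRevLex ord a < toRevLex ord b ↔ a.degree < b.degree ∨
      (a.degree = b.degree ∧ ∃ v : σ, (∀ w : σ, ord.lt w v → a w = b w) ∧ b v < a v) := by
  let := ord
  change revLexKey ord (toRevLex ord a) < revLexKey ord (toRevLex ord b) ↔ _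
  rw [Prod.Lex.lt_iff]
  rfl

instance {σ : Type} [Finite σ] (ord : LinearOrder σ) :
    IsOrderedAddMonoid (RevLexMonomial ord) where
  add_le_add_left a b h c := by
    obtain ⟨a, rfl⟩ := (toRevLex ord).surjective a
    obtain ⟨b, rfl⟩ := (toRevLex ord).surjective b
    obtain ⟨c, rfl⟩ := (toRevLex ord).surjective c
    rcases h.eq_or_lt with h | h
    · rw [h]
    · refine le_of_lt ?_
      rw [← map_add, ← map_add, toRevLex_lt_iff]
      rw [toRevLex_lt_iff] at h
      simpa only [map_add, Finsupp.add_apply, add_lt_add_iff_right, add_left_inj] using h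

theorem toRevLex_monotone {σ : Type} [Finite σ] (ord : LinearOrder σ) :
    Monotone (toRevLex ord) := by
  intro a b h
  rcases h.eq_or_lt with rfl | h
  · exact le_rfl
  · refine le_of_lt ((toRevLex_lt_iff ord _ _).2 (Or.inl ?_))
    obtain ⟨c, rfl⟩ := exists_add_of_le h.le
    have hc : c ≠ 0 := by
      rintro rfl
      simp at h
    have : c.degree ≠ 0 := fun h0 => hc ((Finsupp.degree_eq_zero_iff c).1 h0)
    rw [map_add]
    omega

/-- The (degree) reverse lexicographic order in finitely many variables, ordered by `ord`. -/
noncomputable def degRevLex {σ : Type} [Finite σ] (ord : LinearOrder σ) : MonomialOrder σ where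
  syn := RevLexMonomial ord
  toSyn := toRevLex ord
  toSyn_monotone := toRevLex_monotone ord
  wellFoundedLT_syn := by
    have : WellQuasiOrderedLE (RevLexMonomial ord) :=
      (toRevLex_monotone ord).wellQuasiOrderedLE_of_wellQuasiOrderedLE_of_surjective
        (toRevLex ord).surjective
    exact wellQuasiOrderedLE_iff_wellFoundedLT.1 this

/-- The initial ideal of `I`: generated by the leading monomials of the nonzero elements of `I`. -/
noncomputable def initialIdeal {σ : Type} {K : Type u} [Field K] (mo : MonomialOrder σ)
    (I : Ideal (MvPolynomial σ K)) : Ideal (MvPolynomial σ K) :=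
  Ideal.span {g | ∃ f ∈ I, f ≠ 0 ∧ g = monomial (mo.degree f) (1 : K)}

/-! ### Simplicial complexes -/

/-- The simplicial complex associated with a monomial ideal `I`: the nonempty sets of variables
whose product is not in `I`. -/
noncomputable def stanleyReisnerComplex {σ : Type} {K : Type u} [Field K]
    (I : Ideal (MvPolynomial σ K)) : PreAbstractSimplicialComplex σ where
  faces := {F | F.Nonempty ∧ (∏ v ∈ F, (X v : MvPolynomial σ K)) ∉ I}
  isRelLowerSet_faces := fun _ hF =>
    ⟨hF.1, fun _ hGF hG => ⟨hG, fun h => hF.2 (I.mem_of_dvd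
      (Finset.prod_dvd_prod_of_subset _ _ _ hGF) h)⟩⟩

/-- The facets: the maximal faces. -/
def facets {V : Type} (D : PreAbstractSimplicialComplex V) : Set (Finset V) :=
  {F | Maximal (· ∈ D) F}

/-- A complex is pure if all its facets have the same cardinality. -/
def IsPureComplex {V : Type} (D : PreAbstractSimplicialComplex V) : Prop :=
  ∀ F ∈ facets D, ∀ G ∈ facets D, F.card = G.card

/-- The subcomplex of the faces contained in `S`. -/
def restrictComplex {V : Type} (D : PreAbstractSimplicialComplex V) (S : Set V) :
    PreAbstractSimplicialComplex V where
  faces := {F | F ∈ D ∧ (F : Set V) ⊆ S}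
  isRelLowerSet_faces := fun _ hF =>
    ⟨(D.isRelLowerSet_faces hF.1).1, fun _ hGF hG =>
      ⟨(D.isRelLowerSet_faces hF.1).2 hGF hG, (Finset.coe_subset.2 hGF).trans hF.2⟩⟩

/-- The cone points: the vertices contained in every facet. -/
def conePoints {V : Type} (D : PreAbstractSimplicialComplex V) : Set V :=
  {v | ∀ F ∈ facets D, v ∈ F}

/-- The core: the restriction to the vertices that are not cone points. -/
def coreComplex {V : Type} (D : PreAbstractSimplicialComplex V) :
    PreAbstractSimplicialComplex V :=
  restrictComplex D (conePoints D)ᶜ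

/-! ### The generic symmetric matrix -/

/-- The boxes `(row, col)`, `row ≤ col`, of the upper triangle; they index the variables of the
generic symmetric `n × n` matrix. Rows and columns are numbered from `0`. -/
@[ext]
structure Box (n : ℕ) where
  row : Fin n
  col : Fin n
  row_le_col : row ≤ col
deriving DecidableEq

instance (n : ℕ) : Finite (Box n) :=
  Finite.of_injective (fun x : Box n => (x.row, x.col)) fun x y h => by
    simp only [Prod.mk.injEq] at h
    exact Box.ext h.1 h.2

/-- The variable position of the `(i, j)` entry of a symmetric matrix. -/
def box {n : ℕ} (i j : Fin n) : Box n := ⟨min i j, max i j, min_le_max⟩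

/-- The generic symmetric `n × n` matrix. -/
noncomputable def symMatrix (n : ℕ) (K : Type u) [Field K] :
    Matrix (Fin n) (Fin n) (MvPolynomial (Box n) K) :=
  Matrix.of fun i j => X (box i j)

/-- The ideal `J(2,n)` generated by the 2-minors of the generic symmetric `n × n` matrix. -/
noncomputable def symMinorIdeal (n : ℕ) (K : Type u) [Field K] :
    Ideal (MvPolynomial (Box n) K) :=
  Ideal.span {f | ∃ r c : Fin 2 → Fin n, StrictMono r ∧ StrictMono c ∧
    f = ((symMatrix n K).submatrix r c).det}

/-- The indices `a` and `b`, counted from 1, sum to `n + 1`. -/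
def IsOpposite {n : ℕ} (a b : Fin n) : Prop := ((a : ℕ) + 1) + ((b : ℕ) + 1) = n + 1

/-- The boxes `(1,n), (2,n-1), …` on the antidiagonal. -/
def antidiagonalBoxes (n : ℕ) : Set (Box n) := {x | IsOpposite x.row x.col}

/-- The monomial ideal `K(2,n)`: generated by the products of two variables off the antidiagonal
such that (1) some index of one and some index of the other sum to `n + 1`, or (2) one is strictly
to the right of and strictly below the other. -/
noncomputable def symMonomialIdeal (n : ℕ) (K : Type u) [Field K] :
    Ideal (MvPolynomial (Box n) K) :=
  Ideal.span {f | ∃ x y : Box n, x ∉ antidiagonalBoxes n ∧ y ∉ antidiagonalBoxes n ∧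
    ((∃ a b : Fin n, (a = x.row ∨ a = x.col) ∧ (b = y.row ∨ b = y.col) ∧ IsOpposite a b) ∨
      (x.row < y.row ∧ x.col < y.col)) ∧
    f = X x * X y}

/-- The orders of the variables whose reverse lexicographic order is used: the antidiagonal
variables are the smallest, and of two other variables the one closer to the diagonal is larger. -/
def IsAdmissibleOrder {n : ℕ} (ord : LinearOrder (Box n)) : Prop :=
  (∀ x ∈ antidiagonalBoxes n, ∀ y ∉ antidiagonalBoxes n, ord.lt x y) ∧
  (∀ x ∉ antidiagonalBoxes n, ∀ y ∉ antidiagonalBoxes n,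
    (x.col : ℕ) - (x.row : ℕ) < (y.col : ℕ) - (y.row : ℕ) → ord.lt y x)

/-! ### Path complexes -/

/-- The sets of `m` indices in which no two indices sum to `n + 1`. -/
def oppositeFreeSets (n m : ℕ) : Set (Finset (Fin n)) :=
  {A | A.card = m ∧ ∀ i ∈ A, ∀ j ∈ A, ¬ IsOpposite i j}

/-- The triangle over `A`: the boxes with both indices in `A`. -/
def triangle {n : ℕ} (A : Finset (Fin n)) : Set (Box n) := {x | x.row ∈ A ∧ x.col ∈ A}

/-- `j` is the element of `A` that comes immediately after the element `i` of `A`. -/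
def IsNextIn {n : ℕ} (A : Finset (Fin n)) (i j : Fin n) : Prop :=
  i ∈ A ∧ j ∈ A ∧ i < j ∧ ∀ k ∈ A, ¬ (i < k ∧ k < j)

/-- A step in the triangle over `A`, to the left or downwards. -/
def IsTriangleStep {n : ℕ} (A : Finset (Fin n)) (x y : Box n) : Prop :=
  (y.row = x.row ∧ IsNextIn A y.col x.col) ∨ (y.col = x.col ∧ IsNextIn A x.row y.row)

/-- `l` is a path in the triangle over `A` from the top right corner `(min A, max A)` to a box on
the diagonal. -/
def IsTrianglePath {n : ℕ} (A : Finset (Fin n)) (l : List (Box n)) : Prop :=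
  (∃ x, l.head? = some x ∧ IsLeast (A : Set (Fin n)) x.row ∧ IsGreatest (A : Set (Fin n)) x.col) ∧
  l.IsChain (IsTriangleStep A) ∧
  (∃ x, l.getLast? = some x ∧ x.row = x.col)

/-- The classical path complex over `A`: its faces are the nonempty sets of boxes contained in a
path in the triangle over `A` from the top right corner to the diagonal. -/
def pathComplex {n : ℕ} (A : Finset (Fin n)) : PreAbstractSimplicialComplex (Box n) where
  faces := {F | F.Nonempty ∧ ∃ l, IsTrianglePath A l ∧ F ⊆ l.toFinset}
  isRelLowerSet_faces := fun _ ⟨hF, l, hl, hFl⟩ =>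
    ⟨hF, fun _ hGF hG => ⟨hG, l, hl, hGF.trans hFl⟩⟩

/-! Combinatorics. A face without antidiagonal boxes has no two opposite indices and its boxes are
pairwise nested. A nested set in the triangle over `A` extends to a path, because row `min A` and
column `max A` cannot both contain a box other than the corner (`exists_isPathSet_superset`). So the
facets of the whole complex are the antidiagonal together with a path over a set `A` that takes one
index from each pair of opposite indices. There are `2 ^ m` such `A`, each carries `2 ^ (m - 1)`
paths, and `A` is recovered from a path as its set of indices.

Geometry. Identify `x_ij` with the vector `e_i + e_j`. The facets are the domains of linearity of a
strictly convex height function: for each facet there is a linear function below all heights that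
meets them exactly at the vertices of the facet (`exists_height_potential`). This certificate is
used twice.

Initial ideal. Each generator of `K(2,n)` is the leading term of a 2-minor
(`IsBadPair.exists_minor`). Conversely, comparing heights shows that distinct standard monomials
have distinct images under `x_ij ↦ t_i t_j` (`toricExponent_injOn`). This map kills `J(2,n)`, so an
element of `J(2,n)` with only standard monomials is zero, and division with remainder gives
equality.

Gorenstein property. A generic linear functional on the functions of the certificate orders the
facets into a shelling (`exists_shelledFan`), whose reverse has the complementary restriction sets.
Let `B` be the polynomial ring generated by the global linear functions. The quotient ring `A` is
free over `B` on the shelling monomials, and the coordinate at the last facet is a trace form, which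
is perfect because its Gram matrix against the complementary monomials is triangular with unit
diagonal (`ShelledFan.bijective_trace`). Hence `A` is isomorphic to `Hom_B(A, B)`. Coextension along
a projective algebra does not raise injective dimension, and `B` has finite self-injective dimension
by Hilbert's syzygy theorem, so `A` and its localizations have finite self-injective dimension
(`isGorensteinRing_of_bijective_trace`). -/

/-! ### Homological dimension of polynomial rings. -/

-- `R[X]` is flat over `R`, so base change preserves the exact sequence of a first syzygy, and
-- dimension shifting applies on both sides.
open CategoryTheory Polynomial in
theorem hasProjectiveDimensionLE_baseChange_polynomial {R : Type u} [CommRing R] (n : ℕ)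
    (M : ModuleCat.{u} R) [HasProjectiveDimensionLE M n] :
    HasProjectiveDimensionLE (ModuleCat.of R[X] (TensorProduct R R[X] M)) n := by
  induction n generalizing M with
  | zero =>
    have : HasProjectiveDimensionLE M 0 := ‹_›
    simp only [HasProjectiveDimensionLE, zero_add] at this ⊢
    rw [← projective_iff_hasProjectiveDimensionLT_one, ← IsProjective.iff_projective] at this ⊢
    infer_instance
  | succ n ih =>
    let S := M.projectiveShortComplex
    have hS : S.ShortExact := M.shortExact_projectiveShortComplex
    have := (hS.hasProjectiveDimensionLT_X₃_iff n inferInstance).mp ‹_›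
    have ih' := ih S.X₁
    have hex : Function.Exact S.f.hom S.g.hom :=
      (ShortComplex.ShortExact.moduleCat_exact_iff_function_exact _).mp hS.exact
    have hinj : Function.Injective S.f.hom := (ModuleCat.mono_iff_injective _).mp hS.mono_f
    have hsurj : Function.Surjective S.g.hom := (ModuleCat.epi_iff_surjective _).mp hS.epi_g
    have hex' : Function.Exact (S.f.hom.baseChange R[X]) (S.g.hom.baseChange R[X]) :=
      Module.Flat.lTensor_exact R[X] hex
    let S' : ShortComplex (ModuleCat.{u} R[X]) :=
      ModuleCat.shortComplexOfCompEqZero _ _ hex'.linearMap_comp_eq_zero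
    have hS' : S'.ShortExact := ModuleCat.shortComplex_shortExact S' hex'
      (Module.Flat.lTensor_preserves_injective_linearMap _ hinj)
      (LinearMap.lTensor_surjective _ hsurj)
    have hproj : Projective S'.X₂ := by
      rw [← IsProjective.iff_projective]
      change Module.Projective R[X] (TensorProduct R R[X] S.X₂)
      infer_instance
    exact (hS'.hasProjectiveDimensionLT_X₃_iff n hproj).mpr ih'

open Polynomial in
/-- The endomorphism of `M[X]`, for an `R[X]`-module `M`, whose cokernel is `M`. -/
noncomputable def polynomialModuleShift {R : Type u} [CommRing R] (M : Type u) [AddCommGroup M]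
    [Module R M] [Module R[X] M] [IsScalarTower R R[X] M] :
    PolynomialModule R M →ₗ[R[X]] PolynomialModule R M where
  toFun f := (X : R[X]) • f -
    PolynomialModule.map R (((X : R[X]) • (LinearMap.id : M →ₗ[R[X]] M)).restrictScalars R) f
  map_add' f g := by simp only [smul_add, map_add]; abel
  map_smul' p f := by
    simp [smul_sub, PolynomialModule.map_smul, smul_comm p (X : R[X]) f]

open Polynomial in
theorem polynomialModuleShift_single {R : Type u} [CommRing R] {M : Type u} [AddCommGroup M]
    [Module R M] [Module R[X] M] [IsScalarTower R R[X] M] (i : ℕ) (m : M) :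
    polynomialModuleShift M (PolynomialModule.single R i m) =
      PolynomialModule.single R (i + 1) m - PolynomialModule.single R i ((X : R[X]) • m) := by
  have : (X : R[X]) • PolynomialModule.single R i m = PolynomialModule.single R (i + 1) m := by
    rw [← monomial_one_one_eq_X, PolynomialModule.monomial_smul_single, one_smul, add_comm]
  simp [polynomialModuleShift, this]

open Polynomial in
/-- The evaluation `M[X] → M` for an `R[X]`-module `M`. -/
noncomputable def polynomialModuleEval {R : Type u} [CommRing R] (M : Type u) [AddCommGroup M]
    [Module R M] [Module R[X] M] [IsScalarTower R R[X] M] :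
    PolynomialModule R M →ₗ[R[X]] M where
  toFun f := f.coeff.sum fun i m => (X : R[X]) ^ i • m
  map_add' f g := by
    rw [PolynomialModule.coeff_add, Finsupp.sum_add_index'] <;> simp
  map_smul' p f := by
    have hadd : ∀ f g : PolynomialModule R M,
        ((f + g).coeff.sum fun i m => (X : R[X]) ^ i • m) =
        (f.coeff.sum fun i m => (X : R[X]) ^ i • m) +
          g.coeff.sum fun i m => (X : R[X]) ^ i • m := fun f g => by
      rw [PolynomialModule.coeff_add, Finsupp.sum_add_index'] <;> simp
    induction f using PolynomialModule.induction_linear with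
    | zero => simp
    | add f g hf hg => rw [smul_add, hadd, hf, hg, hadd, smul_add]
    | single i m =>
      induction p using Polynomial.induction_on' with
      | add p q hp hq => rw [add_smul, hadd, hp, hq]; simp only [RingHom.id_apply, add_smul]
      | monomial j r =>
        rw [PolynomialModule.monomial_smul_single, PolynomialModule.coeff_single,
          PolynomialModule.coeff_single, Finsupp.sum_single_index (by simp),
          Finsupp.sum_single_index (by simp), RingHom.id_apply, ← Polynomial.C_mul_X_pow_eq_monomial,
          mul_smul, ← mul_smul ((Polynomial.X : R[X]) ^ j), ← pow_add, ← smul_comm r,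
          ← Polynomial.algebraMap_eq, algebraMap_smul]

open Polynomial in
theorem polynomialModuleEval_single {R : Type u} [CommRing R] {M : Type u} [AddCommGroup M]
    [Module R M] [Module R[X] M] [IsScalarTower R R[X] M] (i : ℕ) (m : M) :
    polynomialModuleEval M (PolynomialModule.single R i m) = (X : R[X]) ^ i • m := by
  change ((PolynomialModule.single R i m).coeff.sum fun i m => (X : R[X]) ^ i • m) = _
  rw [PolynomialModule.coeff_single, Finsupp.sum_single_index (by simp)]

-- If the shift kills `f`, each coefficient is `X` times the next one. Coefficients above the degree
-- vanish, hence all do, by descending induction.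
open Polynomial in
theorem polynomialModuleShift_injective {R : Type u} [CommRing R] (M : Type u) [AddCommGroup M]
    [Module R M] [Module R[X] M] [IsScalarTower R R[X] M] :
    Function.Injective (polynomialModuleShift (R := R) M) := by
  rw [injective_iff_map_eq_zero]
  intro f hf
  have hcoeff : ∀ k, f.coeff k = (X : R[X]) • f.coeff (k + 1) := by
    intro k
    have h1 : ∀ g : PolynomialModule R M, (polynomialModuleShift M g).coeff (k + 1) =
        g.coeff k - (X : R[X]) • g.coeff (k + 1) := by
      intro g
      induction g using PolynomialModule.induction_linear with
      | zero => simp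
      | add f g hf hg =>
        simp only [map_add, PolynomialModule.coeff_add, Finsupp.add_apply, hf, hg, smul_add]
        abel
      | single i m =>
        rw [polynomialModuleShift_single]
        have : ∀ a b : PolynomialModule R M, (a - b).coeff = a.coeff - b.coeff :=
          fun a b => map_sub PolynomialModule.coeffAddEquiv a b
        simp only [this, PolynomialModule.coeff_single, Finsupp.sub_apply, Finsupp.single_apply]
        split_ifs <;> simp_all
    have h2 := h1 f
    rw [hf] at h2
    exact sub_eq_zero.mp h2.symm
  have hzero : ∀ j k, k + j = (f.coeff.support.sup id) + 1 → f.coeff k = 0 := by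
    intro j
    induction j with
    | zero =>
      intro k hk
      by_contra h
      have := Finset.le_sup (f := id) (Finsupp.mem_support_iff.mpr h)
      simp only [id_eq] at this
      omega
    | succ j ih =>
      intro k hk
      rw [hcoeff, ih (k + 1) (by omega), smul_zero]
  ext k
  by_cases hk : k ≤ f.coeff.support.sup id + 1
  · exact hzero (f.coeff.support.sup id + 1 - k) k (by omega)
  · by_contra h
    have := Finset.le_sup (f := id) (Finsupp.mem_support_iff.mpr h)
    simp only [id_eq] at this
    omega

-- Modulo the image of the shift a factor `X` can be moved from the polynomial variable into the
-- module, so `f` is congruent to the constant polynomial `polynomialModuleEval M f`.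
open Polynomial in
theorem polynomialModule_exact {R : Type u} [CommRing R] (M : Type u) [AddCommGroup M]
    [Module R M] [Module R[X] M] [IsScalarTower R R[X] M] :
    Function.Exact (polynomialModuleShift (R := R) M) (polynomialModuleEval M) := by
  have hmod : ∀ f : PolynomialModule R M, ∃ g,
      f - PolynomialModule.single R 0 (polynomialModuleEval M f) = polynomialModuleShift M g := by
    intro f
    induction f using PolynomialModule.induction_linear with
    | zero => exact ⟨0, by simp⟩
    | add f g hf hg =>
      obtain ⟨a, ha⟩ := hf
      obtain ⟨b, hb⟩ := hg
      refine ⟨a + b, ?_⟩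
      rw [map_add, map_add, PolynomialModule.single_add, ← ha, ← hb]
      abel
    | single i m =>
      induction i generalizing m with
      | zero => exact ⟨0, by simp [polynomialModuleEval_single]⟩
      | succ i ih =>
        obtain ⟨a, ha⟩ := ih ((X : R[X]) • m)
        refine ⟨a + PolynomialModule.single R i m, ?_⟩
        rw [map_add, ← ha, polynomialModuleShift_single, polynomialModuleEval_single,
          polynomialModuleEval_single, pow_succ, mul_smul]
        abel
  intro f
  constructor
  · intro hf
    obtain ⟨g, hg⟩ := hmod f
    exact ⟨g, by rw [← hg, hf]; simp⟩
  · rintro ⟨g, rfl⟩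
    induction g using PolynomialModule.induction_linear with
    | zero => simp
    | add f g hf hg => rw [map_add, map_add, hf, hg, add_zero]
    | single i m =>
      rw [polynomialModuleShift_single, map_sub, polynomialModuleEval_single,
        polynomialModuleEval_single, pow_succ, mul_smul, sub_self]

-- The exact sequence `0 → M[X] → M[X] → M → 0` has two terms extended from `R`, of projective
-- dimension at most `n`; the third costs one more.
open CategoryTheory Polynomial in
theorem hasProjectiveDimensionLE_polynomial {R : Type u} [CommRing R] (n : ℕ)
    (hR : ∀ M : ModuleCat.{u} R, HasProjectiveDimensionLE M n) (M : ModuleCat.{u} R[X]) :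
    HasProjectiveDimensionLE M (n + 1) := by
  let : Module R M := Module.compHom M (algebraMap R R[X])
  have : IsScalarTower R R[X] M := ⟨fun r p m => by
    change (r • p) • m = algebraMap R R[X] r • (p • m)
    rw [← mul_smul, Algebra.smul_def]⟩
  have hpd : HasProjectiveDimensionLE (ModuleCat.of R[X] (PolynomialModule R M)) n := by
    have := hR (ModuleCat.of R M)
    have := hasProjectiveDimensionLE_baseChange_polynomial n (ModuleCat.of R M)
    exact ModuleCat.hasProjectiveDimensionLE_of_linearEquiv
      (M := ModuleCat.of R[X] (TensorProduct R R[X] M))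
      (N := ModuleCat.of R[X] (PolynomialModule R M))
      (PolynomialModule.polynomialTensorProductLEquivPolynomialModule R M) n
  let S : ShortComplex (ModuleCat.{u} R[X]) :=
    ModuleCat.shortComplexOfCompEqZero _ _ (polynomialModule_exact (R := R) M).linearMap_comp_eq_zero
  have hS : S.ShortExact := ModuleCat.shortComplex_shortExact S (polynomialModule_exact (R := R) M)
    (polynomialModuleShift_injective (R := R) M)
    (fun m => ⟨PolynomialModule.single R 0 m, by
      change polynomialModuleEval M (PolynomialModule.single R 0 m) = m
      rw [polynomialModuleEval_single, pow_zero, one_smul]⟩)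
  exact hS.hasProjectiveDimensionLT_X₃ (n + 1) hpd
    (hasProjectiveDimensionLT_of_ge _ (n + 1) (n + 2) (Nat.le_succ _))

open CategoryTheory in
theorem hasProjectiveDimensionLE_of_ringEquiv {R R' : Type u} [CommRing R] [CommRing R']
    (e : R ≃+* R') (n : ℕ) (hR : ∀ M : ModuleCat.{u} R, HasProjectiveDimensionLE M n)
    (M : ModuleCat.{u} R') : HasProjectiveDimensionLE M n := by
  let : Module R M := Module.compHom M e.toRingHom
  have := hR (ModuleCat.of R M)
  let := RingHomInvPair.of_ringEquiv e
  let := (RingHomInvPair.of_ringEquiv e).symm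
  exact ModuleCat.hasProjectiveDimensionLE_of_semiLinearEquiv (M := ModuleCat.of R M) (N := M) e
    { AddEquiv.refl M with map_smul' := fun r m => rfl } n

open CategoryTheory in
/-- Hilbert's syzygy theorem, for the global dimension. -/
theorem hasProjectiveDimensionLE_mvPolynomial (K : Type u) [Field K] (n : ℕ)
    (M : ModuleCat.{u} (MvPolynomial (Fin n) K)) : HasProjectiveDimensionLE M n := by
  induction n with
  | zero =>
    refine hasProjectiveDimensionLE_of_ringEquiv
      (isEmptyAlgEquiv K (Fin 0)).symm.toRingEquiv 0 (fun N => ?_) M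
    simp only [HasProjectiveDimensionLE, zero_add]
    rw [← projective_iff_hasProjectiveDimensionLT_one, ← IsProjective.iff_projective]
    exact Module.Projective.of_free
  | succ n ih =>
    exact hasProjectiveDimensionLE_of_ringEquiv (finSuccEquiv K n).symm.toRingEquiv (n + 1)
      (hasProjectiveDimensionLE_polynomial n ih) M

-- Injective dimension of `N` is tested by `Ext(Y, N)`, which vanishes in degrees above `n` by the
-- bound on `Y`.
open CategoryTheory in
theorem hasInjectiveDimensionLE_of_forall_hasProjectiveDimensionLE {R : Type u} [CommRing R]
    (n : ℕ) (hR : ∀ M : ModuleCat.{u} R, HasProjectiveDimensionLE M n) (N : ModuleCat.{u} R) :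
    HasInjectiveDimensionLE N n := by
  rw [HasInjectiveDimensionLE, hasInjectiveDimensionLT_iff]
  intro i hi Y e
  have := hR Y
  exact Abelian.Ext.eq_zero_of_hasProjectiveDimensionLT e (n + 1) hi

/-! ### Coextension of scalars and a criterion for the Gorenstein property. -/

/-- Linear maps out of a `B`-algebra `A`, as elements of the coextension of scalars. -/
noncomputable def coextendScalarsMk {B A : Type u} [CommRing B] [CommRing A] [Algebra B A]
    {N : ModuleCat.{u} B}
    (g : A →ₗ[B] N) : (ModuleCat.coextendScalars (algebraMap B A)).obj N :=
  (ModuleCat.CoextendScalars.equiv (algebraMap B A) N).symm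
    { toFun := fun a => g a
      map_add' := g.map_add
      map_smul' := fun b a => by
        exact (congrArg g (Algebra.smul_def b (show A from a)).symm).trans (g.map_smul b a) }

/-- The linear map out of `A` given by an element of the coextension of scalars. -/
noncomputable def coextendScalarsHom {B A : Type u} [CommRing B] [CommRing A] [Algebra B A]
    {N : ModuleCat.{u} B}
    (g : (ModuleCat.coextendScalars (algebraMap B A)).obj N) : A →ₗ[B] N where
  toFun a := ModuleCat.CoextendScalars.equiv (algebraMap B A) N g a
  map_add' a b := (ModuleCat.CoextendScalars.equiv (algebraMap B A) N g).map_add a b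
  map_smul' b a := by
    exact (congrArg (ModuleCat.CoextendScalars.equiv (algebraMap B A) N g)
      (Algebra.smul_def b a)).trans
      ((ModuleCat.CoextendScalars.equiv (algebraMap B A) N g).map_smul b a)

theorem coextendScalars_ext {B A : Type u} [CommRing B] [CommRing A] [Algebra B A]
    {N : ModuleCat.{u} B} {g h : (ModuleCat.coextendScalars (algebraMap B A)).obj N}
    (H : ∀ a, coextendScalarsHom g a = coextendScalarsHom h a) : g = h :=
  ModuleCat.CoextendScalars.ext (LinearMap.ext H)

-- The functor `Hom_B(A, -)` preserves injectives, being right adjoint to the exact restriction of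
-- scalars, and it is exact because `A` is projective over `B`. Dimension shifting along an
-- embedding into an injective does the rest.
open CategoryTheory in
theorem hasInjectiveDimensionLE_coextendScalars {B A : Type u} [CommRing B] [CommRing A]
    [Algebra B A] [Module.Projective B A] (n : ℕ) (N : ModuleCat.{u} B)
    [HasInjectiveDimensionLE N n] :
    HasInjectiveDimensionLE ((ModuleCat.coextendScalars (algebraMap B A)).obj N) n := by
  have hinj : ∀ I : ModuleCat.{u} B, Injective I →
      Injective ((ModuleCat.coextendScalars.{u, u, u} (algebraMap B A)).obj I) := fun I hI =>
    Injective.injective_of_adjoint (ModuleCat.restrictCoextendScalarsAdj (algebraMap B A)) I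
  induction n generalizing N with
  | zero =>
    have : HasInjectiveDimensionLE N 0 := ‹_›
    simp only [HasInjectiveDimensionLE, zero_add] at this ⊢
    rw [← injective_iff_hasInjectiveDimensionLT_one] at this ⊢
    exact hinj N this
  | succ n ih =>
    let ⟨I, _, f, _⟩ := EnoughInjectives.presentation N
    have hf : Function.Injective f.hom := (ModuleCat.mono_iff_injective f).mp ‹_›
    let S : ShortComplex (ModuleCat.{u} B) :=
      ModuleCat.shortComplexOfCompEqZero _ _ f.hom.exact_map_mkQ_range.linearMap_comp_eq_zero
    have hS : S.ShortExact := ModuleCat.shortComplex_shortExact S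
      f.hom.exact_map_mkQ_range hf (Submodule.mkQ_surjective _)
    have : HasInjectiveDimensionLE S.X₃ n :=
      (hS.hasInjectiveDimensionLT_X₃_iff n inferInstance).mpr ‹_›
    let F := ModuleCat.coextendScalars.{u, u, u} (algebraMap B A)
    have hF : (S.map F).ShortExact := by
      refine ModuleCat.shortComplex_shortExact _ ?_ ?_ ?_
      · intro g
        constructor
        · intro hg
          have hg' : ∀ a : A, coextendScalarsHom g a ∈ f.hom.range := by
            intro a
            have h1 : f.hom.range.mkQ (coextendScalarsHom g a) = 0 :=
              congrArg (fun h => coextendScalarsHom h a) hg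
            simpa using h1
          refine ⟨coextendScalarsMk ((LinearEquiv.ofInjective f.hom hf).symm.toLinearMap ∘ₗ
            (coextendScalarsHom g).codRestrict f.hom.range hg'), coextendScalars_ext fun a => ?_⟩
          exact congrArg Subtype.val ((LinearEquiv.ofInjective f.hom hf).apply_symm_apply
            ⟨coextendScalarsHom g a, hg' a⟩)
        · rintro ⟨h, rfl⟩
          refine coextendScalars_ext fun a => ?_
          exact f.hom.exact_map_mkQ_range.apply_apply_eq_zero (coextendScalarsHom h a)
      · intro g h hgh
        refine coextendScalars_ext fun a => hf ?_
        exact congrArg (fun h => coextendScalarsHom h a) hgh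
      · intro g
        obtain ⟨h, hh⟩ := Module.projective_lifting_property f.hom.range.mkQ (coextendScalarsHom g)
          (Submodule.mkQ_surjective _)
        exact ⟨coextendScalarsMk h, coextendScalars_ext fun a => LinearMap.congr_fun hh a⟩
    exact (hF.hasInjectiveDimensionLT_X₃_iff n (hinj I inferInstance)).mp (ih S.X₃)

theorem localizedModule_hasInjectiveDimensionLE_self {A : Type u} [CommRing A]
    [IsNoetherianRing A] (S : Submonoid A) (n : ℕ)
    [CategoryTheory.HasInjectiveDimensionLE (ModuleCat.of A A) n] :
    CategoryTheory.HasInjectiveDimensionLE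
      (ModuleCat.of (Localization S) (Localization S)) n := by
  have h := (ModuleCat.of A A).localizedModule_hasInjectiveDimensionLE n S
  let e : (ModuleCat.of A A).localizedModule S ≃ₗ[Localization S]
      ModuleCat.of (Localization S) (Localization S) :=
    LinearEquiv.extendScalarsOfIsLocalization S (Localization S)
      (have := (ModuleCat.of A A).localizedModule_isLocalizedModule S
      IsLocalizedModule.linearEquiv S
        ((ModuleCat.of A A).localizedModuleMkLinearMap S)
        (Algebra.linearMap A (Localization S)))
  exact (ModuleCat.hasInjectiveDimensionLE_iff_of_linearEquiv e n).mp h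

open CategoryTheory in
/-- A ring that is projective over a ring `B` of finite self-injective dimension, with
a perfect trace form into `B`, is Gorenstein. -/
theorem isGorensteinRing_of_bijective_trace {B A : Type u} [CommRing B] [CommRing A]
    [IsNoetherianRing A] [Algebra B A] [Module.Projective B A] (n : ℕ)
    [HasInjectiveDimensionLE (ModuleCat.of B B) n] (T : A →ₗ[B] B)
    (hT : Function.Bijective fun a : A => T ∘ₗ LinearMap.mulLeft B a) : IsGorensteinRing A := by
  have hcoe := hasInjectiveDimensionLE_coextendScalars (A := A) n (ModuleCat.of B B)
  -- The map `a ↦ T(a ·)` is an `A`-linear isomorphism from `A` onto the coextension of `B`.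
  have hA : HasInjectiveDimensionLE (ModuleCat.of A A) n := by
    let e : A →ₗ[A] (ModuleCat.coextendScalars (algebraMap B A)).obj (ModuleCat.of B B) :=
      { toFun := fun a => coextendScalarsMk (N := ModuleCat.of B B) (T ∘ₗ LinearMap.mulLeft B a)
        map_add' := fun a b => coextendScalars_ext fun c =>
          (congrArg T (add_mul a b c)).trans (T.map_add _ _)
        map_smul' := fun a b => coextendScalars_ext fun c =>
          congrArg T (show a * b * c = b * (c * a) by ring) }
    have he : Function.Bijective e := by
      constructor
      · intro a b hab
        exact hT.1 (LinearMap.ext fun c => congrArg (fun h => coextendScalarsHom h c) hab)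
      · intro g
        obtain ⟨a, ha⟩ := hT.2 (coextendScalarsHom g)
        exact ⟨a, coextendScalars_ext fun c => LinearMap.congr_fun ha c⟩
    exact (ModuleCat.hasInjectiveDimensionLE_iff_of_linearEquiv (M := ModuleCat.of A A)
      (LinearEquiv.ofBijective e he) n).mpr hcoe
  exact ⟨inferInstance, fun p hp => ⟨n, localizedModule_hasInjectiveDimensionLE_self _ n⟩⟩

/-! ### Triangular families of evaluations and trace forms. -/

/-- Gaussian elimination: at the smallest index where the evaluation of `a` may be nonzero, subtract
the multiple of `e i` that makes it vanish. The set `P` is an invariant of the elimination, later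
homogeneity of a fixed degree, and `S` records which `e i` are really needed. -/
theorem mem_span_of_triangular_evaluations {B A : Type u} [CommRing B] [CommRing A]
    [Algebra B A] {J : Type} [Fintype J] [LinearOrder J]
    (ψ : J → A →ₐ[B] B) (e : J → A) (hinj : ∀ a, (∀ j, ψ j a = 0) → a = 0)
    (htri : ∀ i j, ψ j (e i) ≠ 0 → i ≤ j) (P : Set A) (S : Set J)
    (hP : ∀ a ∈ P, ∀ i, (∀ j < i, ψ j a = 0) →
      ∃ b : B, ψ i a = b * ψ i (e i) ∧ a - b • e i ∈ P ∧ (i ∉ S → b = 0)) {a : A} (ha : a ∈ P) :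
    a ∈ Submodule.span B (e '' S) := by
  classical
  -- `U` is the upper set of indices not yet cleared; its minimum is removed at each step.
  suffices H : ∀ U : Finset J, (∀ i ∈ U, ∀ j, i ≤ j → j ∈ U) → ∀ a ∈ P, (∀ j ∉ U, ψ j a = 0) →
      a ∈ Submodule.span B (e '' S) from
    H Finset.univ (by simp) a ha (by simp)
  intro U
  induction hn : U.card generalizing U with
  | zero =>
    intro _ a _ h0
    rw [Finset.card_eq_zero] at hn
    subst hn
    rw [hinj a fun j => h0 j (Finset.notMem_empty j)]
    exact zero_mem _
  | succ n ih =>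
    intro hU a ha h0
    have hne : U.Nonempty := Finset.card_pos.mp (by omega)
    set i := U.min' hne with hi
    have hiU : i ∈ U := U.min'_mem hne
    obtain ⟨b, hb, hbP, hbS⟩ := hP a ha i fun j hj => h0 j fun hjU =>
      absurd (U.min'_le j hjU) (not_le.mpr hj)
    have hrec : a - b • e i ∈ Submodule.span B (e '' S) := by
      refine ih (U.erase i) (by rw [Finset.card_erase_of_mem hiU]; omega) ?_ _ hbP ?_
      · intro k hk j hkj
        have hk' := Finset.mem_erase.mp hk
        refine Finset.mem_erase.mpr ⟨?_, hU k hk'.2 j hkj⟩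
        rintro rfl
        exact hk'.1 (le_antisymm hkj (U.min'_le k hk'.2))
      · intro j hj
        rw [map_sub, map_smul, smul_eq_mul]
        by_cases hji : j = i
        · rw [hji, hb, sub_self]
        · have hjU : j ∉ U := fun h => hj (Finset.mem_erase.mpr ⟨hji, h⟩)
          have : ψ j (e i) = 0 := by
            by_contra h
            exact hjU (hU i hiU j (htri i j h))
          rw [h0 j hjU, this, mul_zero, sub_zero]
    have hbe : b • e i ∈ Submodule.span B (e '' S) := by
      by_cases hiS : i ∈ S
      · exact Submodule.smul_mem _ _ (Submodule.subset_span ⟨i, hiS, rfl⟩)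
      · rw [hbS hiS, zero_smul]
        exact zero_mem _
    simpa using add_mem hrec hbe

/-- In a relation, evaluate at the smallest index with a nonzero coefficient: only the diagonal term
survives. -/
theorem linearIndependent_of_triangular_evaluations {B A : Type u} [CommRing B] [IsDomain B]
    [CommRing A] [Algebra B A] {J : Type} [Fintype J] [LinearOrder J]
    (ψ : J → A →ₐ[B] B) (e : J → A)
    (htri : ∀ i j, ψ j (e i) ≠ 0 → i ≤ j) (hdiag : ∀ i, ψ i (e i) ≠ 0) :
    LinearIndependent B e := by
  classical
  rw [Fintype.linearIndependent_iff]
  intro b hb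
  by_contra hne
  push Not at hne
  have hU : (Finset.univ.filter fun i => b i ≠ 0).Nonempty := by
    obtain ⟨i, hi⟩ := hne
    exact ⟨i, by simpa using hi⟩
  set i := (Finset.univ.filter fun i => b i ≠ 0).min' hU with hi
  have hbi : b i ≠ 0 := by simpa using (Finset.min'_mem _ hU)
  have h1 : ψ i (∑ j, b j • e j) = b i * ψ i (e i) := by
    rw [map_sum, Finset.sum_eq_single i]
    · rw [map_smul, smul_eq_mul]
    · intro j _ hj
      rw [map_smul, smul_eq_mul]
      by_cases hlt : j < i
      · have : b j = 0 := by
          by_contra h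
          exact absurd (Finset.min'_le _ j (by simpa using h)) (not_le.mpr hlt)
        rw [this, zero_mul]
      · have : ψ i (e j) = 0 := by
          by_contra h
          exact hlt (lt_of_le_of_ne (htri j i h) hj)
        rw [this, mul_zero]
    · simp
  rw [hb, map_zero] at h1
  exact mul_ne_zero hbi (hdiag i) h1.symm

/-- The Gram matrix `T (b i * y j)` is upper triangular with units on the diagonal, hence
invertible, so every functional is `T(a ·)` for a combination `a` of the `y j`. -/
theorem bijective_trace_of_triangular {B A : Type u} [CommRing B] [CommRing A] [Algebra B A]
    {J : Type} [Fintype J] [LinearOrder J]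
    (b : Module.Basis J B A) (y : J → A) (T : A →ₗ[B] B)
    (htri : ∀ i j, T (b i * y j) ≠ 0 → i ≤ j) (hdiag : ∀ i, IsUnit (T (b i * y i))) :
    Function.Bijective fun a : A => T ∘ₗ LinearMap.mulLeft B a := by
  classical
  let Φ : A →ₗ[B] (A →ₗ[B] B) :=
    { toFun := fun a => T ∘ₗ LinearMap.mulLeft B a
      map_add' := fun a c => LinearMap.ext fun x => by simp [add_mul]
      map_smul' := fun r a => LinearMap.ext fun x => by simp }
  let M : Matrix J J B := Matrix.of fun i j => T (b i * y j)
  have hdet : IsUnit M.det := by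
    rw [Matrix.det_of_isUpperTriangular]
    · exact (IsUnit.prod_iff).mpr fun i _ => hdiag i
    · intro i j hij
      by_contra h
      exact absurd (htri i j h) (not_le.mpr hij)
  have hsurj : Function.Surjective Φ := by
    intro L
    let c : J → B := M⁻¹.mulVec fun i => L (b i)
    refine ⟨∑ j, c j • y j, b.ext fun i => ?_⟩
    have hc : M.mulVec c = fun i => L (b i) := by
      rw [Matrix.mulVec_mulVec, Matrix.mul_nonsing_inv _ hdet, Matrix.one_mulVec]
    rw [← congrFun hc i]
    change T ((∑ j, c j • y j) * b i) = ∑ j, M i j * c j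
    rw [Finset.sum_mul, map_sum]
    refine Finset.sum_congr rfl fun j _ => ?_
    rw [smul_mul_assoc, map_smul, smul_eq_mul, mul_comm (y j), mul_comm]
    rfl
  refine ⟨?_, hsurj⟩
  -- A finite free module is isomorphic to its dual, so surjectivity becomes that of an endomorphism
  -- of a finite module, which is then injective.
  let E : (A →ₗ[B] B) ≃ₗ[B] A := (b.constr B).symm.trans b.equivFun.symm
  have : Module.Finite B A := Module.Finite.of_basis b
  have hE : Function.Injective (E.toLinearMap ∘ₗ Φ) :=
    OrzechProperty.injective_of_surjective_endomorphism _ (E.surjective.comp hsurj)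
  exact fun x y hxy => hE (congrArg E hxy)

/-! ### Polynomials restricted to a set of variables, and linear forms. -/

/-- The restriction homomorphism to the variables in `S`, which sends the others to `0`. -/
noncomputable def restrictVars {V : Type} (K : Type u) [Field K] [DecidableEq V] (S : Finset V) :
    MvPolynomial V K →ₐ[K] MvPolynomial V K :=
  aeval fun v => if v ∈ S then X v else 0

theorem coeff_restrictVars {V : Type} {K : Type u} [Field K] [DecidableEq V] (S : Finset V)
    (f : MvPolynomial V K) (a : V →₀ ℕ) :
    coeff a (restrictVars K S f) = if a.support ⊆ S then coeff a f else 0 := by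
  induction f using MvPolynomial.induction_on' with
  | add p q hp hq => rw [map_add, coeff_add, hp, hq, coeff_add]; split_ifs <;> simp
  | monomial b c =>
    have h : restrictVars K S (monomial b c) = if b.support ⊆ S then monomial b c else 0 := by
      rw [restrictVars, aeval_monomial]
      split_ifs with hb
      · rw [monomial_eq, algebraMap_eq]
        congr 1
        exact Finset.prod_congr rfl fun v hv => by simp only [if_pos (hb hv)]
      · obtain ⟨v, hv, hvS⟩ := Finset.not_subset.mp hb
        rw [Finsupp.prod, Finset.prod_eq_zero hv, mul_zero]
        rw [if_neg hvS, zero_pow (Finsupp.mem_support_iff.mp hv)]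
    rw [h]
    split_ifs with h1 h2 h2
    · rfl
    · rw [coeff_monomial, if_neg]
      rintro rfl
      exact h2 h1
    · rw [coeff_monomial, if_neg, coeff_zero]
      rintro rfl
      exact h1 h2
    · exact coeff_zero _

theorem restrictVars_eq_zero_iff {V : Type} {K : Type u} [Field K] [DecidableEq V] (S : Finset V)
    (f : MvPolynomial V K) :
    restrictVars K S f = 0 ↔ ∀ a ∈ f.support, ¬ a.support ⊆ S := by
  rw [MvPolynomial.ext_iff]
  simp only [coeff_restrictVars, coeff_zero, ite_eq_right_iff, mem_support_iff]
  exact forall_congr' fun a => ⟨fun h h1 h2 => h1 (h h2), fun h h1 => by_contra fun h2 => h h2 h1⟩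

theorem prod_X_eq_monomial {V : Type} {K : Type u} [Field K] [DecidableEq V] (S : Finset V) :
    (∏ v ∈ S, X v : MvPolynomial V K) = monomial (Finsupp.indicator S fun _ _ => 1) 1 := by
  rw [monomial_eq, C_1, one_mul, Finsupp.prod]
  have : (Finsupp.indicator S fun _ _ => 1).support = S := by
    ext v
    simp [Finsupp.indicator_apply]
  rw [this]
  refine Finset.prod_congr rfl fun v hv => ?_
  rw [Finsupp.indicator_of_mem hv, pow_one]

/-- A polynomial all of whose monomials involve all the variables in `S` is divisible
by their product. -/
theorem exists_eq_prod_X_mul {V : Type} {K : Type u} [Field K] [DecidableEq V] (S : Finset V)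
    (f : MvPolynomial V K) (e : ℕ) (hf : f.IsHomogeneous e)
    (h : ∀ a ∈ f.support, S ⊆ a.support) :
    ∃ g : MvPolynomial V K, f = (∏ v ∈ S, X v) * g ∧ g.IsHomogeneous (e - S.card) ∧
      (e < S.card → g = 0) := by
  set s : V →₀ ℕ := Finsupp.indicator S fun _ _ => 1 with hs
  have hle : ∀ a ∈ f.support, s ≤ a := by
    intro a ha v
    rw [hs, Finsupp.indicator_apply]
    split_ifs with hv
    · exact Nat.one_le_iff_ne_zero.mpr (Finsupp.mem_support_iff.mp (h a ha hv))
    · exact Nat.zero_le _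
  have hdeg : s.degree = S.card := by
    have hsup : s.support = S := by
      ext v
      simp [hs, Finsupp.indicator_apply]
    rw [Finsupp.degree_apply, hsup, Finset.card_eq_sum_ones]
    exact Finset.sum_congr rfl fun v hv => Finsupp.indicator_of_mem hv _
  have hfe : f = monomial s 1 * (divMonomial f s) := by
    have h0 : modMonomial f s = 0 := by
      ext a
      rw [coeff_zero]
      by_cases ha : s ≤ a
      · exact coeff_modMonomial_of_le f ha
      · rw [coeff_modMonomial_of_not_le f ha]
        by_contra hne
        exact ha (hle a (mem_support_iff.mpr hne))
    conv_lhs => rw [← divMonomial_add_modMonomial f s, h0, add_zero]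
  have hcoeff : ∀ a, coeff a (divMonomial f s) ≠ 0 → S.card + a.degree = e := by
    intro a ha
    rw [coeff_divMonomial] at ha
    have := hf ha
    rw [← hdeg, ← map_add]
    exact (DFunLike.congr_fun Finsupp.degree_eq_weight_one (s + a)).trans this
  refine ⟨divMonomial f s, by rw [prod_X_eq_monomial]; exact hfe, ?_, ?_⟩
  · intro a ha
    have := hcoeff a ha
    refine (DFunLike.congr_fun Finsupp.degree_eq_weight_one a).symm.trans ?_
    omega
  · intro he
    ext a
    rw [coeff_zero]
    by_contra ha
    have := hcoeff a ha
    omega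

/-- The linear form with the given coefficients. -/
noncomputable def linForm {ι : Type} {K : Type u} [Field K] [Fintype ι] (c : ι → K) :
    MvPolynomial ι K :=
  ∑ k, C (c k) * X k

theorem linForm_isHomogeneous {ι : Type} {K : Type u} [Field K] [Fintype ι] (c : ι → K) :
    (linForm c).IsHomogeneous 1 := by
  refine IsHomogeneous.sum _ _ _ fun k _ => ?_
  simpa using (isHomogeneous_C ι (c k)).mul (isHomogeneous_X K k)

/-! ### Stanley–Reisner rings of shelled fans. -/

/-- The facets of a complete unimodular fan with vertices `V`, with the dual bases of their
vertices and with a shelling. -/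
structure ShelledFan (K : Type u) [Field K] (V ι : Type) [Fintype V] [DecidableEq V] [Fintype ι]
    [DecidableEq ι] where
  facets : Finset (Finset V)
  apex : Finset V
  vec : V → ι → K
  dual : Finset V → V → ι → K
  restr : Finset V → Finset V
  rank : Finset V → ℚ
  nonempty : facets.Nonempty
  apex_subset : ∀ F ∈ facets, apex ⊆ F
  card_eq : ∀ F ∈ facets, ∀ G ∈ facets, F.card = G.card
  dual_self : ∀ F ∈ facets, ∀ v ∈ F, ∀ w ∈ F, ∑ k, dual F v k * vec w k = if v = w then 1 else 0
  dual_complete : ∀ F ∈ facets, ∀ k j,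
    ∑ v ∈ F, vec v k * dual F v j = if k = j then 1 else 0
  rank_injOn : Set.InjOn rank facets
  -- A vertex of `F` outside the apex lies in `restr F` when the facet across the opposite wall
  -- comes earlier, and in the complement when it comes later. The next two fields say that the same
  -- order is a shelling read forwards and backwards.
  restr_subset : ∀ F ∈ facets, restr F ⊆ F \ apex
  le_of_restr_subset : ∀ F ∈ facets, ∀ G ∈ facets, restr F ⊆ G → rank F ≤ rank G
  le_of_compl_subset : ∀ F ∈ facets, ∀ G ∈ facets, (F \ apex) \ restr F ⊆ G → rank G ≤ rank F
  exists_lt : ∀ F ∈ facets, ∀ v ∈ restr F, ∃ G ∈ facets, rank G < rank F ∧ F.erase v ⊆ G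
  exists_gt : ∀ F ∈ facets, ∀ v ∈ (F \ apex) \ restr F,
    ∃ G ∈ facets, rank F < rank G ∧ F.erase v ⊆ G
  wall_unique : ∀ F ∈ facets, ∀ v ∈ F, ∀ G ∈ facets, ∀ H ∈ facets, G ≠ F → H ≠ F →
    F.erase v ⊆ G → F.erase v ⊆ H → G = H

namespace ShelledFan

variable {K : Type u} [Field K] {V ι : Type} [Fintype V] [DecidableEq V] [Fintype ι]
  [DecidableEq ι] (D : ShelledFan K V ι)

/-- The restriction of polynomials in the vertices to a facet. -/
noncomputable def eval (F : Finset V) : MvPolynomial V K →ₐ[K] MvPolynomial ι K :=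
  aeval fun v => if v ∈ F then linForm (D.dual F v) else 0

/-- The inclusion of the polynomial functions. -/
noncomputable def param : MvPolynomial ι K →ₐ[K] MvPolynomial V K :=
  aeval fun k => linForm fun v => D.vec v k

/-- The Stanley–Reisner ideal of the fan. -/
noncomputable def ideal : Ideal (MvPolynomial V K) :=
  ⨅ F ∈ D.facets, RingHom.ker (D.eval F)

theorem mem_ideal {f : MvPolynomial V K} : f ∈ D.ideal ↔ ∀ F ∈ D.facets, D.eval F f = 0 := by
  simp [ideal, RingHom.mem_ker]

/-- On the cone of `F`, the piecewise linear function with value `vec v k` at each vertex `v` is the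
coordinate `X k`; this is `dual_complete`. -/
theorem eval_param {F : Finset V} (hF : F ∈ D.facets) (b : MvPolynomial ι K) :
    D.eval F (D.param b) = b := by
  suffices h : (D.eval F).comp D.param = AlgHom.id K _ from DFunLike.congr_fun h b
  refine algHom_ext fun k => ?_
  rw [AlgHom.comp_apply, param, aeval_X, linForm, map_sum]
  simp only [map_mul, eval, aeval_X, mul_ite, mul_zero]
  simp only [algHom_C, algebraMap_eq, Finset.sum_ite_mem, Finset.univ_inter, AlgHom.id_apply]
  simp only [linForm, Finset.mul_sum]
  rw [Finset.sum_comm]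
  have : ∀ j : ι, ∑ v ∈ F, C (D.vec v k) * (C (D.dual F v j) * X j) =
      if k = j then (X j : MvPolynomial ι K) else 0 := by
    intro j
    simp only [← mul_assoc, ← C_mul]
    rw [← Finset.sum_mul, ← map_sum, D.dual_complete F hF]
    split_ifs <;> simp
  simp [this]

theorem eval_restrictVars (F : Finset V) (f : MvPolynomial V K) :
    D.eval F (restrictVars K F f) = D.eval F f := by
  suffices h : (D.eval F).comp (restrictVars K F) = D.eval F from DFunLike.congr_fun h f
  refine algHom_ext fun v => ?_
  rw [AlgHom.comp_apply, restrictVars, aeval_X]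
  split_ifs with hv
  · rfl
  · rw [map_zero, eval, aeval_X, if_neg hv]

theorem param_linForm (c : ι → K) :
    D.param (linForm c) = linForm fun v => ∑ k, c k * D.vec v k := by
  rw [linForm, map_sum]
  simp only [map_mul, algHom_C, algebraMap_eq, param, aeval_X]
  simp only [linForm, Finset.mul_sum, map_sum, C_mul, Finset.sum_mul, mul_assoc]
  exact Finset.sum_comm

/-- Evaluation on a facet can be undone up to the variables outside it, since the vectors of the
facet form a basis. Therefore the kernel of `eval F` is generated by these variables, and `ideal` is
a monomial ideal. -/
theorem restrictVars_param_eval {F : Finset V} (hF : F ∈ D.facets) (f : MvPolynomial V K) :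
    restrictVars K F (D.param (D.eval F f)) = restrictVars K F f := by
  suffices h : ((restrictVars K F).comp D.param).comp (D.eval F) = restrictVars K F from
    DFunLike.congr_fun h f
  refine algHom_ext fun v => ?_
  rw [AlgHom.comp_apply, AlgHom.comp_apply, eval, aeval_X]
  split_ifs with hv
  · rw [D.param_linForm, linForm, map_sum]
    simp only [map_mul, restrictVars, aeval_X, algHom_C, algebraMap_eq, mul_ite, mul_zero,
      Finset.sum_ite_mem, Finset.univ_inter]
    rw [Finset.sum_congr rfl fun w hw => by rw [D.dual_self F hF v hv w hw]]
    simp [hv]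
  · simp [restrictVars, hv]

theorem eval_eq_zero_iff {F : Finset V} (hF : F ∈ D.facets) (f : MvPolynomial V K) :
    D.eval F f = 0 ↔ ∀ a ∈ f.support, ¬ a.support ⊆ F := by
  rw [← restrictVars_eq_zero_iff]
  constructor
  · intro h
    rw [← D.restrictVars_param_eval hF, h, map_zero, map_zero]
  · intro h
    rw [← D.eval_restrictVars, h, map_zero]

theorem mem_ideal_iff {f : MvPolynomial V K} :
    f ∈ D.ideal ↔ ∀ F ∈ D.facets, ∀ a ∈ f.support, ¬ a.support ⊆ F := by
  rw [mem_ideal]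
  exact forall₂_congr fun F hF => D.eval_eq_zero_iff hF f

theorem eval_prod_X_eq_zero_iff {F : Finset V} (hF : F ∈ D.facets) (S : Finset V) :
    D.eval F (∏ v ∈ S, X v) = 0 ↔ ¬ S ⊆ F := by
  classical
  rw [D.eval_eq_zero_iff hF, prod_X_eq_monomial, support_monomial, if_neg one_ne_zero]
  have : (Finsupp.indicator S fun _ _ => 1).support = S := by
    ext v
    simp [Finsupp.indicator_apply]
  simp [this]

/-- The coordinate ring. -/
def CoordRing : Type u := MvPolynomial V K ⧸ D.ideal

noncomputable instance : CommRing D.CoordRing :=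
  inferInstanceAs (CommRing (MvPolynomial V K ⧸ D.ideal))

instance : IsNoetherianRing D.CoordRing :=
  inferInstanceAs (IsNoetherianRing (MvPolynomial V K ⧸ D.ideal))

/-- The projection to the coordinate ring. -/
noncomputable def toCoord : MvPolynomial V K →+* D.CoordRing := Ideal.Quotient.mk D.ideal

theorem toCoord_surjective : Function.Surjective D.toCoord := Ideal.Quotient.mk_surjective

theorem toCoord_eq_zero_iff {f : MvPolynomial V K} : D.toCoord f = 0 ↔ f ∈ D.ideal :=
  Ideal.Quotient.eq_zero_iff_mem

/-- The coordinate ring is an algebra over the polynomial functions. -/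
noncomputable instance : Algebra (MvPolynomial ι K) D.CoordRing :=
  (D.toCoord.comp D.param.toRingHom).toAlgebra

theorem smul_toCoord (b : MvPolynomial ι K) (f : MvPolynomial V K) :
    b • D.toCoord f = D.toCoord (D.param b * f) := by
  rw [Algebra.smul_def, map_mul]
  rfl

/-- The type of the facets, ordered by the shelling. -/
@[ext]
structure Facet where
  val : Finset V
  property : val ∈ D.facets

noncomputable instance : Fintype D.Facet :=
  Fintype.ofInjective (fun F => (⟨F.val, F.property⟩ : {F // F ∈ D.facets}))
    fun _ _ h => Facet.ext (congrArg Subtype.val h)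

noncomputable instance : LinearOrder D.Facet :=
  LinearOrder.lift' (fun F => D.rank F.val) fun F G h =>
    Facet.ext (D.rank_injOn F.property G.property h)

/-- The restriction to a facet, on the coordinate ring. -/
noncomputable def evalQuotient (F : D.Facet) :
    D.CoordRing →ₐ[MvPolynomial ι K] MvPolynomial ι K :=
  { Ideal.Quotient.lift D.ideal (D.eval F.val).toRingHom
      (fun _ hf => D.mem_ideal.mp hf F.val F.property) with
    commutes' := fun b => (D.eval_param F.property b : _) }

theorem evalQuotient_toCoord (F : D.Facet) (f : MvPolynomial V K) :
    D.evalQuotient F (D.toCoord f) = D.eval F.val f := rfl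

/-- The class of the product of the variables in `S`. -/
noncomputable def mon (S : Finset V) : D.CoordRing := D.toCoord (∏ v ∈ S, X v)

theorem evalQuotient_mon_ne_zero (F : D.Facet) (S : Finset V) :
    D.evalQuotient F (D.mon S) ≠ 0 ↔ S ⊆ F.val := by
  rw [mon, evalQuotient_toCoord, Ne, D.eval_prod_X_eq_zero_iff F.property, not_not]

theorem quotient_ext {a : D.CoordRing} (h : ∀ F, D.evalQuotient F a = 0) :
    a = 0 := by
  obtain ⟨f, rfl⟩ := D.toCoord_surjective a
  rw [toCoord_eq_zero_iff, mem_ideal]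
  exact fun F hF => h ⟨F, hF⟩

/-- The classes of the homogeneous polynomials of degree `e` are combinations of the shelling
monomials of degree at most `e`. -/
theorem toCoord_mem_span_of_isHomogeneous {e : ℕ} {f : MvPolynomial V K} (hf : f.IsHomogeneous e) :
    D.toCoord f ∈ Submodule.span (MvPolynomial ι K)
      ((fun F : D.Facet => D.mon (D.restr F.val)) ''
        {F | (D.restr F.val).card ≤ e}) := by
  refine mem_span_of_triangular_evaluations D.evalQuotient _ (fun a => D.quotient_ext) ?_
    {a | ∃ f : MvPolynomial V K, f.IsHomogeneous e ∧ a = D.toCoord f} _ ?_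
    ⟨f, hf, rfl⟩
  · intro F G h
    rw [evalQuotient_mon_ne_zero] at h
    exact D.le_of_restr_subset F.val F.property G.val G.property h
  · rintro a ⟨f, hf, rfl⟩ F hF
    have hres : (restrictVars K F.val f).IsHomogeneous e := by
      intro a ha
      rw [coeff_restrictVars] at ha
      exact hf (by split_ifs at ha; exacts [ha, absurd rfl ha])
    -- `f` vanishes on all earlier facets, and for `v` in `restr F` the set `F.erase v` lies in one
    -- of them. So a monomial of `f` supported on `F` involves every such `v`.
    obtain ⟨g, hg, hghom, hg0⟩ := exists_eq_prod_X_mul (D.restr F.val) _ e hres (by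
      intro a ha v hv
      by_contra hva
      obtain ⟨G, hG, hlt, hsub⟩ := D.exists_lt F.val F.property v hv
      rw [mem_support_iff, coeff_restrictVars] at ha
      split_ifs at ha with haF
      · refine (D.eval_eq_zero_iff hG f).mp (hF ⟨G, hG⟩ hlt) a (mem_support_iff.mpr ha) ?_
        intro w hw
        refine hsub (Finset.mem_erase.mpr ⟨?_, haF hw⟩)
        rintro rfl
        exact hva hw
      · exact ha rfl)
    have hb : (D.eval F.val g).IsHomogeneous (e - (D.restr F.val).card) := by
      have := hghom.aeval (n := 1) (fun v => if v ∈ F.val then linForm (D.dual F.val v) else 0)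
        (fun v => by
          split_ifs
          exacts [linForm_isHomogeneous _, isHomogeneous_zero _ _ _])
      rwa [one_mul] at this
    refine ⟨D.eval F.val g, ?_, ?_, ?_⟩
    · rw [evalQuotient_toCoord, mon, evalQuotient_toCoord, ← D.eval_restrictVars F.val f, hg, map_mul,
        mul_comm]
    · refine ⟨f - D.param (D.eval F.val g) * ∏ v ∈ D.restr F.val, X v, ?_, ?_⟩
      -- Here the subtraction in the degree of `g` is truncated, but `g` is zero and nothing is
      -- subtracted from `f`.
      · by_cases he : e < (D.restr F.val).card
        · rwa [hg0 he, map_zero, map_zero, zero_mul, sub_zero]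
        · refine hf.sub ?_
          have h1 : (D.param (D.eval F.val g)).IsHomogeneous (e - (D.restr F.val).card) := by
            have := hb.aeval (n := 1) (fun k => linForm fun v => D.vec v k)
              (fun k => linForm_isHomogeneous _)
            rwa [one_mul] at this
          have h2 : (∏ v ∈ D.restr F.val, (X v : MvPolynomial V K)).IsHomogeneous
              (D.restr F.val).card := by
            simpa using IsHomogeneous.prod (D.restr F.val) (fun v => (X v : MvPolynomial V K))
              (fun _ => 1) (fun v _ => isHomogeneous_X K v)
          have h3 := h1.mul h2
          rwa [Nat.sub_add_cancel (not_lt.mp he)] at h3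
      · rw [map_sub, mon, smul_toCoord]
    · intro h
      rw [hg0 (not_le.mp h), map_zero]

theorem toCoord_mem_span (f : MvPolynomial V K) :
    D.toCoord f ∈ Submodule.span (MvPolynomial ι K)
      (Set.range fun F : D.Facet => D.mon (D.restr F.val)) := by
  rw [← sum_homogeneousComponent f, map_sum]
  refine Submodule.sum_mem _ fun e _ => ?_
  exact Submodule.span_mono (Set.image_subset_range _ _)
    (D.toCoord_mem_span_of_isHomogeneous (homogeneousComponent_isHomogeneous e f))

theorem evalQuotient_restr_ne_zero (F G : D.Facet)
    (h : D.evalQuotient G (D.mon (D.restr F.val)) ≠ 0) : F ≤ G := by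
  rw [evalQuotient_mon_ne_zero] at h
  exact D.le_of_restr_subset _ F.property _ G.property h

/-- The shelling basis of the coordinate ring over the polynomial functions. -/
noncomputable def basis : Module.Basis D.Facet (MvPolynomial ι K) D.CoordRing :=
  Module.Basis.mk (v := fun F : D.Facet => D.mon (D.restr F.val))
    (linearIndependent_of_triangular_evaluations D.evalQuotient _ D.evalQuotient_restr_ne_zero
      fun F => by
        rw [evalQuotient_mon_ne_zero]
        exact (D.restr_subset _ F.property).trans Finset.sdiff_subset)
    (fun a _ => by
      obtain ⟨f, rfl⟩ := D.toCoord_surjective a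
      exact D.toCoord_mem_span f)

theorem basis_apply (F : D.Facet) : D.basis F = D.mon (D.restr F.val) := by
  rw [basis, Module.Basis.mk_apply]

instance : Nonempty D.Facet := D.nonempty.elim fun F hF => ⟨⟨F, hF⟩⟩

/-- The last facet of the shelling. -/
noncomputable def last : D.Facet := Finset.univ.max' (Finset.univ_nonempty)

theorem le_last (F : D.Facet) : F ≤ D.last := Finset.le_max' _ _ (Finset.mem_univ F)

theorem restr_last : D.restr D.last.val = D.last.val \ D.apex := by
  refine Finset.Subset.antisymm (D.restr_subset _ D.last.property) fun v hv => ?_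
  by_contra hvr
  obtain ⟨G, hG, hlt, -⟩ := D.exists_gt _ D.last.property v (Finset.mem_sdiff.mpr ⟨hv, hvr⟩)
  exact absurd (D.le_last ⟨G, hG⟩) (not_le.mpr hlt)

/-- The trace form: the coordinate at the last facet of the shelling. -/
noncomputable def trace : D.CoordRing →ₗ[MvPolynomial ι K] MvPolynomial ι K :=
  D.basis.coord D.last

/-- A monomial of lower degree only involves shelling monomials of lower degree, while the one of
the last facet has the full degree by `restr_last`. -/
theorem trace_eq_zero_of_card_lt {S : Finset V} (hS : S.card < (D.last.val \ D.apex).card) :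
    D.trace (D.mon S) = 0 := by
  have hhom : (∏ v ∈ S, (X v : MvPolynomial V K)).IsHomogeneous S.card := by
    simpa using IsHomogeneous.prod S (fun v => (X v : MvPolynomial V K))
      (fun _ => 1) (fun v _ => isHomogeneous_X K v)
  have h := D.toCoord_mem_span_of_isHomogeneous hhom
  change D.mon S ∈ _ at h
  refine Submodule.span_induction (p := fun a _ => D.trace a = 0) ?_ (map_zero _) ?_ ?_ h
  · rintro _ ⟨F, hF, rfl⟩
    change D.basis.coord D.last (D.mon (D.restr F.val)) = 0
    rw [← basis_apply, Module.Basis.coord_apply, Module.Basis.repr_self,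
      Finsupp.single_eq_of_ne]
    rintro rfl
    rw [Set.mem_ofPred_eq, restr_last] at hF
    omega
  · intro a b _ _ ha hb
    rw [map_add, ha, hb, add_zero]
  · intro r a _ ha
    rw [map_smul, ha, smul_zero]

theorem card_sdiff_apex (F G : D.Facet) : (F.val \ D.apex).card = (G.val \ D.apex).card := by
  rw [Finset.card_sdiff_of_subset (D.apex_subset _ F.property),
    Finset.card_sdiff_of_subset (D.apex_subset _ G.property),
    D.card_eq _ F.property _ G.property]

theorem mon_eq_zero {S : Finset V} (h : ∀ F ∈ D.facets, ¬ S ⊆ F) : D.mon S = 0 :=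
  D.quotient_ext fun F => by
    by_contra hne
    exact h _ F.property ((D.evalQuotient_mon_ne_zero F S).mp hne)

theorem toCoord_X_mul_mon {v : V} {S : Finset V} (hv : v ∉ S) :
    D.toCoord (X v) * D.mon S = D.mon (insert v S) := by
  rw [mon, mon, Finset.prod_insert hv, map_mul]

theorem linForm_smul_mon (c : ι → K) (S : Finset V) :
    linForm c • D.mon S =
      ∑ v, D.toCoord (C (∑ k, c k * D.vec v k)) * (D.toCoord (X v) * D.mon S) := by
  rw [mon, smul_toCoord, param_linForm, linForm, map_mul, map_sum, Finset.sum_mul]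
  simp only [map_mul, mul_assoc]

/-- The value of the trace form on the product of the vertices of a facet is a nonzero
constant. -/
theorem trace_mon_facet (F : D.Facet) :
    ∃ c : K, c ≠ 0 ∧ D.trace (D.mon (F.val \ D.apex)) = C c := by
  induction F using WellFounded.induction (wellFounded_gt (α := D.Facet)) with
  | _ F ih =>
  -- Descending induction along the shelling: for the last facet the product is itself a basis
  -- element, and otherwise `F` is compared with a later facet `G` across a wall.
  by_cases hlast : (F.val \ D.apex) \ D.restr F.val = ∅
  · have hF : F = D.last := le_antisymm (D.le_last F)
      (D.le_of_compl_subset _ F.property _ D.last.property (by rw [hlast]; exact Finset.empty_subset _))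
    refine ⟨1, one_ne_zero, ?_⟩
    rw [hF, ← restr_last, ← basis_apply, trace, Module.Basis.coord_apply,
      Module.Basis.repr_self, Finsupp.single_eq_same, C_1]
  · obtain ⟨v, hv⟩ := Finset.nonempty_iff_ne_empty.mpr hlast
    obtain ⟨G, hG, hlt, hsub⟩ := D.exists_gt _ F.property v hv
    have hvF : v ∈ F.val := (Finset.mem_sdiff.mp (Finset.mem_sdiff.mp hv).1).1
    have hvC : v ∉ D.apex := (Finset.mem_sdiff.mp (Finset.mem_sdiff.mp hv).1).2
    obtain ⟨c, hc, hcG⟩ := ih ⟨G, hG⟩ hlt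
    have hGF : G ≠ F.val := by
      rintro rfl
      exact lt_irrefl _ hlt
    obtain ⟨w, hwG, hwF⟩ : ∃ w ∈ G, w ∉ F.val := by
      by_contra h
      push Not at h
      exact hGF (Finset.eq_of_subset_of_card_le h (D.card_eq _ F.property _ hG).le)
    have hGeq : G = insert w (F.val.erase v) := by
      symm
      refine Finset.eq_of_subset_of_card_le (Finset.insert_subset hwG hsub) ?_
      rw [Finset.card_insert_of_notMem (fun h => hwF (Finset.mem_of_mem_erase h)),
        Finset.card_erase_of_mem hvF, D.card_eq _ hG _ F.property]
      have := Finset.card_pos.mpr ⟨v, hvF⟩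
      omega
    have hwC : w ∉ D.apex := fun h => hwF (D.apex_subset _ F.property h)
    set W := (F.val \ D.apex).erase v with hW
    have hWF : insert v W = F.val \ D.apex :=
      Finset.insert_erase (Finset.mem_sdiff.mpr ⟨hvF, hvC⟩)
    have hWG : insert w W = G \ D.apex := by
      rw [hGeq, hW]
      ext x
      simp only [Finset.mem_insert, Finset.mem_erase, Finset.mem_sdiff]
      constructor
      · rintro (rfl | ⟨h1, h2, h3⟩)
        exacts [⟨Or.inl rfl, hwC⟩, ⟨Or.inr ⟨h1, h2⟩, h3⟩]
      · rintro ⟨rfl | ⟨h1, h2⟩, h3⟩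
        exacts [Or.inl rfl, Or.inr ⟨h1, h2, h3⟩]
    have hwW : w ∉ W := fun h =>
      hwF (Finset.mem_sdiff.mp (Finset.mem_of_mem_erase h)).1
    -- The linear function that is `1` at `v` and `0` on the wall `F.erase v`. Its value `a` at `w`
    -- is nonzero, since otherwise it would vanish on the basis given by `G`.
    set ℓ := D.dual F.val v with hℓ
    set a := ∑ k, ℓ k * D.vec w k with ha
    have ha0 : a ≠ 0 := by
      intro ha0
      have hz : ∀ x ∈ G, ∑ k, ℓ k * D.vec x k = 0 := by
        intro x hx
        rw [hGeq, Finset.mem_insert] at hx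
        rcases hx with rfl | hx
        · exact ha0
        · rw [hℓ, D.dual_self _ F.property v hvF x (Finset.mem_of_mem_erase hx),
            if_neg (Finset.ne_of_mem_erase hx).symm]
      have hℓ0 : ∀ j, ℓ j = 0 := by
        intro j
        have h1 : ∑ k, ℓ k * ∑ x ∈ G, D.vec x k * D.dual G x j = 0 := by
          simp only [Finset.mul_sum]
          rw [Finset.sum_comm]
          refine Finset.sum_eq_zero fun x hx => ?_
          simp only [← mul_assoc]
          rw [← Finset.sum_mul, hz x hx, zero_mul]
        simpa [D.dual_complete G hG] using h1
      have := D.dual_self _ F.property v hvF v hvF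
      simp [← hℓ, hℓ0] at this
    -- In the product of `ℓ` with the monomial of the wall, vertices of the wall have coefficient
    -- zero, and by `wall_unique` only `v` and `w` complete the wall to a face. The trace of the
    -- left side is zero for reasons of degree, so the traces at `F` and `G` are proportional.
    have hsum : linForm ℓ • D.mon W =
        D.mon (F.val \ D.apex) + D.toCoord (C a) * D.mon (G \ D.apex) := by
      rw [linForm_smul_mon, ← hWF, ← hWG, ← D.toCoord_X_mul_mon hwW,
        ← D.toCoord_X_mul_mon (Finset.notMem_erase v _)]
      have hvw : v ≠ w := by
        rintro rfl
        exact hwF hvF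
      rw [← Finset.sum_subset (Finset.subset_univ {v, w}), Finset.sum_pair hvw]
      · rw [hℓ, D.dual_self _ F.property v hvF v hvF, if_pos rfl, C_1, map_one, one_mul]
      · intro x _ hx
        simp only [Finset.mem_insert, Finset.mem_singleton, not_or] at hx
        by_cases hxF : x ∈ F.val
        · rw [hℓ, D.dual_self _ F.property v hvF x hxF, if_neg (Ne.symm hx.1), C_0, map_zero,
            zero_mul]
        · have hxW : x ∉ W := fun h => hxF (Finset.mem_sdiff.mp (Finset.mem_of_mem_erase h)).1
          rw [D.toCoord_X_mul_mon hxW, D.mon_eq_zero, mul_zero]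
          intro H hH hxH
          have hFH : F.val.erase v ⊆ H := by
            intro y hy
            by_cases hyC : y ∈ D.apex
            · exact D.apex_subset _ hH hyC
            · exact hxH (Finset.mem_insert_of_mem (Finset.mem_erase.mpr
                ⟨Finset.ne_of_mem_erase hy,
                  Finset.mem_sdiff.mpr ⟨Finset.mem_of_mem_erase hy, hyC⟩⟩))
          have hHF : H ≠ F.val := by
            rintro rfl
            exact hxF (hxH (Finset.mem_insert_self x W))
          have hGH := D.wall_unique _ F.property v hvF G hG H hH hGF hHF hsub hFH
          have hxG : x ∈ G := hGH ▸ hxH (Finset.mem_insert_self x W)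
          rw [hGeq, Finset.mem_insert] at hxG
          exact hxG.elim hx.2 fun h => hxF (Finset.mem_of_mem_erase h)
    have hcard : W.card < (D.last.val \ D.apex).card := by
      rw [← D.card_sdiff_apex F, ← hWF, Finset.card_insert_of_notMem (Finset.notMem_erase v _)]
      exact Nat.lt_succ_self _
    have htr := congrArg D.trace hsum
    have hCa : ∀ x : D.CoordRing, D.toCoord (C a) * x = (C a : MvPolynomial ι K) • x := by
      intro x
      obtain ⟨f, rfl⟩ := D.toCoord_surjective x
      rw [smul_toCoord, map_mul, show D.param (C a) = C a from D.param.commutes a]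
    rw [map_smul, D.trace_eq_zero_of_card_lt hcard, smul_zero, map_add, hCa, map_smul, hcG,
      smul_eq_mul, ← C_mul] at htr
    refine ⟨-(a * c), neg_ne_zero.mpr (mul_ne_zero ha0 hc), ?_⟩
    rw [C_neg]
    exact eq_neg_of_add_eq_zero_left htr.symm

theorem mon_mul_mon {S T : Finset V} (h : Disjoint S T) : D.mon S * D.mon T = D.mon (S ∪ T) := by
  rw [mon, mon, mon, Finset.prod_union h, map_mul]

/-- The shelling monomials are paired with the complementary monomials. If the product for `F` and
`G` is nonzero, some facet `H` contains both factors, and the forward and backward shelling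
conditions give `F ≤ H ≤ G`. On the diagonal the product is the full monomial of `F`, whose trace is
a nonzero constant. -/
theorem bijective_trace :
    Function.Bijective fun a : D.CoordRing => D.trace ∘ₗ LinearMap.mulLeft (MvPolynomial ι K) a := by
  refine bijective_trace_of_triangular D.basis
    (fun F => D.mon ((F.val \ D.apex) \ D.restr F.val)) D.trace ?_ ?_
  · intro F G h
    rw [basis_apply] at h
    obtain ⟨H, hH⟩ : ∃ H, D.evalQuotient H
        (D.mon (D.restr F.val) * D.mon ((G.val \ D.apex) \ D.restr G.val)) ≠ 0 := by
      by_contra hne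
      push Not at hne
      exact h (by rw [D.quotient_ext hne, map_zero])
    rw [map_mul] at hH
    have h1 := (D.evalQuotient_mon_ne_zero _ _).mp (left_ne_zero_of_mul hH)
    have h2 := (D.evalQuotient_mon_ne_zero _ _).mp (right_ne_zero_of_mul hH)
    exact (D.le_of_restr_subset _ F.property _ H.property h1).trans
      (D.le_of_compl_subset _ G.property _ H.property h2)
  · intro F
    rw [basis_apply, D.mon_mul_mon Finset.disjoint_sdiff,
      Finset.union_sdiff_of_subset (D.restr_subset _ F.property)]
    obtain ⟨c, hc, hcF⟩ := D.trace_mon_facet F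
    rw [hcF]
    exact hc.isUnit.map C

end ShelledFan

theorem isGorensteinRing_shelledFan {K : Type u} [Field K] {V : Type} [Fintype V] [DecidableEq V]
    {n : ℕ} (D : ShelledFan K V (Fin n)) : IsGorensteinRing (MvPolynomial V K ⧸ D.ideal) := by
  have := Module.Free.of_basis D.basis
  have := hasInjectiveDimensionLE_of_forall_hasProjectiveDimensionLE n
    (hasProjectiveDimensionLE_mvPolynomial K n) (ModuleCat.of _ (MvPolynomial (Fin n) K))
  exact isGorensteinRing_of_bijective_trace (A := D.CoordRing) n D.trace D.bijective_trace

/-! ### Shellings from strictly convex height functions. -/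

theorem exists_dual_of_injective {k : Type u} [Field k] {V ι : Type} [DecidableEq V] [Fintype ι]
    [DecidableEq ι] (F : Finset V) (vec : V → ι → k) (hcard : F.card = Fintype.card ι)
    (hinj : ∀ c : ι → k, (∀ v ∈ F, ∑ i, c i * vec v i = 0) → c = 0) :
    ∃ dual : V → ι → k,
      (∀ v ∈ F, ∀ w ∈ F, ∑ i, dual v i * vec w i = if v = w then 1 else 0) ∧
      (∀ i j, ∑ v ∈ F, vec v i * dual v j = if i = j then 1 else 0) := by
  let f : (ι → k) →ₗ[k] (F → k) :=
    { toFun := fun c v => ∑ i, c i * vec v.1 i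
      map_add' := fun c d => by ext v; simp [add_mul, Finset.sum_add_distrib]
      map_smul' := fun r c => by ext v; simp [Finset.mul_sum, mul_assoc] }
  have hf : Function.Injective f := by
    rw [injective_iff_map_eq_zero]
    exact fun c hc => hinj c fun v hv => congrFun hc ⟨v, hv⟩
  let E : (ι → k) ≃ₗ[k] (F → k) := LinearEquiv.ofBijective f ⟨hf,
    (LinearMap.injective_iff_surjective_of_finrank_eq_finrank (by simp [hcard])).mp hf⟩
  refine ⟨fun v => if h : v ∈ F then E.symm (Pi.single ⟨v, h⟩ 1) else 0, ?_, ?_⟩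
  · intro v hv w hw
    simp only [dif_pos hv]
    have := congrFun (E.apply_symm_apply (Pi.single ⟨v, hv⟩ 1)) ⟨w, hw⟩
    refine Eq.trans this ?_
    rw [Pi.single_apply]
    simp [eq_comm]
  · intro i j
    have h1 : E (Pi.single i 1) = ∑ v : F, vec v.1 i • (Pi.single v 1 : F → k) := by
      ext w
      change ∑ l, (Pi.single i 1 : ι → k) l * vec w.1 l = _
      simp [Pi.single_apply]
    have h2 := congrFun (E.symm_apply_apply (Pi.single i 1)) j
    rw [h1, map_sum] at h2
    simp only [map_smul, Finset.sum_apply, Pi.smul_apply, smul_eq_mul, Pi.single_apply] at h2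
    rw [← Finset.sum_coe_sort F]
    refine Eq.trans (Finset.sum_congr rfl fun v _ => ?_) (h2.trans (by simp [eq_comm]))
    simp only [dif_pos v.2]

/-- Over the infinite field `ℚ`, finitely many hyperplanes do not cover the dual space. -/
theorem exists_generic_vector {ι : Type} [Fintype ι] (S : Finset (ι → ℚ)) (hS : 0 ∉ S) :
    ∃ c : ι → ℚ, ∀ w ∈ S, ∑ i, c i * w i ≠ 0 := by
  obtain ⟨f, hf⟩ := Module.exists_dual_forall_apply_ne_zero (K := ℚ) (fun w : S => (w : ι → ℚ))
    fun w h => hS (h ▸ w.2)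
  classical
  refine ⟨fun i => f (Pi.single i 1), fun w hw => ?_⟩
  have h := hf ⟨w, hw⟩
  rw [LinearMap.pi_apply_eq_sum_univ f] at h
  refine ne_of_eq_of_ne (Finset.sum_congr rfl fun i _ => ?_) h
  rw [smul_eq_mul, mul_comm]
  congr 2
  exact congrArg f (_root_.funext fun j => by simp [Pi.single_apply, eq_comm])

/-- Coordinates with respect to a dual basis. -/
theorem eq_sum_dual {k : Type u} [Field k] {V ι : Type} [Fintype ι] [DecidableEq ι]
    {F : Finset V} {vec dual : V → ι → k}
    (hdual : ∀ i j, ∑ v ∈ F, vec v i * dual v j = if i = j then 1 else 0) (u : ι → k) (j : ι) :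
    u j = ∑ v ∈ F, (∑ i, u i * vec v i) * dual v j := by
  simp only [Finset.sum_mul]
  rw [Finset.sum_comm]
  simp only [mul_assoc, ← Finset.mul_sum, hdual]
  simp

/-- The `u F` are vertices of the polyhedron of all `y` with `⟨y, vec v⟩ ≤ height v`, and `F` is the
set of constraints tight at `u F`. As in the simplex algorithm, a generic objective `c` orders these
vertices, and its coordinates `crd F v` in the basis of `F` tell which edges at `u F` go up or down.
The shelling is constructed over `ℚ`; the field `K` only enters through the dual bases. -/
theorem exists_shelledFan (K : Type u) [Field K] {V ι : Type} [Fintype V] [DecidableEq V]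
    [Fintype ι] [DecidableEq ι] (facets : Finset (Finset V)) (hne : facets.Nonempty)
    (apex : Finset V) (hapex : ∀ F ∈ facets, apex ⊆ F)
    (hcard : ∀ F ∈ facets, F.card = Fintype.card ι)
    (vec : V → ι → ℤ)
    (hK : ∀ F ∈ facets, ∀ c : ι → K, (∀ v ∈ F, ∑ i, c i * (vec v i : K) = 0) → c = 0)
    (hQ : ∀ F ∈ facets, ∀ c : ι → ℚ, (∀ v ∈ F, ∑ i, c i * (vec v i : ℚ) = 0) → c = 0)
    (height : V → ℚ) (u : Finset V → ι → ℚ)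
    (hle : ∀ F ∈ facets, ∀ v, ∑ i, u F i * (vec v i : ℚ) ≤ height v)
    (heq : ∀ F ∈ facets, ∀ v, ∑ i, u F i * (vec v i : ℚ) = height v ↔ v ∈ F)
    (hwall : ∀ F ∈ facets, ∀ v ∈ F, v ∉ apex → ∃ G ∈ facets, G ≠ F ∧ F.erase v ⊆ G) :
    ∃ D : ShelledFan K V ι, D.facets = facets := by
  classical
  choose! dK hdK1 hdK2 using fun F (hF : F ∈ facets) =>
    exists_dual_of_injective F (fun v i => (vec v i : K)) (hcard F hF) (hK F hF)
  choose! dQ hdQ1 hdQ2 using fun F (hF : F ∈ facets) =>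
    exists_dual_of_injective F (fun v i => (vec v i : ℚ)) (hcard F hF) (hQ F hF)
  have hlt : ∀ F ∈ facets, ∀ v ∉ F, ∑ i, u F i * (vec v i : ℚ) < height v := fun F hF v hv =>
    lt_of_le_of_ne (hle F hF v) fun h => hv ((heq F hF v).mp h)
  have hsub : ∀ F ∈ facets, ∀ G ∈ facets, F ⊆ G → F = G := fun F hF G hG h =>
    Finset.eq_of_subset_of_card_le h (by rw [hcard F hF, hcard G hG])
  have hune : ∀ F ∈ facets, ∀ G ∈ facets, u F = u G → F = G := by
    intro F hF G hG h
    refine hsub F hF G hG fun v hv => (heq G hG v).mp ?_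
    rw [← h]
    exact (heq F hF v).mpr hv
  have hdne : ∀ F ∈ facets, ∀ v ∈ F, dQ F v ≠ 0 := by
    intro F hF v hv h
    have := hdQ1 F hF v hv v hv
    simp [h] at this
  -- Genericity makes all coordinates `crd F v` nonzero and separates the values at distinct
  -- vertices `u F`.
  obtain ⟨c, hc⟩ := exists_generic_vector
    (((facets ×ˢ (Finset.univ : Finset V)).image (fun p => dQ p.1 p.2) ∪
      (facets ×ˢ facets).image (fun p => u p.1 - u p.2)).erase 0) (Finset.notMem_erase _ _)
  let crd : Finset V → V → ℚ := fun F v => ∑ i, c i * dQ F v i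
  have hcrd : ∀ F ∈ facets, ∀ v ∈ F, crd F v ≠ 0 := fun F hF v hv =>
    hc _ (Finset.mem_erase.mpr ⟨hdne F hF v hv, Finset.mem_union_left _
      (Finset.mem_image.mpr ⟨(F, v), by simp [hF], rfl⟩)⟩)
  let rank : Finset V → ℚ := fun F => -∑ i, c i * u F i
  have hrank : Set.InjOn rank facets := by
    intro F hF G hG h
    by_contra hFG
    refine hc (u F - u G) (Finset.mem_erase.mpr ⟨fun h0 => hFG (hune F hF G hG
      (sub_eq_zero.mp h0)), Finset.mem_union_right _ (Finset.mem_image.mpr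
        ⟨(F, G), by simpa using ⟨hF, hG⟩, rfl⟩)⟩) ?_
    simp only [rank, neg_inj] at h
    simp only [Pi.sub_apply, mul_sub, Finset.sum_sub_distrib]
    rw [h, sub_self]
  -- The slacks `height v - ⟨u G, vec v⟩` are nonnegative and vanish exactly on `G`, so the sign of
  -- the difference is controlled by the `crd F v` with `v ∉ G`. All shelling conditions follow from
  -- this identity.
  have hdiff : ∀ F ∈ facets, ∀ G ∈ facets, rank G - rank F =
      ∑ v ∈ F, (height v - ∑ i, u G i * (vec v i : ℚ)) * crd F v := by
    intro F hF G hG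
    have h1 : ∀ w : ι → ℚ, ∑ j, c j * w j =
        ∑ v ∈ F, (∑ i, w i * (vec v i : ℚ)) * crd F v := by
      intro w
      simp only [crd]
      rw [Finset.sum_congr rfl fun j _ => by rw [eq_sum_dual (hdQ2 F hF) w j]]
      simp only [Finset.mul_sum]
      rw [Finset.sum_comm]
      refine Finset.sum_congr rfl fun v _ => Finset.sum_congr rfl fun j _ => ?_
      ring
    simp only [rank]
    rw [h1 (u F), h1 (u G), neg_sub_neg, ← Finset.sum_sub_distrib]
    refine Finset.sum_congr rfl fun v hv => ?_
    rw [(heq F hF v).mpr hv, sub_mul]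
  let restr : Finset V → Finset V := fun F => (F \ apex).filter fun v => crd F v < 0
  have hwallrank : ∀ F ∈ facets, ∀ v ∈ F, v ∉ apex → ∃ G ∈ facets, G ≠ F ∧ F.erase v ⊆ G ∧
      ∃ t : ℚ, 0 < t ∧ rank G - rank F = t * crd F v := by
    intro F hF v hv hva
    obtain ⟨G, hG, hGF, hFG⟩ := hwall F hF v hv hva
    have hvG : v ∉ G := by
      intro hvG
      refine hGF (hsub F hF G hG fun w hw => ?_).symm
      by_cases hwv : w = v
      · rwa [hwv]
      · exact hFG (Finset.mem_erase.mpr ⟨hwv, hw⟩)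
    refine ⟨G, hG, hGF, hFG, _, sub_pos.mpr (hlt G hG v hvG), ?_⟩
    rw [hdiff F hF G hG, Finset.sum_eq_single v]
    · intro w hw hwv
      rw [(heq G hG w).mpr (hFG (Finset.mem_erase.mpr ⟨hwv, hw⟩)), sub_self, zero_mul]
    · exact fun h => absurd hv h
  refine ⟨{
    facets := facets
    apex := apex
    vec := fun v i => (vec v i : K)
    dual := dK
    restr := restr
    rank := rank
    nonempty := hne
    apex_subset := hapex
    card_eq := fun F hF G hG => by rw [hcard F hF, hcard G hG]
    dual_self := hdK1
    dual_complete := hdK2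
    rank_injOn := hrank
    restr_subset := fun F _ => Finset.filter_subset _ _
    le_of_restr_subset := ?_
    le_of_compl_subset := ?_
    exists_lt := ?_
    exists_gt := ?_
    wall_unique := ?_ }, rfl⟩
  · intro F hF G hG h
    rw [← sub_nonneg, hdiff F hF G hG]
    refine Finset.sum_nonneg fun v hv => ?_
    by_cases hvG : v ∈ G
    · rw [(heq G hG v).mpr hvG, sub_self, zero_mul]
    · refine mul_nonneg (sub_nonneg.mpr (hle G hG v)) (not_lt.mp fun hneg => hvG (h ?_))
      exact Finset.mem_filter.mpr ⟨Finset.mem_sdiff.mpr ⟨hv, fun ha => hvG (hapex G hG ha)⟩, hneg⟩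
  · intro F hF G hG h
    rw [← sub_nonpos, hdiff F hF G hG]
    refine Finset.sum_nonpos fun v hv => ?_
    by_cases hvG : v ∈ G
    · rw [(heq G hG v).mpr hvG, sub_self, zero_mul]
    · refine mul_nonpos_of_nonneg_of_nonpos (sub_nonneg.mpr (hle G hG v))
        (not_lt.mp fun hpos => hvG (h ?_))
      refine Finset.mem_sdiff.mpr ⟨Finset.mem_sdiff.mpr ⟨hv, fun ha => hvG (hapex G hG ha)⟩, ?_⟩
      exact fun hr => lt_asymm hpos (Finset.mem_filter.mp hr).2
  · intro F hF v hv
    obtain ⟨hv1, hv2⟩ := Finset.mem_filter.mp hv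
    obtain ⟨hvF, hva⟩ := Finset.mem_sdiff.mp hv1
    obtain ⟨G, hG, -, hFG, t, ht, hr⟩ := hwallrank F hF v hvF hva
    exact ⟨G, hG, sub_neg.mp (hr ▸ mul_neg_of_pos_of_neg ht hv2), hFG⟩
  · intro F hF v hv
    obtain ⟨hv1, hv2⟩ := Finset.mem_sdiff.mp hv
    obtain ⟨hvF, hva⟩ := Finset.mem_sdiff.mp hv1
    obtain ⟨G, hG, -, hFG, t, ht, hr⟩ := hwallrank F hF v hvF hva
    refine ⟨G, hG, sub_pos.mp (hr ▸ mul_pos ht ?_), hFG⟩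
    refine lt_of_le_of_ne (not_lt.mp fun hneg => hv2 (Finset.mem_filter.mpr ⟨hv1, hneg⟩))
      (hcrd F hF v hvF).symm
  · intro F hF v hv G hG H hH hGF hHF hFG hFH
    by_contra hGH
    have hnot : ∀ G' ∈ facets, G' ≠ F → F.erase v ⊆ G' → v ∉ G' := by
      intro G' hG' hne' hFG' hvG
      refine hne' (hsub F hF G' hG' fun w hw => ?_).symm
      by_cases hwv : w = v
      · rwa [hwv]
      · exact hFG' (Finset.mem_erase.mpr ⟨hwv, hw⟩)
    have hex : ∀ G' ∈ facets, ∀ H' ∈ facets, G' ≠ H' → ∃ w ∈ G', w ∉ H' := by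
      intro G' hG' H' hH' hne'
      by_contra hcon
      push Not at hcon
      exact hne' (hsub G' hG' H' hH' hcon)
    -- Linear functions that agree on the wall differ by a multiple of `ℓ`. A vertex of a neighbour
    -- outside `F` has `ℓ < 0`; for two distinct neighbours the multiple for `u G - u H` would then
    -- have to be both negative and positive.
    let ℓ : V → ℚ := fun w => ∑ i, dQ F v i * (vec w i : ℚ)
    have hform : ∀ p q : ι → ℚ, (∀ w ∈ F.erase v, ∑ i, p i * (vec w i : ℚ) =
        ∑ i, q i * (vec w i : ℚ)) → ∀ w, ∑ i, p i * (vec w i : ℚ) - ∑ i, q i * (vec w i : ℚ) =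
        (∑ i, p i * (vec v i : ℚ) - ∑ i, q i * (vec v i : ℚ)) * ℓ w := by
      intro p q hpq w
      have h1 : ∀ j, (p - q) j = (∑ i, (p - q) i * (vec v i : ℚ)) * dQ F v j := by
        intro j
        rw [eq_sum_dual (hdQ2 F hF) (p - q) j, Finset.sum_eq_single v]
        · intro x hx hxv
          have := hpq x (Finset.mem_erase.mpr ⟨hxv, hx⟩)
          simp only [Pi.sub_apply, sub_mul, Finset.sum_sub_distrib]
          rw [this, sub_self]
        · exact fun h => absurd hv h
      simp only [ℓ, ← Finset.sum_sub_distrib, ← sub_mul, Finset.mul_sum]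
      refine Finset.sum_congr rfl fun i _ => ?_
      have := h1 i
      simp only [Pi.sub_apply] at this
      rw [this]
      ring
    have hval : ∀ G' ∈ facets, F.erase v ⊆ G' → ∀ w ∈ F.erase v,
        ∑ i, u G' i * (vec w i : ℚ) = height w := fun G' hG' h w hw => (heq G' hG' w).mpr (h hw)
    have hneg : ∀ G' ∈ facets, G' ≠ F → F.erase v ⊆ G' → ∀ w ∈ G', w ∉ F → ℓ w < 0 := by
      intro G' hG' hne' hFG' w hw hwF
      have h1 := hform (u F) (u G') (fun x hx => by
        rw [hval F hF (Finset.erase_subset _ _) x hx, hval G' hG' hFG' x hx]) w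
      rw [(heq F hF v).mpr hv, (heq G' hG' w).mpr hw] at h1
      have h2 := hlt F hF w hwF
      have h3 := hlt G' hG' v (hnot G' hG' hne' hFG')
      by_contra hcon
      have := mul_nonneg (sub_pos.mpr h3).le (not_lt.mp hcon)
      linarith
    obtain ⟨x, hxG, hxH⟩ := hex G hG H hH hGH
    obtain ⟨y, hyH, hyG⟩ := hex H hH G hG (Ne.symm hGH)
    have hx : ℓ x < 0 := hneg G hG hGF hFG x hxG fun hxF => hxH (hFH (Finset.mem_erase.mpr
      ⟨fun h => hnot G hG hGF hFG (h ▸ hxG), hxF⟩))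
    have hy : ℓ y < 0 := hneg H hH hHF hFH y hyH fun hyF => hyG (hFG (Finset.mem_erase.mpr
      ⟨fun h => hnot H hH hHF hFH (h ▸ hyH), hyF⟩))
    have hGHform := hform (u G) (u H) (fun w hw => by
      rw [hval G hG hFG w hw, hval H hH hFH w hw])
    have h1 := hGHform x
    have h2 := hGHform y
    rw [(heq G hG x).mpr hxG] at h1
    rw [(heq H hH y).mpr hyH] at h2
    have h3 := hlt H hH x hxH
    have h4 := hlt G hG y hyG
    nlinarith

theorem isGorensteinRing_of_regular_fan (K : Type u) [Field K] {V : Type} [Fintype V]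
    [DecidableEq V] {n : ℕ} (facets : Finset (Finset V)) (hne : facets.Nonempty)
    (apex : Finset V) (hapex : ∀ F ∈ facets, apex ⊆ F)
    (hcard : ∀ F ∈ facets, F.card = n)
    (vec : V → Fin n → ℤ)
    (hK : ∀ F ∈ facets, ∀ c : Fin n → K, (∀ v ∈ F, ∑ i, c i * (vec v i : K) = 0) → c = 0)
    (hQ : ∀ F ∈ facets, ∀ c : Fin n → ℚ, (∀ v ∈ F, ∑ i, c i * (vec v i : ℚ) = 0) → c = 0)
    (height : V → ℚ) (u : Finset V → Fin n → ℚ)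
    (hle : ∀ F ∈ facets, ∀ v, ∑ i, u F i * (vec v i : ℚ) ≤ height v)
    (heq : ∀ F ∈ facets, ∀ v, ∑ i, u F i * (vec v i : ℚ) = height v ↔ v ∈ F)
    (hwall : ∀ F ∈ facets, ∀ v ∈ F, v ∉ apex → ∃ G ∈ facets, G ≠ F ∧ F.erase v ⊆ G)
    (I : Ideal (MvPolynomial V K))
    (hI : ∀ f, f ∈ I ↔ ∀ F ∈ facets, ∀ a ∈ f.support, ¬ a.support ⊆ F) :
    IsGorensteinRing (MvPolynomial V K ⧸ I) := by
  obtain ⟨D, rfl⟩ := exists_shelledFan K facets hne apex hapex (by simpa using hcard) vec hK hQ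
    height u hle heq hwall
  have : I = D.ideal := by
    ext f
    rw [hI, D.mem_ideal_iff]
  rw [this]
  exact isGorensteinRing_shelledFan D

/-! ### Boxes, nested sets and paths as sets of boxes. -/

theorem box_comm {n : ℕ} (i j : Fin n) : box i j = box j i := by
  simp only [box, min_comm, max_comm]

theorem box_row_of_le {n : ℕ} {i j : Fin n} (h : i ≤ j) : (box i j).row = i := min_eq_left h

theorem box_col_of_le {n : ℕ} {i j : Fin n} (h : i ≤ j) : (box i j).col = j := max_eq_right h

theorem box_row_col {n : ℕ} (x : Box n) : box x.row x.col = x :=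
  Box.ext (min_eq_left x.row_le_col) (max_eq_right x.row_le_col)

theorem box_eq_iff {n : ℕ} {i j k l : Fin n} :
    box i j = box k l ↔ (i = k ∧ j = l) ∨ (i = l ∧ j = k) := by
  simp only [box, Box.mk.injEq]
  constructor
  · rintro ⟨h1, h2⟩
    rcases le_total i j with h | h <;> rcases le_total k l with h' | h' <;>
      simp only [h, h', min_eq_left, min_eq_right, max_eq_left, max_eq_right] at h1 h2 <;>
      simp [h1, h2]
  · rintro (⟨rfl, rfl⟩ | ⟨rfl, rfl⟩)
    exacts [⟨rfl, rfl⟩, ⟨min_comm _ _, max_comm _ _⟩]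

/-- The index `a` is the row or the column of the box `x`. -/
def Box.HasIndex {n : ℕ} (x : Box n) (a : Fin n) : Prop := a = x.row ∨ a = x.col

theorem box_hasIndex {n : ℕ} {i j a : Fin n} : (box i j).HasIndex a ↔ a = i ∨ a = j := by
  rcases le_total i j with h | h
  · simp [Box.HasIndex, box, h]
  · simp [Box.HasIndex, box, h, or_comm]

/-- The intervals given by the boxes in `S` are nested. -/
def IsNestedSet {n : ℕ} (S : Finset (Box n)) : Prop :=
  ∀ x ∈ S, ∀ y ∈ S, ¬ (x.row < y.row ∧ x.col < y.col)

/-- The index `r` lies outside the range of `A`, and `e` is the end of `A` away from `r`. -/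
def IsBeyond {n : ℕ} (A : Finset (Fin n)) (e r : Fin n) : Prop :=
  (IsLeast (A : Set (Fin n)) e ∧ ∀ a ∈ A, a < r) ∨
    (IsGreatest (A : Set (Fin n)) e ∧ ∀ a ∈ A, r < a)

theorem IsBeyond.mem {n : ℕ} {A : Finset (Fin n)} {e r : Fin n} (h : IsBeyond A e r) : e ∈ A := by
  rcases h with h | h
  exacts [h.1.1, h.1.1]

theorem IsBeyond.notMem {n : ℕ} {A : Finset (Fin n)} {e r : Fin n} (h : IsBeyond A e r) :
    r ∉ A := by
  intro hr
  rcases h with h | h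
  exacts [lt_irrefl _ (h.2 r hr), lt_irrefl _ (h.2 r hr)]

theorem IsBeyond.ne {n : ℕ} {A : Finset (Fin n)} {e r : Fin n} (h : IsBeyond A e r) : e ≠ r :=
  fun her => h.notMem (her ▸ h.mem)

/-- The set of boxes of a path in the triangle over `A`, built up from the diagonal. -/
inductive IsPathSet {n : ℕ} : Finset (Fin n) → Finset (Box n) → Prop
  | single (a : Fin n) : IsPathSet {a} {box a a}
  | extend {A : Finset (Fin n)} {F : Finset (Box n)} {e r : Fin n} (h : IsPathSet A F)
      (hr : IsBeyond A e r) : IsPathSet (insert r A) (insert (box e r) F)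

namespace IsPathSet

variable {n : ℕ} {A : Finset (Fin n)} {F : Finset (Box n)}

theorem nonempty (h : IsPathSet A F) : A.Nonempty := by
  cases h <;> simp

theorem mem_of_hasIndex (h : IsPathSet A F) {x : Box n} (hx : x ∈ F) {a : Fin n}
    (ha : x.HasIndex a) : a ∈ A := by
  induction h with
  | single b =>
    rw [Finset.mem_singleton.mp hx, box_hasIndex] at ha
    simpa using ha
  | extend h hr ih =>
    rcases Finset.mem_insert.mp hx with rfl | hx
    · rw [box_hasIndex] at ha
      rcases ha with rfl | rfl
      exacts [Finset.mem_insert_of_mem hr.mem, Finset.mem_insert_self _ _]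
    · exact Finset.mem_insert_of_mem (ih hx)

theorem exists_hasIndex (h : IsPathSet A F) {a : Fin n} (ha : a ∈ A) :
    ∃ x ∈ F, x.HasIndex a := by
  induction h with
  | single b => exact ⟨box b b, by simp, by rw [box_hasIndex]; simpa using ha⟩
  | @extend A F e r h hr ih =>
    rcases Finset.mem_insert.mp ha with rfl | ha
    · exact ⟨_, Finset.mem_insert_self _ _, box_hasIndex.mpr (Or.inr rfl)⟩
    · obtain ⟨x, hx, hxa⟩ := ih ha
      exact ⟨x, Finset.mem_insert_of_mem hx, hxa⟩

theorem index_unique {A' : Finset (Fin n)} (h : IsPathSet A F) (h' : IsPathSet A' F) : A = A' := by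
  ext a
  constructor
  · intro ha
    obtain ⟨x, hx, hxa⟩ := h.exists_hasIndex ha
    exact h'.mem_of_hasIndex hx hxa
  · intro ha
    obtain ⟨x, hx, hxa⟩ := h'.exists_hasIndex ha
    exact h.mem_of_hasIndex hx hxa

theorem box_notMem (h : IsPathSet A F) {e r : Fin n} (hr : r ∉ A) : box e r ∉ F := fun hb =>
  hr (h.mem_of_hasIndex hb (box_hasIndex.mpr (Or.inr rfl)))

theorem card_eq (h : IsPathSet A F) : F.card = A.card := by
  induction h with
  | single b => simp
  | extend h hr ih =>
    rw [Finset.card_insert_of_notMem hr.notMem,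
      Finset.card_insert_of_notMem (h.box_notMem hr.notMem), ih]

theorem isNestedSet (h : IsPathSet A F) : IsNestedSet F := by
  induction h with
  | single b =>
    intro x hx y hy
    rw [Finset.mem_singleton.mp hx, Finset.mem_singleton.mp hy]
    exact fun h => lt_irrefl _ h.1
  | @extend A F e r h hr ih =>
    have key : ∀ y ∈ F, ¬ ((box e r).row < y.row ∧ (box e r).col < y.col) ∧
        ¬ (y.row < (box e r).row ∧ y.col < (box e r).col) := by
      intro y hy
      have h1 := h.mem_of_hasIndex hy (Or.inl rfl)
      have h2 := h.mem_of_hasIndex hy (Or.inr rfl)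
      rcases hr with ⟨he, hr⟩ | ⟨he, hr⟩
      · rw [box_row_of_le (hr e he.1).le, box_col_of_le (hr e he.1).le]
        exact ⟨fun h => lt_asymm h.2 (hr _ h2), fun h => absurd (he.2 h1) (not_le.mpr h.1)⟩
      · rw [box_comm, box_row_of_le (hr e he.1).le, box_col_of_le (hr e he.1).le]
        exact ⟨fun h => absurd (he.2 h2) (not_le.mpr h.2), fun h => lt_asymm h.1 (hr _ h1)⟩
    intro x hx y hy
    rcases Finset.mem_insert.mp hx with rfl | hx <;> rcases Finset.mem_insert.mp hy with rfl | hy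
    · exact fun h => lt_irrefl _ h.1
    · exact (key y hy).1
    · exact (key x hx).2
    · exact ih x hx y hy

end IsPathSet

/-- Let `p` and `q` be the ends of `A`. A box of row `p` and a box of column `q`, both different
from the corner, are not nested. So apart from the corner, one of the indices `p` and `q` does not
occur in `S`, and it can be removed from `A`. -/
theorem exists_isPathSet_superset {n : ℕ} {A : Finset (Fin n)} (hA : A.Nonempty)
    {S : Finset (Box n)} (hS : ∀ x ∈ S, x.row ∈ A ∧ x.col ∈ A) (hN : IsNestedSet S) :
    ∃ F, IsPathSet A F ∧ S ⊆ F := by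
  induction A using Finset.strongInduction generalizing S with
  | _ A ih =>
  set p := A.min' hA with hp
  set q := A.max' hA with hq
  have hpA : p ∈ A := A.min'_mem hA
  have hqA : q ∈ A := A.max'_mem hA
  have hpl : ∀ a ∈ A, p ≤ a := fun a ha => A.min'_le a ha
  have hql : ∀ a ∈ A, a ≤ q := fun a ha => A.le_max' a ha
  by_cases hpq : p = q
  · have hAp : A = {p} := Finset.eq_singleton_iff_unique_mem.mpr
      ⟨hpA, fun a ha => le_antisymm (hpq ▸ hql a ha) (hpl a ha)⟩
    refine ⟨{box p p}, hAp ▸ IsPathSet.single p, fun x hx => ?_⟩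
    have h := hS x hx
    rw [hAp, Finset.mem_singleton, Finset.mem_singleton] at h
    rw [Finset.mem_singleton, ← box_row_col x, h.1, h.2]
  have hlt : p < q := lt_of_le_of_ne (hpl q hqA) hpq
  have hcases : (∀ x ∈ S, x.row = p → x.col = q) ∨ (∀ x ∈ S, x.col = q → x.row = p) := by
    by_contra h
    push Not at h
    obtain ⟨⟨x, hx, hx1, hx2⟩, y, hy, hy1, hy2⟩ := h
    refine hN x hx y hy ⟨?_, ?_⟩
    · rw [hx1]
      exact lt_of_le_of_ne (hpl _ (hS y hy).1) (Ne.symm hy2)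
    · rw [hy1]
      exact lt_of_le_of_ne (hql _ (hS x hx).2) hx2
  have hsub : ∀ e r, IsBeyond (A.erase r) e r → r ∈ A → box e r = box p q →
      (∀ x ∈ S.erase (box p q), x.row ≠ r ∧ x.col ≠ r) → ∃ F, IsPathSet A F ∧ S ⊆ F := by
    intro e r hr hrA hbox hx
    obtain ⟨F, hF, hSF⟩ := ih (A.erase r) (Finset.erase_ssubset hrA) ⟨e, hr.mem⟩
      (S := S.erase (box p q))
      (fun x h => ⟨Finset.mem_erase.mpr ⟨(hx x h).1, (hS x (Finset.mem_of_mem_erase h)).1⟩,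
        Finset.mem_erase.mpr ⟨(hx x h).2, (hS x (Finset.mem_of_mem_erase h)).2⟩⟩)
      (fun x h y h' => hN x (Finset.mem_of_mem_erase h) y (Finset.mem_of_mem_erase h'))
    refine ⟨_, Finset.insert_erase hrA ▸ hF.extend hr, fun x h => ?_⟩
    by_cases hxb : x = box p q
    · rw [hxb, hbox]
      exact Finset.mem_insert_self _ _
    · exact Finset.mem_insert_of_mem (hSF (Finset.mem_erase.mpr ⟨hxb, h⟩))
  rcases hcases with h | h
  · refine hsub q p (Or.inr ⟨⟨Finset.mem_coe.mpr (Finset.mem_erase.mpr ⟨Ne.symm hpq, hqA⟩),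
      fun a ha => hql a (Finset.mem_of_mem_erase ha)⟩, fun a ha => lt_of_le_of_ne
        (hpl a (Finset.mem_of_mem_erase ha)) (Finset.ne_of_mem_erase ha).symm⟩) hpA
      (box_comm q p) fun x hx => ?_
    have hxS := Finset.mem_of_mem_erase hx
    have hrow : x.row ≠ p := fun h1 => Finset.ne_of_mem_erase hx (by
      rw [← box_row_col x, h1, h x hxS h1])
    exact ⟨hrow, fun h1 => hrow (le_antisymm (h1 ▸ x.row_le_col) (hpl _ (hS x hxS).1))⟩
  · refine hsub p q (Or.inl ⟨⟨Finset.mem_coe.mpr (Finset.mem_erase.mpr ⟨hpq, hpA⟩),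
      fun a ha => hpl a (Finset.mem_of_mem_erase ha)⟩, fun a ha => lt_of_le_of_ne
        (hql a (Finset.mem_of_mem_erase ha)) (Finset.ne_of_mem_erase ha)⟩) hqA
      rfl fun x hx => ?_
    have hxS := Finset.mem_of_mem_erase hx
    have hcol : x.col ≠ q := fun h1 => Finset.ne_of_mem_erase hx (by
      rw [← box_row_col x, h1, h x hxS h1])
    exact ⟨fun h1 => hcol (le_antisymm (hql _ (hS x hxS).2) (h1 ▸ x.row_le_col)), hcol⟩

/-- A box of a path can be replaced, unless its removal makes an index disappear. -/
theorem IsPathSet.exists_flip {n : ℕ} {A : Finset (Fin n)} {F : Finset (Box n)}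
    (h : IsPathSet A F) {v : Box n} (hv : v ∈ F) :
    (∃ a ∈ A, ∀ x ∈ F.erase v, ¬ x.HasIndex a) ∨
      ∃ G, IsPathSet A G ∧ G ≠ F ∧ F.erase v ⊆ G := by
  induction h with
  | single b =>
    left
    refine ⟨b, by simp, fun x hx => ?_⟩
    rw [Finset.mem_singleton.mp hv] at hx
    simp at hx
  | @extend A F e r h hr ih =>
    have hb : box e r ∉ F := h.box_notMem hr.notMem
    by_cases hvb : v = box e r
    · left
      refine ⟨r, Finset.mem_insert_self _ _, fun x hx hxr => ?_⟩
      rw [hvb, Finset.erase_insert hb] at hx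
      exact hr.notMem (h.mem_of_hasIndex hx hxr)
    have hvF : v ∈ F := (Finset.mem_insert.mp hv).resolve_left hvb
    have hFe : (insert (box e r) F).erase v = insert (box e r) (F.erase v) :=
      Finset.erase_insert_of_ne (Ne.symm hvb)
    rcases ih hvF with ⟨a, haA, ha⟩ | ⟨G, hG, hGF, hFG⟩
    -- If `a ≠ e`, the added box `(e, r)` does not have index `a`, which stays missing. If `a = e`,
    -- this box still covers it and the path is flipped at this place.
    · by_cases hae : a = e
      · subst hae
        right
        cases h with
        | single b =>
          have hab : a = b := by simpa using haA
          subst hab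
          have hva : v = box a a := by simpa using hvF
          have hr' : IsBeyond {r} r a := by
            rcases hr with ⟨-, hr⟩ | ⟨-, hr⟩
            · exact Or.inr ⟨by simp [IsGreatest], by simpa using hr⟩
            · exact Or.inl ⟨by simp [IsLeast], by simpa using hr⟩
          refine ⟨insert (box r a) {box r r}, ?_, ?_, ?_⟩
          · have := (IsPathSet.single r).extend hr'
            rwa [Finset.pair_comm] at this
          · intro heq
            have : box a a ∈ (insert (box r a) {box r r} : Finset (Box n)) := by rw [heq]; simp
            simp [box_eq_iff, hr'.ne.symm] at this
          · rw [hFe, hva]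
            simp [box_comm a r]
        | @extend A F e r' h hr'' =>
          have hb' : box e r' ∉ F := h.box_notMem hr''.notMem
          have hb'v : (box e r').HasIndex a → v = box e r' := by
            intro hba
            by_contra hne
            exact ha _ (Finset.mem_erase.mpr ⟨Ne.symm hne, Finset.mem_insert_self _ _⟩) hba
          -- An index older than `r'` occurs in an earlier box; if it is also the end `e`, it occurs
          -- in `box e r'` too, and removing one box cannot make it disappear.
          have har' : a = r' := by
            by_contra har
            have haA' : a ∈ A := (Finset.mem_insert.mp haA).resolve_left har
            have hae : a = e := by
              rcases hr with ⟨ha1, -⟩ | ⟨ha1, -⟩ <;> rcases hr'' with ⟨he1, he2⟩ | ⟨he1, he2⟩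
              · exact le_antisymm (ha1.2 (Finset.mem_insert_of_mem he1.1)) (he1.2 haA')
              · exact absurd (ha1.2 (Finset.mem_insert_self _ _)) (not_le.mpr (he2 a haA'))
              · exact absurd (ha1.2 (Finset.mem_insert_self _ _)) (not_le.mpr (he2 a haA'))
              · exact le_antisymm (he1.2 haA') (ha1.2 (Finset.mem_insert_of_mem he1.1))
            have hv' := hb'v (box_hasIndex.mpr (Or.inl hae))
            obtain ⟨x, hx, hxa⟩ := h.exists_hasIndex haA'
            refine ha x (Finset.mem_erase.mpr ⟨?_, Finset.mem_insert_of_mem hx⟩) hxa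
            rintro rfl
            exact hb' (hv' ▸ hx)
          subst har'
          have hv' : v = box e a := hb'v (box_hasIndex.mpr (Or.inr rfl))
          have hne : A.Nonempty := h.nonempty
          -- The last two added indices lie on opposite sides of `A`, and the flip exchanges the
          -- order in which they are added.
          obtain ⟨e', he', hra⟩ : ∃ e', IsBeyond A e' r ∧ IsBeyond (insert r A) r a := by
            rcases hr with ⟨ha1, ha2⟩ | ⟨ha1, ha2⟩
            · refine ⟨A.min' hne, Or.inl ⟨A.isLeast_min' hne,
                fun x hx => ha2 x (Finset.mem_insert_of_mem hx)⟩, Or.inr ⟨⟨by simp, ?_⟩, ?_⟩⟩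
              · intro x hx
                rcases Finset.mem_insert.mp (Finset.mem_coe.mp hx) with rfl | hx
                exacts [le_rfl, (ha2 x (Finset.mem_insert_of_mem hx)).le]
              · intro x hx
                rcases Finset.mem_insert.mp hx with rfl | hx
                · exact ha2 a (Finset.mem_insert_self _ _)
                · refine lt_of_le_of_ne (ha1.2 (Finset.mem_insert_of_mem hx)) ?_
                  rintro rfl
                  exact hr''.notMem hx
            · refine ⟨A.max' hne, Or.inr ⟨A.isGreatest_max' hne,
                fun x hx => ha2 x (Finset.mem_insert_of_mem hx)⟩, Or.inl ⟨⟨by simp, ?_⟩, ?_⟩⟩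
              · intro x hx
                rcases Finset.mem_insert.mp (Finset.mem_coe.mp hx) with rfl | hx
                exacts [le_rfl, (ha2 x (Finset.mem_insert_of_mem hx)).le]
              · intro x hx
                rcases Finset.mem_insert.mp hx with rfl | hx
                · exact ha2 a (Finset.mem_insert_self _ _)
                · refine lt_of_le_of_ne (ha1.2 (Finset.mem_insert_of_mem hx)) ?_
                  rintro rfl
                  exact hr''.notMem hx
          have hG := (h.extend he').extend hra
          refine ⟨_, Finset.insert_comm a r A ▸ hG, ?_, ?_⟩
          · intro heq
            have hvG : v ∈ insert (box r a) (insert (box e' r) F) := heq ▸ hv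
            rw [hv'] at hvG
            simp only [Finset.mem_insert, box_eq_iff, hb', or_false] at hvG
            have her : e ≠ r := fun h' => he'.notMem (h' ▸ hr''.mem)
            have hae' : a ≠ e' := fun h' => hr''.notMem (h' ▸ he'.mem)
            have har : a ≠ r := fun h' => hra.ne h'.symm
            rcases hvG with (⟨h1, -⟩ | ⟨h1, h2⟩) | (⟨h1, h2⟩ | ⟨h1, h2⟩)
            exacts [her h1, har h2, har h2, her h1]
          · rw [hFe, hv', Finset.erase_insert hb', box_comm a r]
            exact Finset.insert_subset_insert _ (Finset.subset_insert _ _)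
      · left
        refine ⟨a, Finset.mem_insert_of_mem haA, fun x hx => ?_⟩
        rw [hFe] at hx
        rcases Finset.mem_insert.mp hx with rfl | hx
        · rw [box_hasIndex]
          rintro (h1 | rfl)
          exacts [hae h1, hr.notMem haA]
        · exact ha x hx
    · right
      refine ⟨_, hG.extend hr, fun heq => hGF ?_, ?_⟩
      · rw [← Finset.erase_insert (hG.box_notMem (e := e) hr.notMem), heq,
          Finset.erase_insert hb]
      · rw [hFe]
        exact Finset.insert_subset_insert _ hFG

/-! ### Comparison with paths as lists of steps. -/

theorem IsNextIn.erase {n : ℕ} {A : Finset (Fin n)} {i j r : Fin n} (h : IsNextIn A i j)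
    (hi : i ≠ r) (hj : j ≠ r) : IsNextIn (A.erase r) i j :=
  ⟨Finset.mem_erase.mpr ⟨hi, h.1⟩, Finset.mem_erase.mpr ⟨hj, h.2.1⟩, h.2.2.1,
    fun k hk => h.2.2.2 k (Finset.mem_of_mem_erase hk)⟩

theorem IsNextIn.insert {n : ℕ} {A : Finset (Fin n)} {i j e r : Fin n} (h : IsNextIn A i j)
    (hr : IsBeyond A e r) : IsNextIn (insert r A) i j := by
  refine ⟨Finset.mem_insert_of_mem h.1, Finset.mem_insert_of_mem h.2.1, h.2.2.1, fun k hk hik => ?_⟩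
  rcases Finset.mem_insert.mp hk with rfl | hk
  · rcases hr with ⟨-, hr⟩ | ⟨-, hr⟩
    exacts [lt_asymm hik.2 (hr j h.2.1), lt_asymm hik.1 (hr i h.1)]
  · exact h.2.2.2 k hk hik

theorem IsTriangleStep.monotone {n : ℕ} {A : Finset (Fin n)} {x y : Box n}
    (h : IsTriangleStep A x y) : x.row ≤ y.row ∧ y.col ≤ x.col := by
  rcases h with ⟨h1, h2⟩ | ⟨h1, h2⟩
  exacts [⟨h1.ge, h2.2.2.1.le⟩, ⟨h2.2.2.1.le, h1.le⟩]

theorem IsTriangleStep.erase {n : ℕ} {A : Finset (Fin n)} {x y : Box n} {r : Fin n}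
    (h : IsTriangleStep A x y) (hx : x.row ≠ r ∧ x.col ≠ r) (hy : y.row ≠ r ∧ y.col ≠ r) :
    IsTriangleStep (A.erase r) x y := by
  rcases h with ⟨h1, h2⟩ | ⟨h1, h2⟩
  exacts [Or.inl ⟨h1, h2.erase hy.2 hx.2⟩, Or.inr ⟨h1, h2.erase hx.1 hy.1⟩]

theorem chain_monotone {n : ℕ} {A : Finset (Fin n)} {y : Box n} {t : List (Box n)}
    (h : (y :: t).IsChain (IsTriangleStep A)) :
    ∀ z ∈ y :: t, y.row ≤ z.row ∧ z.col ≤ y.col := by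
  induction t generalizing y with
  | nil => intro z hz; rw [List.mem_singleton.mp hz]; exact ⟨le_rfl, le_rfl⟩
  | cons w t ih =>
    rw [List.isChain_cons_cons] at h
    intro z hz
    rcases List.mem_cons.mp hz with rfl | hz
    · exact ⟨le_rfl, le_rfl⟩
    · have h1 := ih h.2 z hz
      have h2 := h.1.monotone
      exact ⟨h2.1.trans h1.1, h1.2.trans h2.2⟩

theorem chain_erase {n : ℕ} {A : Finset (Fin n)} {r : Fin n} {l : List (Box n)}
    (h : l.IsChain (IsTriangleStep A)) (hl : ∀ z ∈ l, z.row ≠ r ∧ z.col ≠ r) :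
    l.IsChain (IsTriangleStep (A.erase r)) := by
  induction l with
  | nil => exact List.IsChain.nil
  | cons x l ih =>
    cases l with
    | nil => exact List.IsChain.singleton _
    | cons y t =>
      rw [List.isChain_cons_cons] at h ⊢
      exact ⟨h.1.erase (hl x (by simp)) (hl y (by simp)),
        ih h.2 fun z hz => hl z (List.mem_cons_of_mem _ hz)⟩

/-- A step to the left from the corner abandons the column `max A` for good, and a step downwards
the row `min A`. The tail is thus a path over `A` without that index. -/
theorem IsTrianglePath.isPathSet {n : ℕ} {A : Finset (Fin n)} {l : List (Box n)}
    (h : IsTrianglePath A l) : IsPathSet A l.toFinset := by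
  induction l generalizing A with
  | nil =>
    obtain ⟨⟨x, hx, -⟩, -⟩ := h
    simp at hx
  | cons x l ih =>
    obtain ⟨⟨x', hx', hleast, hgreatest⟩, hchain, ⟨z, hz, hzd⟩⟩ := h
    obtain rfl : x = x' := by simpa using hx'
    cases l with
    | nil =>
      obtain rfl : x = z := by simpa using hz
      have hA : A = {x.row} := Finset.eq_singleton_iff_unique_mem.mpr ⟨hleast.1,
        fun a ha => le_antisymm (hzd ▸ hgreatest.2 ha) (hleast.2 ha)⟩
      have hx : [x].toFinset = {box x.row x.row} := by
        conv_rhs => rw [show box x.row x.row = x by conv_rhs => rw [← box_row_col x, ← hzd]]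
        rfl
      rw [hx, hA]
      exact IsPathSet.single _
    | cons y t =>
      rw [List.isChain_cons_cons] at hchain
      have hmono := chain_monotone hchain.2
      have hlast : (y :: t).getLast? = some z := by rwa [List.getLast?_cons_cons] at hz
      rw [List.toFinset_cons]
      rcases hchain.1 with ⟨h1, h2⟩ | ⟨h1, h2⟩
      · have hlt : ∀ w ∈ y :: t, w.col < x.col := fun w hw => (hmono w hw).2.trans_lt h2.2.2.1
        have hne : x.row ≠ x.col := by
          rw [← h1]
          exact (y.row_le_col.trans_lt h2.2.2.1).ne
        have hpath : IsTrianglePath (A.erase x.col) (y :: t) := by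
          refine ⟨⟨y, rfl, ?_, ?_⟩, chain_erase hchain.2 fun w hw =>
            ⟨(w.row_le_col.trans_lt (hlt w hw)).ne, (hlt w hw).ne⟩, ⟨z, hlast, hzd⟩⟩
          · rw [h1]
            exact ⟨Finset.mem_coe.mpr (Finset.mem_erase.mpr ⟨hne, hleast.1⟩),
              fun a ha => hleast.2 (Finset.mem_of_mem_erase ha)⟩
          · refine ⟨Finset.mem_coe.mpr (Finset.mem_erase.mpr ⟨h2.2.2.1.ne, h2.1⟩), fun a ha => ?_⟩
            have haA := Finset.mem_of_mem_erase ha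
            exact not_lt.mp fun h => h2.2.2.2 a haA
              ⟨h, lt_of_le_of_ne (hgreatest.2 haA) (Finset.ne_of_mem_erase ha)⟩
        have hext := (ih hpath).extend (e := x.row) (r := x.col) (Or.inl
          ⟨⟨Finset.mem_coe.mpr (Finset.mem_erase.mpr ⟨hne, hleast.1⟩),
            fun a ha => hleast.2 (Finset.mem_of_mem_erase ha)⟩,
          fun a ha => lt_of_le_of_ne (hgreatest.2 (Finset.mem_of_mem_erase ha))
            (Finset.ne_of_mem_erase ha)⟩)
        rwa [Finset.insert_erase hgreatest.1, box_row_col] at hext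
      · have hlt : ∀ w ∈ y :: t, x.row < w.row := fun w hw => h2.2.2.1.trans_le (hmono w hw).1
        have hne : x.col ≠ x.row := by
          rw [← h1]
          exact (h2.2.2.1.trans_le y.row_le_col).ne'
        have hpath : IsTrianglePath (A.erase x.row) (y :: t) := by
          refine ⟨⟨y, rfl, ?_, ?_⟩, chain_erase hchain.2 fun w hw =>
            ⟨(hlt w hw).ne', ((hlt w hw).trans_le w.row_le_col).ne'⟩, ⟨z, hlast, hzd⟩⟩
          · refine ⟨Finset.mem_coe.mpr (Finset.mem_erase.mpr ⟨h2.2.2.1.ne', h2.2.1⟩),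
              fun a ha => ?_⟩
            have haA := Finset.mem_of_mem_erase ha
            exact not_lt.mp fun h => h2.2.2.2 a haA
              ⟨lt_of_le_of_ne (hleast.2 haA) (Finset.ne_of_mem_erase ha).symm, h⟩
          · rw [h1]
            exact ⟨Finset.mem_coe.mpr (Finset.mem_erase.mpr ⟨hne, hgreatest.1⟩),
              fun a ha => hgreatest.2 (Finset.mem_of_mem_erase ha)⟩
        have hext := (ih hpath).extend (e := x.col) (r := x.row) (Or.inr
          ⟨⟨Finset.mem_coe.mpr (Finset.mem_erase.mpr ⟨hne, hgreatest.1⟩),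
            fun a ha => hgreatest.2 (Finset.mem_of_mem_erase ha)⟩,
          fun a ha => lt_of_le_of_ne (hleast.2 (Finset.mem_of_mem_erase ha))
            (Finset.ne_of_mem_erase ha).symm⟩)
        rwa [Finset.insert_erase hleast.1, box_comm, box_row_col] at hext

theorem IsPathSet.exists_isTrianglePath {n : ℕ} {A : Finset (Fin n)} {F : Finset (Box n)}
    (h : IsPathSet A F) : ∃ l, IsTrianglePath A l ∧ F = l.toFinset := by
  induction h with
  | single a =>
    refine ⟨[box a a], ⟨⟨box a a, rfl, ?_, ?_⟩, List.IsChain.singleton _, ⟨box a a, rfl, ?_⟩⟩, rfl⟩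
    · rw [box_row_of_le le_rfl]
      simp [IsLeast]
    · rw [box_col_of_le le_rfl]
      simp [IsGreatest]
    · rw [box_row_of_le le_rfl, box_col_of_le le_rfl]
  | @extend A F e r h hr ih =>
    obtain ⟨l, ⟨⟨y, hy, hleast, hgreatest⟩, hchain, z, hz, hzd⟩, hF⟩ := ih
    obtain ⟨t, rfl⟩ : ∃ t, l = y :: t := by
      cases l with
      | nil => simp at hy
      | cons y' t => exact ⟨t, by simpa using hy⟩
    have hchain' : (y :: t).IsChain (IsTriangleStep (insert r A)) := hchain.imp fun u w h => by
      rcases h with ⟨h1, h2⟩ | ⟨h1, h2⟩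
      exacts [Or.inl ⟨h1, h2.insert hr⟩, Or.inr ⟨h1, h2.insert hr⟩]
    refine ⟨box e r :: y :: t, ⟨⟨box e r, rfl, ?_, ?_⟩, ?_, ⟨z, ?_, hzd⟩⟩, ?_⟩
    · rcases hr with ⟨he, hr⟩ | ⟨he, hr⟩
      · rw [box_row_of_le (hr e he.1).le]
        refine ⟨by simpa using Or.inr he.1, fun a ha => ?_⟩
        rcases Finset.mem_insert.mp (Finset.mem_coe.mp ha) with rfl | ha
        exacts [(hr e he.1).le, he.2 ha]
      · rw [box_comm, box_row_of_le (hr e he.1).le]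
        refine ⟨by simp, fun a ha => ?_⟩
        rcases Finset.mem_insert.mp (Finset.mem_coe.mp ha) with rfl | ha
        exacts [le_rfl, (hr a ha).le]
    · rcases hr with ⟨he, hr⟩ | ⟨he, hr⟩
      · rw [box_col_of_le (hr e he.1).le]
        refine ⟨by simp, fun a ha => ?_⟩
        rcases Finset.mem_insert.mp (Finset.mem_coe.mp ha) with rfl | ha
        exacts [le_rfl, (hr a ha).le]
      · rw [box_comm, box_col_of_le (hr e he.1).le]
        refine ⟨by simpa using Or.inr he.1, fun a ha => ?_⟩
        rcases Finset.mem_insert.mp (Finset.mem_coe.mp ha) with rfl | ha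
        exacts [(hr e he.1).le, he.2 ha]
    · rw [List.isChain_cons_cons]
      refine ⟨?_, hchain'⟩
      rcases hr with ⟨he, hr⟩ | ⟨he, hr⟩
      · left
        rw [box_row_of_le (hr e he.1).le, box_col_of_le (hr e he.1).le]
        refine ⟨hleast.unique he, Finset.mem_insert_of_mem hgreatest.1, Finset.mem_insert_self _ _,
          hr _ hgreatest.1, fun k hk hk' => ?_⟩
        rcases Finset.mem_insert.mp hk with rfl | hk
        exacts [lt_irrefl _ hk'.2, absurd (hgreatest.2 hk) (not_le.mpr hk'.1)]
      · right
        rw [box_comm, box_row_of_le (hr e he.1).le, box_col_of_le (hr e he.1).le]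
        refine ⟨hgreatest.unique he, Finset.mem_insert_self _ _, Finset.mem_insert_of_mem hleast.1,
          hr _ hleast.1, fun k hk hk' => ?_⟩
        rcases Finset.mem_insert.mp hk with rfl | hk
        exacts [lt_irrefl _ hk'.1, absurd (hleast.2 hk) (not_le.mpr hk'.2)]
    · rw [List.getLast?_cons_cons, hz]
    · rw [List.toFinset_cons, ← hF]

theorem isPathSet_iff {n : ℕ} {A : Finset (Fin n)} {F : Finset (Box n)} :
    IsPathSet A F ↔ ∃ l, IsTrianglePath A l ∧ F = l.toFinset :=
  ⟨IsPathSet.exists_isTrianglePath, fun ⟨_, hl, h⟩ => h ▸ hl.isPathSet⟩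

/-! ### The number of paths over an index set. -/

/-- A path over at least two indices is obtained by extending a path. -/
theorem IsPathSet.exists_extend {n : ℕ} {A : Finset (Fin n)} {F : Finset (Box n)}
    (h : IsPathSet A F) {p q : Fin n} (hp : IsLeast (A : Set (Fin n)) p)
    (hq : IsGreatest (A : Set (Fin n)) q) (hpq : p ≠ q) :
    ∃ r, (r = p ∨ r = q) ∧ ∃ G, IsPathSet (A.erase r) G ∧ F = insert (box p q) G := by
  cases h with
  | single a =>
    have hpa : p = a := by simpa using hp.1
    have hqa : q = a := by simpa using hq.1
    exact absurd (hpa.trans hqa.symm) hpq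
  | @extend A F e r h hr =>
    have hA : (insert r A).erase r = A := Finset.erase_insert hr.notMem
    rcases hr with ⟨he, hr⟩ | ⟨he, hr⟩
    · have hqr : q = r := hq.unique ⟨by simp, fun a ha => by
        rcases Finset.mem_insert.mp (Finset.mem_coe.mp ha) with rfl | ha
        exacts [le_rfl, (hr a ha).le]⟩
      have hpe : p = e := hp.unique ⟨by simpa using Or.inr he.1, fun a ha => by
        rcases Finset.mem_insert.mp (Finset.mem_coe.mp ha) with rfl | ha
        exacts [(hr e he.1).le, he.2 ha]⟩
      exact ⟨r, Or.inr hqr.symm, F, hA.symm ▸ h, by rw [hqr, hpe]⟩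
    · have hpr : p = r := hp.unique ⟨by simp, fun a ha => by
        rcases Finset.mem_insert.mp (Finset.mem_coe.mp ha) with rfl | ha
        exacts [le_rfl, (hr a ha).le]⟩
      have hqe : q = e := hq.unique ⟨by simpa using Or.inr he.1, fun a ha => by
        rcases Finset.mem_insert.mp (Finset.mem_coe.mp ha) with rfl | ha
        exacts [(hr e he.1).le, he.2 ha]⟩
      exact ⟨r, Or.inl hpr.symm, F, hA.symm ▸ h, by rw [hpr, hqe, box_comm]⟩

/-- Removing the corner leaves a path over `A` without its minimum or without its maximum. The two
cases are disjoint because a path determines its indices, so each further index doubles the number.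
-/
theorem ncard_isPathSet {n : ℕ} {A : Finset (Fin n)} (hA : A.Nonempty) :
    {F | IsPathSet A F}.ncard = 2 ^ (A.card - 1) := by
  induction A using Finset.strongInduction with
  | _ A ih =>
  set p := A.min' hA with hp
  set q := A.max' hA with hq
  have hpl : IsLeast (A : Set (Fin n)) p := A.isLeast_min' hA
  have hqg : IsGreatest (A : Set (Fin n)) q := A.isGreatest_max' hA
  by_cases hpq : p = q
  · have hAp : A = {p} := Finset.eq_singleton_iff_unique_mem.mpr
      ⟨hpl.1, fun a ha => le_antisymm (hpq ▸ hqg.2 ha) (hpl.2 ha)⟩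
    have : {F | IsPathSet A F} = {{box p p}} := by
      ext F
      simp only [Set.mem_ofPred_eq, Set.mem_singleton_iff]
      constructor
      · intro h
        have hcard : F.card = 1 := by rw [h.card_eq, hAp, Finset.card_singleton]
        obtain ⟨x, hx⟩ := Finset.card_eq_one.mp hcard
        have h1 := h.mem_of_hasIndex (hx ▸ Finset.mem_singleton_self x) (Or.inl rfl)
        have h2 := h.mem_of_hasIndex (hx ▸ Finset.mem_singleton_self x) (Or.inr rfl)
        rw [hAp, Finset.mem_singleton] at h1 h2
        rw [hx, ← box_row_col x, h1, h2]
      · rintro rfl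
        rw [hAp]
        exact IsPathSet.single p
    rw [this, Set.ncard_singleton, hAp, Finset.card_singleton]
    rfl
  have hlt : p < q := lt_of_le_of_ne (hpl.2 hqg.1) hpq
  have hbp : IsBeyond (A.erase p) q p := Or.inr
    ⟨⟨Finset.mem_coe.mpr (Finset.mem_erase.mpr ⟨Ne.symm hpq, hqg.1⟩),
      fun a ha => hqg.2 (Finset.mem_of_mem_erase ha)⟩, fun a ha => lt_of_le_of_ne
        (hpl.2 (Finset.mem_of_mem_erase ha)) (Finset.ne_of_mem_erase ha).symm⟩
  have hbq : IsBeyond (A.erase q) p q := Or.inl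
    ⟨⟨Finset.mem_coe.mpr (Finset.mem_erase.mpr ⟨hpq, hpl.1⟩),
      fun a ha => hpl.2 (Finset.mem_of_mem_erase ha)⟩, fun a ha => lt_of_le_of_ne
        (hqg.2 (Finset.mem_of_mem_erase ha)) (Finset.ne_of_mem_erase ha)⟩
  have hset : {F | IsPathSet A F} = insert (box p q) '' {G | IsPathSet (A.erase p) G} ∪
      insert (box p q) '' {G | IsPathSet (A.erase q) G} := by
    ext F
    simp only [Set.mem_ofPred_eq, Set.mem_union, Set.mem_image]
    constructor
    · intro h
      obtain ⟨r, rfl | rfl, G, hG, hF⟩ := h.exists_extend hpl hqg hpq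
      exacts [Or.inl ⟨G, hG, hF.symm⟩, Or.inr ⟨G, hG, hF.symm⟩]
    · rintro (⟨G, hG, rfl⟩ | ⟨G, hG, rfl⟩)
      · have := hG.extend hbp
        rwa [Finset.insert_erase hpl.1, box_comm] at this
      · have := hG.extend hbq
        rwa [Finset.insert_erase hqg.1] at this
  have hnp : ∀ G, IsPathSet (A.erase p) G → box p q ∉ G := fun G hG => by
    rw [box_comm]
    exact hG.box_notMem hbp.notMem
  have hnq : ∀ G, IsPathSet (A.erase q) G → box p q ∉ G := fun G hG => hG.box_notMem hbq.notMem
  have hinj : ∀ r, (∀ G, IsPathSet (A.erase r) G → box p q ∉ G) →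
      (insert (box p q) '' {G | IsPathSet (A.erase r) G}).ncard =
        {G | IsPathSet (A.erase r) G}.ncard := fun r hr =>
    Set.InjOn.ncard_image fun G hG H hH h => by
      rw [← Finset.erase_insert (hr G hG), ← Finset.erase_insert (hr H hH), h]
  rw [hset, Set.ncard_union_eq _ (Set.toFinite _) (Set.toFinite _), hinj p hnp, hinj q hnq,
    ih _ (Finset.erase_ssubset hpl.1) ⟨q, hbp.mem⟩, ih _ (Finset.erase_ssubset hqg.1) ⟨p, hbq.mem⟩,
    Finset.card_erase_of_mem hpl.1, Finset.card_erase_of_mem hqg.1]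
  · have : 2 ≤ A.card := Finset.one_lt_card.mpr ⟨p, hpl.1, q, hqg.1, hpq⟩
    rw [← two_mul, ← pow_succ']
    congr 1
    omega
  · rw [Set.disjoint_left]
    rintro _ ⟨G, hG, rfl⟩ ⟨H, hH, h⟩
    have hGH : H = G := by
      rw [← Finset.erase_insert (hnp G hG), ← Finset.erase_insert (hnq H hH), h]
    have := hG.index_unique (hGH ▸ hH)
    have hqmem : q ∈ A.erase p := hbp.mem
    rw [this] at hqmem
    exact Finset.ne_of_mem_erase hqmem rfl

/-! ### Sets of indices without opposite pairs. -/

theorem isOpposite_iff {n : ℕ} {a b : Fin n} : IsOpposite a b ↔ b = a.rev := by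
  rw [IsOpposite, Fin.ext_iff, Fin.val_rev]
  omega

theorem IsOpposite.symm {n : ℕ} {a b : Fin n} (h : IsOpposite a b) : IsOpposite b a := by
  rw [isOpposite_iff] at h ⊢
  rw [h, Fin.rev_rev]

theorem not_isOpposite_self {n m : ℕ} (hn : n = 2 * m) (a : Fin n) : ¬ IsOpposite a a := by
  rw [IsOpposite]
  omega

/-- No two indices in `S` are opposite. -/
def IsOppositeFree {n : ℕ} (S : Finset (Fin n)) : Prop := ∀ i ∈ S, ∀ j ∈ S, ¬ IsOpposite i j

theorem card_eq_of_mem_iff_rev_notMem {n m : ℕ} (hn : n = 2 * m) {A : Finset (Fin n)}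
    (hA : ∀ a, a ∈ A ↔ a.rev ∉ A) : A.card = m := by
  have h1 : Aᶜ = A.image Fin.rev := by
    ext a
    rw [Finset.mem_compl, hA a, not_not, Finset.mem_image]
    constructor
    · exact fun h => ⟨a.rev, h, a.rev_rev⟩
    · rintro ⟨b, hb, rfl⟩
      rwa [Fin.rev_rev]
  have h2 : Aᶜ.card = A.card := by
    rw [h1, Finset.card_image_of_injective _ Fin.rev_injective]
  have h3 := A.card_add_card_compl
  rw [Fintype.card_fin] at h3
  omega

/-- `A` and its reversal are disjoint and have `m` elements each, so they fill all `2 * m` indices.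
-/
theorem mem_iff_rev_notMem {n m : ℕ} (hn : n = 2 * m) {A : Finset (Fin n)}
    (hA : A ∈ oppositeFreeSets n m) (a : Fin n) : a ∈ A ↔ a.rev ∉ A := by
  refine ⟨fun h h' => hA.2 a h _ h' (isOpposite_iff.mpr rfl), fun h => ?_⟩
  have hdisj : Disjoint A (A.image Fin.rev) := by
    rw [Finset.disjoint_left]
    intro b hb hb'
    obtain ⟨c, hc, rfl⟩ := Finset.mem_image.mp hb'
    exact hA.2 c hc _ hb (isOpposite_iff.mpr rfl)
  have huniv : A ∪ A.image Fin.rev = Finset.univ := by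
    rw [← Finset.card_eq_iff_eq_univ, Finset.card_union_of_disjoint hdisj,
      Finset.card_image_of_injective _ Fin.rev_injective, hA.1, Fintype.card_fin]
    omega
  have ha : a ∈ A ∪ A.image Fin.rev := huniv ▸ Finset.mem_univ a
  rcases Finset.mem_union.mp ha with ha | ha
  · exact ha
  · obtain ⟨c, hc, rfl⟩ := Finset.mem_image.mp ha
    rw [Fin.rev_rev] at h
    exact absurd hc h

/-- From each opposite pair missed by `S`, add the member in the lower half. -/
theorem exists_oppositeFreeSets_superset {n m : ℕ} (hn : n = 2 * m) {S : Finset (Fin n)}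
    (hS : IsOppositeFree S) : ∃ A ∈ oppositeFreeSets n m, S ⊆ A := by
  have hA : ∀ a, (a ∈ S ∨ (a.rev ∉ S ∧ (a : ℕ) < m)) ↔
      ¬ (a.rev ∈ S ∨ (a.rev.rev ∉ S ∧ (a.rev : ℕ) < m)) := by
    intro a
    have h1 : a ∈ S → a.rev ∉ S := fun h h' => hS a h _ h' (isOpposite_iff.mpr rfl)
    have h2 : (a.rev : ℕ) < m ↔ ¬ (a : ℕ) < m := by
      rw [Fin.val_rev]
      omega
    rw [Fin.rev_rev, h2]
    tauto
  set A : Finset (Fin n) := Finset.univ.filter fun a => a ∈ S ∨ (a.rev ∉ S ∧ (a : ℕ) < m)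
    with hAdef
  have hmem : ∀ a, a ∈ A ↔ a.rev ∉ A := fun a => by
    rw [hAdef, Finset.mem_filter_univ, Finset.mem_filter_univ]
    exact hA a
  refine ⟨A, ⟨card_eq_of_mem_iff_rev_notMem hn hmem, fun i hi j hj h => ?_⟩, fun a ha => ?_⟩
  · rw [isOpposite_iff] at h
    exact (hmem i).mp hi (h ▸ hj)
  · rw [hAdef, Finset.mem_filter_univ]
    exact Or.inl ha

/-- Such a set is determined by its intersection with the lower half `L`, which is arbitrary. -/
theorem ncard_oppositeFreeSets {n m : ℕ} (hn : n = 2 * m) :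
    (oppositeFreeSets n m).ncard = 2 ^ m := by
  set L : Finset (Fin n) := Finset.univ.filter fun a => (a : ℕ) < m with hL
  have hmemL : ∀ a, a ∈ L ↔ (a : ℕ) < m := fun a => by rw [hL, Finset.mem_filter_univ]
  have hrevL : ∀ a : Fin n, a.rev ∈ L ↔ a ∉ L := fun a => by
    rw [hmemL, hmemL, Fin.val_rev]
    omega
  have hcard : L.card = m :=
    card_eq_of_mem_iff_rev_notMem hn fun a => by rw [hrevL, not_not]
  have hpow : 2 ^ m = (L.powerset : Set (Finset (Fin n))).ncard := by
    rw [Set.ncard_coe_finset, Finset.card_powerset, hcard]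
  rw [hpow]
  refine Set.ncard_congr (fun A _ => A ∩ L)
    (fun A _ => Finset.mem_coe.mpr (Finset.mem_powerset.mpr Finset.inter_subset_right)) ?_ ?_
  · intro A B hA hB h
    have key : ∀ a ∈ L, (a ∈ A ↔ a ∈ B) := fun a ha => by
      have := Finset.ext_iff.mp h a
      simpa [ha] using this
    ext a
    by_cases ha : a ∈ L
    · exact key a ha
    · rw [mem_iff_rev_notMem hn hA, mem_iff_rev_notMem hn hB, key _ ((hrevL a).mpr ha)]
  · intro B hB
    have hBL : B ⊆ L := Finset.mem_powerset.mp (Finset.mem_coe.mp hB)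
    have hS : IsOppositeFree (B ∪ (L \ B).image Fin.rev) := by
      intro i hi j hj hij
      rw [isOpposite_iff] at hij
      subst hij
      simp only [Finset.mem_union, Finset.mem_image, Finset.mem_sdiff] at hi hj
      rcases hi with hi | ⟨b, ⟨hbL, hbB⟩, rfl⟩
      · rcases hj with hj | ⟨c, ⟨hcL, hcB⟩, hc⟩
        · exact (hrevL i).mp (hBL hj) (hBL hi)
        · exact hcB (Fin.rev_injective hc ▸ hi)
      · rw [Fin.rev_rev] at hj
        rcases hj with hj | ⟨c, ⟨hcL, hcB⟩, hc⟩
        · exact hbB hj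
        · exact (hrevL c).mp (hc ▸ hbL) hcL
    obtain ⟨A, hA, hSA⟩ := exists_oppositeFreeSets_superset hn hS
    refine ⟨A, hA, ?_⟩
    ext a
    rw [Finset.mem_inter]
    constructor
    · rintro ⟨haA, haL⟩
      by_contra haB
      exact (mem_iff_rev_notMem hn hA a).mp haA (hSA (Finset.mem_union_right _
        (Finset.mem_image_of_mem _ (Finset.mem_sdiff.mpr ⟨haL, haB⟩))))
    · exact fun h => ⟨hSA (Finset.mem_union_left _ h), hBL h⟩

/-! ### Standard monomials and compatible sets of boxes. -/

/-- The product of the variables of `x` and `y` is one of the generators of `K(2,n)`. -/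
def IsBadPair {n : ℕ} (x y : Box n) : Prop :=
  x ∉ antidiagonalBoxes n ∧ y ∉ antidiagonalBoxes n ∧
    ((∃ a b : Fin n, (a = x.row ∨ a = x.col) ∧ (b = y.row ∨ b = y.col) ∧ IsOpposite a b) ∨
      (x.row < y.row ∧ x.col < y.col))

/-- This makes the generators squarefree. It needs `n` even: no index is opposite to itself. -/
theorem IsBadPair.ne {n m : ℕ} (hn : n = 2 * m) {x y : Box n} (h : IsBadPair x y) : x ≠ y := by
  rintro rfl
  obtain ⟨hx, -, ⟨a, b, rfl | rfl, rfl | rfl, hab⟩ | h⟩ := h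
  · exact not_isOpposite_self hn _ hab
  · exact hx hab
  · exact hx hab.symm
  · exact not_isOpposite_self hn _ hab
  · exact lt_irrefl _ h.1

/-- The product of the variables in `S` is not in `K(2,n)`. -/
def IsCompatible {n : ℕ} (S : Finset (Box n)) : Prop := ∀ x ∈ S, ∀ y ∈ S, ¬ IsBadPair x y

theorem IsCompatible.subset {n : ℕ} {S T : Finset (Box n)} (hT : IsCompatible T) (h : S ⊆ T) :
    IsCompatible S := fun x hx y hy => hT x (h hx) y (h hy)

theorem symMonomialIdeal_eq (n : ℕ) (K : Type u) [Field K] : symMonomialIdeal n K =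
    Ideal.span ((fun s => monomial s (1 : K)) ''
      {s | ∃ x y : Box n, IsBadPair x y ∧ s = Finsupp.single x 1 + Finsupp.single y 1}) := by
  rw [symMonomialIdeal]
  congr 1
  ext f
  constructor
  · rintro ⟨x, y, h1, h2, h3, rfl⟩
    exact ⟨_, ⟨x, y, ⟨h1, h2, h3⟩, rfl⟩, by simp [X, monomial_mul]⟩
  · rintro ⟨_, ⟨x, y, ⟨h1, h2, h3⟩, rfl⟩, rfl⟩
    exact ⟨x, y, h1, h2, h3, by simp [X, monomial_mul]⟩

theorem single_add_single_le_iff {σ : Type*} {x y : σ} (h : x ≠ y) (a : σ →₀ ℕ) :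
    Finsupp.single x 1 + Finsupp.single y 1 ≤ a ↔ x ∈ a.support ∧ y ∈ a.support := by
  classical
  simp only [Finsupp.mem_support_iff]
  constructor
  · intro ha
    have hx := ha x
    have hy := ha y
    simp only [Finsupp.add_apply, Finsupp.single_apply, if_true] at hx hy
    constructor <;> omega
  · rintro ⟨hx, hy⟩ z
    simp only [Finsupp.add_apply, Finsupp.single_apply]
    by_cases h1 : x = z
    · subst h1
      rw [if_pos rfl, if_neg h.symm]
      omega
    · rw [if_neg h1]
      split_ifs with h2
      · subst h2
        omega
      · omega

theorem mem_symMonomialIdeal_iff {n m : ℕ} (hn : n = 2 * m) {K : Type u} [Field K]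
    {f : MvPolynomial (Box n) K} :
    f ∈ symMonomialIdeal n K ↔ ∀ a ∈ f.support, ¬ IsCompatible a.support := by
  rw [symMonomialIdeal_eq, mem_ideal_span_monomial_image]
  refine forall₂_congr fun a _ => ?_
  rw [IsCompatible]
  push Not
  constructor
  · rintro ⟨_, ⟨x, y, h, rfl⟩, hle⟩
    rw [single_add_single_le_iff (h.ne hn)] at hle
    exact ⟨x, hle.1, y, hle.2, h⟩
  · rintro ⟨x, hx, y, hy, h⟩
    exact ⟨_, ⟨x, y, h, rfl⟩, (single_add_single_le_iff (h.ne hn) a).mpr ⟨hx, hy⟩⟩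

theorem mem_stanleyReisnerComplex_iff {n m : ℕ} (hn : n = 2 * m) {K : Type u} [Field K]
    {F : Finset (Box n)} :
    F ∈ stanleyReisnerComplex (symMonomialIdeal n K) ↔ F.Nonempty ∧ IsCompatible F := by
  classical
  change F.Nonempty ∧ _ ↔ _
  refine and_congr_right fun _ => ?_
  have hprod : (∏ v ∈ F, (X v : MvPolynomial (Box n) K)) =
      monomial (∑ v ∈ F, Finsupp.single v 1) 1 := by
    rw [monomial_sum_one]
    rfl
  have hsupp : (∑ v ∈ F, Finsupp.single v 1 : Box n →₀ ℕ).support = F := by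
    ext w
    simp [Finsupp.single_apply]
  rw [hprod, mem_symMonomialIdeal_iff hn, support_monomial, if_neg one_ne_zero]
  simp [hsupp]

theorem IsPathSet.notMem_antidiagonalBoxes {n m : ℕ} {A : Finset (Fin n)} {F : Finset (Box n)}
    (hA : A ∈ oppositeFreeSets n m) (h : IsPathSet A F) {x : Box n} (hx : x ∈ F) :
    x ∉ antidiagonalBoxes n :=
  hA.2 _ (h.mem_of_hasIndex hx (Or.inl rfl)) _ (h.mem_of_hasIndex hx (Or.inr rfl))

theorem IsPathSet.not_isBadPair {n m : ℕ} {A : Finset (Fin n)} {F : Finset (Box n)}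
    (hA : A ∈ oppositeFreeSets n m) (h : IsPathSet A F) {x y : Box n} (hx : x ∈ F) (hy : y ∈ F) :
    ¬ IsBadPair x y := by
  rintro ⟨-, -, ⟨a, b, ha, hb, hab⟩ | hlt⟩
  · exact hA.2 a (h.mem_of_hasIndex hx ha) b (h.mem_of_hasIndex hy hb) hab
  · exact h.isNestedSet x hx y hy hlt

theorem IsPathSet.isCompatible {n m : ℕ} {A : Finset (Fin n)} {F : Finset (Box n)}
    (hA : A ∈ oppositeFreeSets n m) (h : IsPathSet A F) : IsCompatible F :=
  fun _ hx _ hy => h.not_isBadPair hA hx hy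

/-- The indices of the boxes in `S`. -/
def indexSet {n : ℕ} (S : Finset (Box n)) : Finset (Fin n) :=
  S.image Box.row ∪ S.image Box.col

theorem mem_indexSet {n : ℕ} {S : Finset (Box n)} {a : Fin n} :
    a ∈ indexSet S ↔ ∃ x ∈ S, x.HasIndex a := by
  simp only [indexSet, Finset.mem_union, Finset.mem_image, Box.HasIndex]
  grind

theorem IsCompatible.isOppositeFree_indexSet {n : ℕ} {S : Finset (Box n)} (hS : IsCompatible S)
    (hS' : ∀ x ∈ S, x ∉ antidiagonalBoxes n) : IsOppositeFree (indexSet S) := by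
  intro a ha b hb hab
  obtain ⟨x, hx, hxa⟩ := mem_indexSet.mp ha
  obtain ⟨y, hy, hyb⟩ := mem_indexSet.mp hb
  exact hS x hx y hy ⟨hS' x hx, hS' y hy, Or.inl ⟨a, b, hxa, hyb, hab⟩⟩

theorem IsCompatible.isNestedSet {n : ℕ} {S : Finset (Box n)} (hS : IsCompatible S)
    (hS' : ∀ x ∈ S, x ∉ antidiagonalBoxes n) : IsNestedSet S :=
  fun x hx y hy h => hS x hx y hy ⟨hS' x hx, hS' y hy, Or.inr h⟩

theorem nonempty_of_mem_oppositeFreeSets {n m : ℕ} (hm : 1 ≤ m) {A : Finset (Fin n)}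
    (hA : A ∈ oppositeFreeSets n m) : A.Nonempty := by
  rw [← Finset.card_pos, hA.1]
  omega

theorem IsCompatible.exists_isPathSet {n m : ℕ} (hm : 1 ≤ m) {S : Finset (Box n)}
    (hS : IsCompatible S) (hS' : ∀ x ∈ S, x ∉ antidiagonalBoxes n) {A : Finset (Fin n)}
    (hA : A ∈ oppositeFreeSets n m) (hSA : indexSet S ⊆ A) : ∃ F, IsPathSet A F ∧ S ⊆ F :=
  exists_isPathSet_superset (nonempty_of_mem_oppositeFreeSets hm hA)
    (fun x hx => ⟨hSA (mem_indexSet.mpr ⟨x, hx, Or.inl rfl⟩),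
      hSA (mem_indexSet.mpr ⟨x, hx, Or.inr rfl⟩)⟩) (hS.isNestedSet hS')

theorem IsCompatible.exists_oppositeFreeSets_isPathSet {n m : ℕ} (hm : 1 ≤ m) (hn : n = 2 * m)
    {S : Finset (Box n)} (hS : IsCompatible S) (hS' : ∀ x ∈ S, x ∉ antidiagonalBoxes n) :
    ∃ A ∈ oppositeFreeSets n m, ∃ F, IsPathSet A F ∧ S ⊆ F := by
  obtain ⟨A, hA, hSA⟩ := exists_oppositeFreeSets_superset hn (hS.isOppositeFree_indexSet hS')
  exact ⟨A, hA, hS.exists_isPathSet hm hS' hA hSA⟩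

/-- A path avoiding a given index. -/
theorem exists_isPathSet_notMem {n m : ℕ} (hm : 1 ≤ m) (hn : n = 2 * m) {S : Finset (Box n)}
    (hS : IsCompatible S) (hS' : ∀ x ∈ S, x ∉ antidiagonalBoxes n) {a : Fin n}
    (ha : a ∉ indexSet S) : ∃ A ∈ oppositeFreeSets n m, a ∉ A ∧ ∃ F, IsPathSet A F ∧ S ⊆ F := by
  -- Forcing the opposite index into `A` excludes `a`.
  have hfree : IsOppositeFree (insert a.rev (indexSet S)) := by
    have h := hS.isOppositeFree_indexSet hS'
    intro i hi j hj hij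
    rcases Finset.mem_insert.mp hi with rfl | hi <;> rcases Finset.mem_insert.mp hj with rfl | hj
    · exact not_isOpposite_self hn _ hij
    · rw [isOpposite_iff, Fin.rev_rev] at hij
      exact ha (hij ▸ hj)
    · have := isOpposite_iff.mp hij.symm
      rw [Fin.rev_rev] at this
      exact ha (this ▸ hi)
    · exact h i hi j hj hij
  obtain ⟨A, hA, hSA⟩ := exists_oppositeFreeSets_superset hn hfree
  refine ⟨A, hA, fun h => ?_,
    hS.exists_isPathSet hm hS' hA ((Finset.subset_insert _ _).trans hSA)⟩
  exact (mem_iff_rev_notMem hn hA a).mp h (hSA (Finset.mem_insert_self _ _))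

theorem IsPathSet.eq_of_subset {n m : ℕ} {A B : Finset (Fin n)} {F G : Finset (Box n)}
    (hA : A ∈ oppositeFreeSets n m) (hB : B ∈ oppositeFreeSets n m) (hF : IsPathSet A F)
    (hG : IsPathSet B G) (h : F ⊆ G) : F = G :=
  Finset.eq_of_subset_of_card_le h (by rw [hF.card_eq, hG.card_eq, hA.1, hB.1])

/-- The antidiagonal boxes as a finset. -/
noncomputable def antidiagonalFinset (n : ℕ) : Finset (Box n) :=
  (Set.toFinite (antidiagonalBoxes n)).toFinset

theorem mem_antidiagonalFinset {n : ℕ} {x : Box n} :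
    x ∈ antidiagonalFinset n ↔ x ∈ antidiagonalBoxes n := by
  rw [antidiagonalFinset, Set.Finite.mem_toFinset]

theorem isCompatible_antidiagonal_union {n : ℕ} {F : Finset (Box n)} (hF : IsCompatible F) :
    IsCompatible (antidiagonalFinset n ∪ F) := by
  intro x hx y hy h
  rw [Finset.mem_union, mem_antidiagonalFinset] at hx hy
  exact hF x (hx.resolve_left h.1) y (hy.resolve_left h.2.1) h

theorem IsCompatible.exists_subset_antidiagonal_union {n m : ℕ} (hm : 1 ≤ m) (hn : n = 2 * m)
    {S : Finset (Box n)} (hS : IsCompatible S) :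
    ∃ A ∈ oppositeFreeSets n m, ∃ F, IsPathSet A F ∧ S ⊆ antidiagonalFinset n ∪ F := by
  obtain ⟨A, hA, F, hF, hSF⟩ := (hS.subset (Finset.sdiff_subset (t := antidiagonalFinset n))
    ).exists_oppositeFreeSets_isPathSet hm hn fun x hx => by
      rw [← mem_antidiagonalFinset]
      exact (Finset.mem_sdiff.mp hx).2
  refine ⟨A, hA, F, hF, fun x hx => ?_⟩
  by_cases h : x ∈ antidiagonalFinset n
  · exact Finset.mem_union_left _ h
  · exact Finset.mem_union_right _ (hSF (Finset.mem_sdiff.mpr ⟨hx, h⟩))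

/-! ### Facets, cone points and core. -/

section Complex

variable {K : Type u} [Field K] {n m : ℕ}

theorem facets_stanleyReisnerComplex (hm : 1 ≤ m) (hn : n = 2 * m) :
    facets (stanleyReisnerComplex (symMonomialIdeal n K)) =
      {G | ∃ A ∈ oppositeFreeSets n m, ∃ F, IsPathSet A F ∧ G = antidiagonalFinset n ∪ F} := by
  have hface : ∀ A ∈ oppositeFreeSets n m, ∀ F, IsPathSet A F →
      antidiagonalFinset n ∪ F ∈ stanleyReisnerComplex (symMonomialIdeal n K) := by
    intro A hA F hF
    refine (mem_stanleyReisnerComplex_iff hn).mpr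
      ⟨?_, isCompatible_antidiagonal_union (hF.isCompatible hA)⟩
    obtain ⟨a, ha⟩ := hF.nonempty
    obtain ⟨x, hx, -⟩ := hF.exists_hasIndex ha
    exact ⟨x, Finset.mem_union_right _ hx⟩
  ext G
  constructor
  · intro hG
    obtain ⟨A, hA, F, hF, hGF⟩ :=
      ((mem_stanleyReisnerComplex_iff hn).mp hG.1).2.exists_subset_antidiagonal_union hm hn
    exact ⟨A, hA, F, hF, hG.eq_of_le (hface A hA F hF) hGF⟩
  · rintro ⟨A, hA, F, hF, rfl⟩
    refine ⟨hface A hA F hF, fun G hG hle => ?_⟩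
    obtain ⟨B, hB, F', hF', hGF⟩ :=
      ((mem_stanleyReisnerComplex_iff hn).mp hG).2.exists_subset_antidiagonal_union hm hn
    have hsub : F ⊆ F' := fun x hx => (Finset.mem_union.mp (hGF (hle
      (Finset.mem_union_right _ hx)))).resolve_left fun h =>
        hF.notMem_antidiagonalBoxes hA hx (mem_antidiagonalFinset.mp h)
    rw [hF.eq_of_subset hA hB hF' hsub]
    exact hGF

/-- A box `v` off the antidiagonal is missed by every facet whose index set `A` does not contain
`v.row`. -/
theorem conePoints_stanleyReisnerComplex (hm : 1 ≤ m) (hn : n = 2 * m) :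
    conePoints (stanleyReisnerComplex (symMonomialIdeal n K)) = antidiagonalBoxes n := by
  ext v
  rw [conePoints, facets_stanleyReisnerComplex hm hn]
  constructor
  · intro hv
    by_contra hva
    obtain ⟨A, hA, hvA, F, hF, -⟩ := exists_isPathSet_notMem hm hn (S := ∅)
      (fun x hx => absurd hx (Finset.notMem_empty x)) (fun x hx => absurd hx (Finset.notMem_empty x))
      (a := v.row) (by simp [indexSet])
    rcases Finset.mem_union.mp (hv _ ⟨A, hA, F, hF, rfl⟩) with h | h
    · exact hva (mem_antidiagonalFinset.mp h)
    · exact hvA (hF.mem_of_hasIndex h (Or.inl rfl))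
  · rintro hv _ ⟨A, hA, F, hF, rfl⟩
    exact Finset.mem_union_left _ (mem_antidiagonalFinset.mpr hv)

theorem mem_coreComplex_iff (hm : 1 ≤ m) (hn : n = 2 * m) {F : Finset (Box n)} :
    F ∈ coreComplex (stanleyReisnerComplex (symMonomialIdeal n K)) ↔
      F.Nonempty ∧ IsCompatible F ∧ ∀ x ∈ F, x ∉ antidiagonalBoxes n := by
  rw [coreComplex, conePoints_stanleyReisnerComplex hm hn, ← and_assoc,
    ← mem_stanleyReisnerComplex_iff (K := K) hn]
  rfl

theorem IsPathSet.mem_coreComplex (hm : 1 ≤ m) (hn : n = 2 * m) {A : Finset (Fin n)}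
    (hA : A ∈ oppositeFreeSets n m) {F G : Finset (Box n)} (hF : IsPathSet A F) (hG : G.Nonempty)
    (hGF : G ⊆ F) : G ∈ coreComplex (stanleyReisnerComplex (symMonomialIdeal n K)) :=
  (mem_coreComplex_iff hm hn).mpr ⟨hG, (hF.isCompatible hA).subset hGF,
    fun _ hx => hF.notMem_antidiagonalBoxes hA (hGF hx)⟩

theorem IsPathSet.set_nonempty {A : Finset (Fin n)} {F : Finset (Box n)} (hF : IsPathSet A F) :
    F.Nonempty := by
  rw [← Finset.card_pos, hF.card_eq, Finset.card_pos]
  exact hF.nonempty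

theorem facets_coreComplex (hm : 1 ≤ m) (hn : n = 2 * m) :
    facets (coreComplex (stanleyReisnerComplex (symMonomialIdeal n K))) =
      ⋃ A ∈ oppositeFreeSets n m, {F | IsPathSet A F} := by
  ext G
  simp only [Set.mem_iUnion, Set.mem_ofPred_eq, exists_prop]
  constructor
  · intro hG
    have h := (mem_coreComplex_iff hm hn).mp hG.1
    obtain ⟨A, hA, F, hF, hGF⟩ := h.2.1.exists_oppositeFreeSets_isPathSet hm hn h.2.2
    rw [hG.eq_of_le (hF.mem_coreComplex hm hn hA hF.set_nonempty subset_rfl) hGF]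
    exact ⟨A, hA, hF⟩
  · rintro ⟨A, hA, hF⟩
    refine ⟨hF.mem_coreComplex hm hn hA hF.set_nonempty subset_rfl, fun G' hG' hle => ?_⟩
    have h := (mem_coreComplex_iff hm hn).mp hG'
    obtain ⟨B, hB, F', hF', hGF⟩ := h.2.1.exists_oppositeFreeSets_isPathSet hm hn h.2.2
    rw [hF.eq_of_subset hA hB hF' (hle.trans hGF)]
    exact hGF

theorem mem_pathComplex_iff {A : Finset (Fin n)} {F : Finset (Box n)} :
    F ∈ pathComplex A ↔ F.Nonempty ∧ ∃ G, IsPathSet A G ∧ F ⊆ G := by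
  change F.Nonempty ∧ _ ↔ _
  refine and_congr_right fun _ => ⟨?_, ?_⟩
  · rintro ⟨l, hl, hFl⟩
    exact ⟨_, hl.isPathSet, hFl⟩
  · rintro ⟨G, hG, hFG⟩
    obtain ⟨l, hl, rfl⟩ := hG.exists_isTrianglePath
    exact ⟨l, hl, hFG⟩

theorem facets_pathComplex (A : Finset (Fin n)) : facets (pathComplex A) = {F | IsPathSet A F} := by
  ext F
  constructor
  · intro hF
    obtain ⟨-, G, hG, hFG⟩ := mem_pathComplex_iff.mp hF.1
    rw [hF.eq_of_le (mem_pathComplex_iff.mpr ⟨hG.set_nonempty, G, hG, subset_rfl⟩) hFG]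
    exact hG
  · intro hF
    refine ⟨mem_pathComplex_iff.mpr ⟨hF.set_nonempty, F, hF, subset_rfl⟩, fun G hG hle => ?_⟩
    obtain ⟨-, G', hG', hGG'⟩ := mem_pathComplex_iff.mp hG
    have : F = G' := Finset.eq_of_subset_of_card_le (hle.trans hGG')
      (by rw [hG'.card_eq, IsPathSet.card_eq hF])
    rw [this]
    exact hGG'

theorem restrictComplex_coreComplex_triangle (hm : 1 ≤ m) (hn : n = 2 * m) {A : Finset (Fin n)}
    (hA : A ∈ oppositeFreeSets n m) :
    restrictComplex (coreComplex (stanleyReisnerComplex (symMonomialIdeal n K))) (triangle A) =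
      pathComplex A := by
  refine SetLike.ext fun F => ?_
  rw [mem_pathComplex_iff]
  change F ∈ coreComplex _ ∧ _ ↔ _
  rw [mem_coreComplex_iff hm hn]
  constructor
  · rintro ⟨⟨hF, hFc, hFa⟩, hFA⟩
    refine ⟨hF, hFc.exists_isPathSet hm hFa hA fun a ha => ?_⟩
    obtain ⟨x, hx, rfl | rfl⟩ := mem_indexSet.mp ha
    exacts [(hFA hx).1, (hFA hx).2]
  · rintro ⟨hF, G, hG, hFG⟩
    exact ⟨⟨hF, (hG.isCompatible hA).subset hFG,
      fun x hx => hG.notMem_antidiagonalBoxes hA (hFG hx)⟩,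
      fun x hx => ⟨hG.mem_of_hasIndex (hFG hx) (Or.inl rfl),
        hG.mem_of_hasIndex (hFG hx) (Or.inr rfl)⟩⟩

theorem pairwiseDisjoint_isPathSet (s : Set (Finset (Fin n))) :
    s.PairwiseDisjoint fun A => {F : Finset (Box n) | IsPathSet A F} := by
  intro A _ B _ hAB
  refine Set.disjoint_left.mpr fun F (hF : IsPathSet A F) (hG : IsPathSet B F) => ?_
  exact hAB (hF.index_unique hG)

theorem ncard_facets_coreComplex (hm : 1 ≤ m) (hn : n = 2 * m) :
    (facets (coreComplex (stanleyReisnerComplex (symMonomialIdeal n K)))).ncard =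
      2 ^ (n - 1) := by
  classical
  set t : Finset (Finset (Fin n)) := (Set.toFinite (oppositeFreeSets n m)).toFinset with ht
  have htcard : t.card = 2 ^ m := by
    rw [ht, ← Set.ncard_eq_toFinset_card, ncard_oppositeFreeSets hn]
  have hunion : facets (coreComplex (stanleyReisnerComplex (symMonomialIdeal n K))) =
      (t.biUnion fun A => (Set.toFinite {F : Finset (Box n) | IsPathSet A F}).toFinset :
        Finset (Finset (Box n))) := by
    rw [facets_coreComplex hm hn]
    ext F
    simp [ht]
  rw [hunion, Set.ncard_coe_finset, Finset.card_biUnion, Finset.sum_congr rfl (g := fun _ =>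
    2 ^ (m - 1)), Finset.sum_const, htcard, smul_eq_mul, ← pow_add]
  · congr 1
    omega
  · intro A hA
    have hA' : A ∈ oppositeFreeSets n m := by simpa [ht] using hA
    rw [← Set.ncard_eq_toFinset_card, ncard_isPathSet (nonempty_of_mem_oppositeFreeSets hm hA'),
      hA'.1]
  · intro A _ B _ hAB
    rw [Function.onFun, Set.Finite.disjoint_toFinset]
    exact pairwiseDisjoint_isPathSet Set.univ (Set.mem_univ A) (Set.mem_univ B) hAB

theorem card_of_mem_facets_coreComplex (hm : 1 ≤ m) (hn : n = 2 * m) {F : Finset (Box n)}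
    (hF : F ∈ facets (coreComplex (stanleyReisnerComplex (symMonomialIdeal n K)))) :
    F.card = m := by
  rw [facets_coreComplex hm hn] at hF
  simp only [Set.mem_iUnion, Set.mem_ofPred_eq, exists_prop] at hF
  obtain ⟨A, hA, hF⟩ := hF
  rw [hF.card_eq, hA.1]

end Complex

/-! ### The height function and the Gorenstein property of `K(2,n)`. -/

/-- The signed distance of the position `(i, j)` from the antidiagonal. -/
def antidiagonalOffset {n : ℕ} (i j : Fin n) : ℚ := (i : ℚ) + j + 1 - n

/-- For indices `c`, `e`, `r`, `q`, the squared offsets at `(c, r)` and `(e, q)` exceed those at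
`(c, q)` and `(e, r)` by `2 * (c - e) * (r - q)`. This makes the heights favour nested pairs, and
the potential is built along the path, the new box fixing its value at the new index. -/
theorem exists_potential_of_isPathSet {n : ℕ} {A : Finset (Fin n)} {F : Finset (Box n)}
    (h : IsPathSet A F) : ∃ x : Fin n → ℚ, ∀ a ∈ A, ∀ b ∈ A,
      x a + x b ≤ antidiagonalOffset a b ^ 2 ∧
        (x a + x b = antidiagonalOffset a b ^ 2 ↔ box a b ∈ F) := by
  induction h with
  | single a =>
    refine ⟨fun _ => antidiagonalOffset a a ^ 2 / 2, ?_⟩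
    simp only [Finset.mem_singleton, forall_eq, add_halves, le_refl, and_self]
  | @extend A F e r h hr ih =>
    obtain ⟨x, hx⟩ := ih
    -- The partner `q` of `e` in an old box makes the exchange with the new box `(e, r)` possible:
    -- all other `c` lie on the same side of `e` as `r` does of `q`.
    obtain ⟨q, hqA, hq, hqe⟩ : ∃ q ∈ A, box e q ∈ F ∧
        ∀ c ∈ A, c ≠ e → 0 < ((c : ℚ) - e) * ((r : ℚ) - q) := by
      obtain ⟨y, hy, hye⟩ := h.exists_hasIndex hr.mem
      obtain ⟨q, hq⟩ : ∃ q, y = box e q := by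
        rcases hye with rfl | rfl
        exacts [⟨y.col, (box_row_col y).symm⟩, ⟨y.row, by rw [box_comm, box_row_col]⟩]
      have hqA : q ∈ A := h.mem_of_hasIndex hy (hq ▸ box_hasIndex.mpr (Or.inr rfl))
      refine ⟨q, hqA, hq ▸ hy, fun c hc hce => ?_⟩
      rcases hr with ⟨he, hr⟩ | ⟨he, hr⟩
      · have h1 : e < c := lt_of_le_of_ne (he.2 hc) hce.symm
        have h2 := hr q hqA
        refine mul_pos (sub_pos.mpr ?_) (sub_pos.mpr ?_) <;> exact_mod_cast ‹_›
      · have h1 : c < e := lt_of_le_of_ne (he.2 hc) hce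
        have h2 := hr q hqA
        refine mul_pos_of_neg_of_neg (sub_neg.mpr ?_) (sub_neg.mpr ?_) <;> exact_mod_cast ‹_›
    have hrA := hr.notMem
    have hrq : (0 : ℚ) < ((r : ℚ) - e) * ((r : ℚ) - q) := by
      rcases hr with ⟨he, hr⟩ | ⟨he, hr⟩
      · have h1 := hr e he.1
        have h2 := hr q hqA
        refine mul_pos (sub_pos.mpr ?_) (sub_pos.mpr ?_) <;> exact_mod_cast ‹_›
      · have h1 := hr e he.1
        have h2 := hr q hqA
        refine mul_pos_of_neg_of_neg (sub_neg.mpr ?_) (sub_neg.mpr ?_) <;> exact_mod_cast ‹_›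
    set y : ℚ := antidiagonalOffset e r ^ 2 - x e with hy
    have hxq : x e + x q = antidiagonalOffset e q ^ 2 := (hx e hr.mem q hqA).2.mpr hq
    have hcr : ∀ c ∈ A, x c + y ≤ antidiagonalOffset c r ^ 2 ∧
        (x c + y = antidiagonalOffset c r ^ 2 ↔ box c r ∈ insert (box e r) F) := by
      intro c hc
      by_cases hce : c = e
      · subst hce
        simp [hy]
      · have h1 := (hx c hc q hqA).1
        have h2 := hqe c hc hce
        have h3 : x c + y < antidiagonalOffset c r ^ 2 := by
          simp only [antidiagonalOffset] at *
          nlinarith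
        have hcr : c ≠ r := fun h' => hrA (h' ▸ hc)
        have h4 : box c r ∉ insert (box e r) F := by
          rw [Finset.mem_insert, box_eq_iff, not_or]
          refine ⟨?_, h.box_notMem hrA⟩
          rintro (⟨h', -⟩ | ⟨h', -⟩)
          exacts [hce h', hcr h']
        exact ⟨h3.le, fun h' => absurd h' h3.ne, fun h' => absurd h' h4⟩
    have hrr : y + y ≤ antidiagonalOffset r r ^ 2 ∧
        (y + y = antidiagonalOffset r r ^ 2 ↔ box r r ∈ insert (box e r) F) := by
      have h1 := (hcr q hqA).1
      have h3 : y + y < antidiagonalOffset r r ^ 2 := by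
        simp only [antidiagonalOffset] at *
        nlinarith
      have h4 : box r r ∉ insert (box e r) F := by
        rw [Finset.mem_insert, box_eq_iff, not_or]
        refine ⟨?_, h.box_notMem hrA⟩
        rintro (⟨h', -⟩ | ⟨-, h'⟩)
        exacts [hr.ne h'.symm, hr.ne h'.symm]
      exact ⟨h3.le, fun h' => absurd h' h3.ne, fun h' => absurd h' h4⟩
    have hsymm : ∀ a b : Fin n, antidiagonalOffset a b = antidiagonalOffset b a := fun a b => by
      simp only [antidiagonalOffset]
      ring
    have hne : ∀ a ∈ A, a ≠ r := fun a ha h' => hrA (h' ▸ ha)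
    refine ⟨Function.update x r y, fun a ha b hb => ?_⟩
    rcases Finset.mem_insert.mp ha with rfl | ha' <;>
      rcases Finset.mem_insert.mp hb with rfl | hb'
    · rw [Function.update_self]
      exact hrr
    · rw [Function.update_self, Function.update_of_ne (hne b hb'), add_comm, hsymm, box_comm a b]
      exact hcr b hb'
    · rw [Function.update_self, Function.update_of_ne (hne a ha')]
      exact hcr a ha'
    · rw [Function.update_of_ne (hne a ha'), Function.update_of_ne (hne b hb')]
      refine ⟨(hx a ha' b hb').1, (hx a ha' b hb').2.trans ?_⟩
      rw [Finset.mem_insert, or_iff_right]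
      rw [box_eq_iff]
      rintro (⟨-, h'⟩ | ⟨h', -⟩)
      exacts [hne b hb' h', hne a ha' h']

/-- The facets are the regions of linearity of a convex function. -/
theorem exists_height_potential {n m : ℕ} (hn : n = 2 * m) :
    ∃ (height : Box n → ℚ) (u : Finset (Box n) → Fin n → ℚ), ∀ A ∈ oppositeFreeSets n m, ∀ F,
      IsPathSet A F → ∀ v : Box n, u F v.row + u F v.col ≤ height v ∧
        (u F v.row + u F v.col = height v ↔ v ∈ antidiagonalFinset n ∪ F) := by
  classical
  have hx : ∀ F : Finset (Box n), ∃ x : Fin n → ℚ, ∀ A, IsPathSet A F → ∀ a ∈ A, ∀ b ∈ A,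
      x a + x b ≤ antidiagonalOffset a b ^ 2 ∧
        (x a + x b = antidiagonalOffset a b ^ 2 ↔ box a b ∈ F) := by
    intro F
    by_cases hF : ∃ A, IsPathSet A F
    · obtain ⟨A, hA⟩ := hF
      obtain ⟨x, hx⟩ := exists_potential_of_isPathSet hA
      exact ⟨x, fun B hB => hA.index_unique hB ▸ hx⟩
    · exact ⟨0, fun A hA => absurd ⟨A, hA⟩ hF⟩
  choose x hx using hx
  obtain ⟨B, hB⟩ : ∃ B : ℚ, ∀ F a, |x F a| ≤ B := by
    obtain ⟨B, hB⟩ := (Set.finite_range fun p : Finset (Box n) × Fin n => |x p.1 p.2|).bddAbove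
    exact ⟨B, fun F a => hB ⟨(F, a), rfl⟩⟩
  -- `N` dominates every sum of two potentials. Boxes off the antidiagonal are lifted by `N`, so
  -- equality there forces both indices into `A`; taking opposite values at opposite indices gives
  -- equality on the antidiagonal.
  set N : ℚ := 2 * |B| + 1 with hN
  refine ⟨fun v => if v ∈ antidiagonalBoxes n then 0 else N + antidiagonalOffset v.row v.col ^ 2,
    fun F a => if ∃ A ∈ oppositeFreeSets n m, IsPathSet A F ∧ a ∈ A then N / 2 + x F a
      else - (N / 2 + x F a.rev), fun A hA F hF v => ?_⟩
  have hmem : ∀ a, (∃ A ∈ oppositeFreeSets n m, IsPathSet A F ∧ a ∈ A) ↔ a ∈ A := fun a =>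
    ⟨fun ⟨A', _, hA', h⟩ => hF.index_unique hA' ▸ h, fun h => ⟨A, hA, hF, h⟩⟩
  simp only [hmem, Finset.mem_union, mem_antidiagonalFinset]
  have hb : ∀ a, -|B| ≤ x F a ∧ x F a ≤ |B| := fun a =>
    abs_le.mp ((hB F a).trans (le_abs_self B))
  have hsq := sq_nonneg (antidiagonalOffset v.row v.col)
  have hanti : v ∈ antidiagonalBoxes n ↔ v.col = v.row.rev := isOpposite_iff
  have hanti' : v ∈ antidiagonalBoxes n ↔ v.row = v.col.rev := by
    rw [hanti, eq_comm, Fin.rev_eq_iff]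
  have hstrict : ∀ y z : ℚ, y < z → v ∉ antidiagonalBoxes n → v ∉ F →
      y ≤ z ∧ (y = z ↔ v ∈ antidiagonalBoxes n ∨ v ∈ F) := fun y z h h1 h2 =>
    ⟨h.le, fun h' => absurd h' h.ne, fun h' => (h'.elim h1 h2).elim⟩
  by_cases hr : v.row ∈ A <;> by_cases hc : v.col ∈ A
  · have hva : v ∉ antidiagonalBoxes n := hA.2 _ hr _ hc
    rw [if_pos hr, if_pos hc, if_neg hva]
    obtain ⟨h1, h2⟩ := hx F A hF _ hr _ hc
    rw [box_row_col] at h2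
    refine ⟨by linarith, ?_⟩
    rw [or_iff_right hva, ← h2]
    constructor <;> intro h <;> linarith
  · rw [if_pos hr, if_neg hc]
    have hvF : v ∉ F := fun h => hc (hF.mem_of_hasIndex h (Or.inr rfl))
    by_cases hva : v ∈ antidiagonalBoxes n
    · rw [if_pos hva, ← hanti'.mp hva]
      simp [hva]
    · rw [if_neg hva]
      have h1 := hb v.row
      have h2 := hb v.col.rev
      exact hstrict _ _ (by linarith) hva hvF
  · rw [if_neg hr, if_pos hc]
    have hvF : v ∉ F := fun h => hr (hF.mem_of_hasIndex h (Or.inl rfl))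
    by_cases hva : v ∈ antidiagonalBoxes n
    · rw [if_pos hva, ← hanti.mp hva]
      simp [hva]
    · rw [if_neg hva]
      have h1 := hb v.row.rev
      have h2 := hb v.col
      exact hstrict _ _ (by linarith) hva hvF
  · have hva : v ∉ antidiagonalBoxes n := fun h => hc (by
      rw [mem_iff_rev_notMem hn hA, ← hanti'.mp h]
      exact hr)
    have hvF : v ∉ F := fun h => hr (hF.mem_of_hasIndex h (Or.inl rfl))
    rw [if_neg hr, if_neg hc, if_neg hva]
    have h1 := hb v.row.rev
    have h2 := hb v.col.rev
    exact hstrict _ _ (by linarith) hva hvF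

/-- The affine forms `c i + c j - c o` that vanish on a facet are zero. -/
theorem eq_zero_of_forall_mem_facet {n m : ℕ} (hm : 1 ≤ m) (hn : n = 2 * m) {L : Type*} [Field L]
    {A : Finset (Fin n)} (hA : A ∈ oppositeFreeSets n m) {F : Finset (Box n)}
    (hF : IsPathSet A F) (o : Fin n) (c : Fin n → L)
    (hc : ∀ v ∈ antidiagonalFinset n ∪ F, c v.row + c v.col - c o = 0) : c = 0 := by
  have hbox : ∀ i j, box i j ∈ antidiagonalFinset n ∪ F → c i + c j = c o := by
    intro i j h
    have := hc _ h
    rcases le_total i j with hij | hij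
    · rw [box_row_of_le hij, box_col_of_le hij] at this
      linear_combination this
    · rw [box_comm, box_row_of_le hij, box_col_of_le hij] at this
      linear_combination this
  have key : ∀ {A : Finset (Fin n)} {F : Finset (Box n)}, IsPathSet A F →
      (∀ i j, box i j ∈ F → c i + c j = c o) → ∀ a ∈ A, ∀ b ∈ A, c a + c b = c o := by
    intro A F hF h
    induction hF with
    | single a =>
      simp only [Finset.mem_singleton, forall_eq]
      exact h a a (Finset.mem_singleton_self _)
    | @extend A F e r hF hr ih =>
      have ih := ih fun i j hij => h i j (Finset.mem_insert_of_mem hij)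
      have h1 := h e r (Finset.mem_insert_self _ _)
      have h2 := ih e hr.mem e hr.mem
      intro a ha b hb
      rcases Finset.mem_insert.mp ha with rfl | ha' <;>
        rcases Finset.mem_insert.mp hb with rfl | hb'
      · linear_combination 2 * h1 - h2
      · linear_combination h1 - h2 + ih e hr.mem b hb'
      · linear_combination h1 - h2 + ih e hr.mem a ha'
      · exact ih a ha' b hb'
  have hAA := key hF fun i j h => hbox i j (Finset.mem_union_right _ h)
  obtain ⟨a, ha⟩ := nonempty_of_mem_oppositeFreeSets hm hA
  have hrev : ∀ i, c i + c i.rev = c o := fun i => hbox _ _ (Finset.mem_union_left _ (by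
    rw [mem_antidiagonalFinset]
    rcases le_total i i.rev with h | h
    · change IsOpposite _ _
      rw [box_row_of_le h, box_col_of_le h, isOpposite_iff]
    · change IsOpposite _ _
      rw [box_comm, box_row_of_le h, box_col_of_le h, isOpposite_iff, Fin.rev_rev]))
  have hall : ∀ i, c i = c a := by
    intro i
    by_cases hi : i ∈ A
    · linear_combination hAA i hi a ha - hAA a ha a ha
    · have hi' : i.rev ∈ A := by
        rw [mem_iff_rev_notMem hn hA, Fin.rev_rev]
        exact hi
      linear_combination hrev i - hAA _ hi' a ha
  -- From `c a + c a = c o` and `c o = c a`, without dividing by `2`. The term `- c o` is what makes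
  -- the forms independent also in characteristic two.
  have hzero : c a = 0 := by
    linear_combination hAA a ha a ha + hall o
  ext i
  rw [hall i, hzero, Pi.zero_apply]

theorem card_antidiagonalFinset {n m : ℕ} (hn : n = 2 * m) :
    (antidiagonalFinset n).card = m := by
  set L : Finset (Fin n) := Finset.univ.filter fun a => (a : ℕ) < m with hL
  have hmemL : ∀ a, a ∈ L ↔ (a : ℕ) < m := fun a => by rw [hL, Finset.mem_filter_univ]
  have hcard : L.card = m := card_eq_of_mem_iff_rev_notMem hn fun a => by
    rw [hmemL, hmemL, Fin.val_rev]
    omega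
  have hle : ∀ a ∈ L, a ≤ a.rev := fun a ha => by
    rw [hmemL] at ha
    rw [Fin.le_def, Fin.val_rev]
    omega
  rw [← hcard]
  refine (Finset.card_nbij (fun a => box a a.rev) (fun a ha => ?_) (fun a ha b hb h => ?_)
    fun x hx => ?_).symm
  · rw [Finset.mem_coe, mem_antidiagonalFinset]
    change IsOpposite _ _
    rw [box_row_of_le (hle a ha), box_col_of_le (hle a ha), isOpposite_iff]
  · have := congrArg Box.row h
    simpa only [box_row_of_le (hle a ha), box_row_of_le (hle b hb)] using this
  · rw [Finset.mem_coe, mem_antidiagonalFinset] at hx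
    have hx' : x.col = x.row.rev := isOpposite_iff.mp hx
    refine ⟨x.row, Finset.mem_coe.mpr ((hmemL _).mpr ?_), ?_⟩
    · have := x.row_le_col
      rw [hx', Fin.le_def, Fin.val_rev] at this
      omega
    · change box x.row x.row.rev = x
      rw [← hx', box_row_col]

theorem IsPathSet.card_antidiagonal_union {n m : ℕ} (hn : n = 2 * m) {A : Finset (Fin n)}
    (hA : A ∈ oppositeFreeSets n m) {F : Finset (Box n)} (hF : IsPathSet A F) :
    (antidiagonalFinset n ∪ F).card = n := by
  rw [Finset.card_union_of_disjoint, hF.card_eq, hA.1, card_antidiagonalFinset hn]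
  · omega
  · rw [Finset.disjoint_left]
    exact fun x hx hxF => hF.notMem_antidiagonalBoxes hA hxF (mem_antidiagonalFinset.mp hx)

/-- The linear form `c i + c j - c o` in the variables `c`, for the box `(i, j)`. -/
def boxVector {n : ℕ} (o : Fin n) (x : Box n) (k : Fin n) : ℤ :=
  (if k = x.row then 1 else 0) + (if k = x.col then 1 else 0) - (if k = o then 1 else 0)

theorem sum_mul_boxVector {n : ℕ} {L : Type*} [CommRing L] (o : Fin n) (x : Box n)
    (c : Fin n → L) : ∑ k, c k * (boxVector o x k : L) = c x.row + c x.col - c o := by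
  simp [boxVector, mul_add, mul_sub, Finset.sum_add_distrib, Finset.sum_sub_distrib]

theorem isGorensteinRing_symMonomialIdeal (K : Type u) [Field K] {n m : ℕ} (hm : 1 ≤ m)
    (hn : n = 2 * m) : IsGorensteinRing (MvPolynomial (Box n) K ⧸ symMonomialIdeal n K) := by
  classical
  have : Fintype (Box n) := Fintype.ofFinite _
  obtain ⟨height, u, hu⟩ := exists_height_potential hn
  set o : Fin n := ⟨0, by omega⟩
  set fac : Finset (Finset (Box n)) := (Set.toFinite {G | ∃ A ∈ oppositeFreeSets n m, ∃ F,
    IsPathSet A F ∧ G = antidiagonalFinset n ∪ F}).toFinset with hfac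
  have hmem : ∀ G, G ∈ fac ↔ ∃ A ∈ oppositeFreeSets n m, ∃ F,
      IsPathSet A F ∧ G = antidiagonalFinset n ∪ F := fun G => by
    rw [hfac, Set.Finite.mem_toFinset, Set.mem_ofPred_eq]
  have hdiff : ∀ A ∈ oppositeFreeSets n m, ∀ F, IsPathSet A F →
      (antidiagonalFinset n ∪ F) \ antidiagonalFinset n = F := by
    intro A hA F hF
    rw [Finset.union_sdiff_left, Finset.sdiff_eq_self_iff_disjoint, Finset.disjoint_left]
    exact fun x hxF hx => hF.notMem_antidiagonalBoxes hA hxF (mem_antidiagonalFinset.mp hx)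
  have hwall : ∀ F ∈ fac, ∀ v ∈ F, v ∉ antidiagonalFinset n → ∃ G ∈ fac, G ≠ F ∧
      F.erase v ⊆ G := by
    intro F hF v hv hva
    obtain ⟨A, hA, P, hP, rfl⟩ := (hmem F).mp hF
    have hvP := (Finset.mem_union.mp hv).resolve_left hva
    -- Either the path is flipped over the same index set, or an index has disappeared and is
    -- exchanged for its opposite.
    obtain ⟨B, hB, Q, hQ, hne, hsub⟩ : ∃ B ∈ oppositeFreeSets n m, ∃ Q, IsPathSet B Q ∧ Q ≠ P ∧
        P.erase v ⊆ Q := by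
      rcases hP.exists_flip hvP with ⟨a, haA, ha⟩ | ⟨Q, hQ, hne, hsub⟩
      · obtain ⟨B, hB, haB, Q, hQ, hsub⟩ := exists_isPathSet_notMem hm hn
          ((hP.isCompatible hA).subset (Finset.erase_subset v P))
          (fun x hx => hP.notMem_antidiagonalBoxes hA (Finset.mem_of_mem_erase hx)) (a := a)
          (fun h => by
            obtain ⟨x, hx, hxa⟩ := mem_indexSet.mp h
            exact ha x hx hxa)
        refine ⟨B, hB, Q, hQ, ?_, hsub⟩
        rintro rfl
        exact haB (hP.index_unique hQ ▸ haA)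
      · exact ⟨A, hA, Q, hQ, hne, hsub⟩
    refine ⟨_, (hmem _).mpr ⟨B, hB, Q, hQ, rfl⟩, fun h => hne ?_, fun x hx => ?_⟩
    · rw [← hdiff B hB Q hQ, h, hdiff A hA P hP]
    · obtain ⟨hxv, hx⟩ := Finset.mem_erase.mp hx
      rcases Finset.mem_union.mp hx with hx | hx
      · exact Finset.mem_union_left _ hx
      · exact Finset.mem_union_right _ (hsub (Finset.mem_erase.mpr ⟨hxv, hx⟩))
  -- Adding `u o` to every coordinate compensates for the subtracted coordinate `o` in `boxVector`,
  -- so the values on boxes are unchanged.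
  refine isGorensteinRing_of_regular_fan K fac ?_ (antidiagonalFinset n) ?_ ?_ (boxVector o) ?_ ?_
    height (fun F i => u (F \ antidiagonalFinset n) i + u (F \ antidiagonalFinset n) o) ?_ ?_
    hwall _ ?_ (n := n)
  · obtain ⟨A, hA, F, hF, -⟩ := IsCompatible.exists_oppositeFreeSets_isPathSet hm hn (n := n)
      (S := ∅) (fun x hx => absurd hx (Finset.notMem_empty x))
      (fun x hx => absurd hx (Finset.notMem_empty x))
    exact ⟨_, (hmem _).mpr ⟨A, hA, F, hF, rfl⟩⟩
  · intro F hF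
    obtain ⟨A, hA, P, hP, rfl⟩ := (hmem F).mp hF
    exact Finset.subset_union_left
  · intro F hF
    obtain ⟨A, hA, P, hP, rfl⟩ := (hmem F).mp hF
    exact hP.card_antidiagonal_union hn hA
  · intro F hF c hc
    obtain ⟨A, hA, P, hP, rfl⟩ := (hmem F).mp hF
    exact eq_zero_of_forall_mem_facet hm hn hA hP o c fun v hv => by
      rw [← sum_mul_boxVector, hc v hv]
  · intro F hF c hc
    obtain ⟨A, hA, P, hP, rfl⟩ := (hmem F).mp hF
    exact eq_zero_of_forall_mem_facet hm hn hA hP o c fun v hv => by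
      rw [← sum_mul_boxVector, hc v hv]
  · intro F hF v
    obtain ⟨A, hA, P, hP, rfl⟩ := (hmem F).mp hF
    have := (hu A hA P hP v).1
    rw [sum_mul_boxVector, hdiff A hA P hP]
    linarith
  · intro F hF v
    obtain ⟨A, hA, P, hP, rfl⟩ := (hmem F).mp hF
    rw [sum_mul_boxVector, hdiff A hA P hP, ← (hu A hA P hP v).2]
    constructor <;> intro h <;> linarith
  · intro f
    rw [mem_symMonomialIdeal_iff hn]
    constructor
    · intro h F hF a ha hsub
      obtain ⟨A, hA, P, hP, rfl⟩ := (hmem F).mp hF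
      exact h a ha ((isCompatible_antidiagonal_union (hP.isCompatible hA)).subset hsub)
    · intro h a ha hc
      obtain ⟨A, hA, P, hP, hsub⟩ := hc.exists_subset_antidiagonal_union hm hn
      exact h _ ((hmem _).mpr ⟨A, hA, P, hP, rfl⟩) a ha hsub

/-! ### The Veronese parametrization and the initial ideal. -/

/-- The value of the linear form `u` on the image of the monomial `a` under `x_{ij} ↦ t_i t_j`. -/
def toricWeight {n : ℕ} (u : Fin n → ℚ) (a : Box n →₀ ℕ) : ℚ :=
  a.sum fun v k => (k : ℚ) * (u v.row + u v.col)

/-- The exponent of the image of the monomial `a` under `x_{ij} ↦ t_i t_j`. -/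
noncomputable def toricExponent {n : ℕ} (a : Box n →₀ ℕ) : Fin n →₀ ℕ :=
  a.sum fun v k => k • (Finsupp.single v.row 1 + Finsupp.single v.col 1)

theorem toricWeight_eq {n : ℕ} (u : Fin n → ℚ) (a : Box n →₀ ℕ) :
    toricWeight u a = (toricExponent a).sum fun i k => (k : ℚ) * u i := by
  rw [toricExponent, Finsupp.sum_sum_index (by simp) (by intros; push_cast; ring), toricWeight]
  refine Finset.sum_congr rfl fun v _ => ?_
  beta_reduce
  rw [smul_add, Finsupp.sum_add_index' (by simp) (by intros; push_cast; ring)]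
  simp only [Finsupp.smul_single, smul_eq_mul, mul_one]
  rw [Finsupp.sum_single_index (by simp), Finsupp.sum_single_index (by simp), mul_add]

/-- Coordinate functions of the basis formed by a facet; they read off the exponents of a monomial
supported on it. The term `- c o` is absorbed by shifting `c` by `c o / 2`, which is harmless over
`ℚ`. -/
theorem exists_dual_of_isPathSet {n m : ℕ} (hm : 1 ≤ m) (hn : n = 2 * m)
    {A : Finset (Fin n)} (hA : A ∈ oppositeFreeSets n m) {F : Finset (Box n)}
    (hF : IsPathSet A F) (v : Box n) : ∃ u : Fin n → ℚ, ∀ w ∈ antidiagonalFinset n ∪ F,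
      u w.row + u w.col = if w = v then 1 else 0 := by
  set o : Fin n := ⟨0, by omega⟩
  set G := antidiagonalFinset n ∪ F with hG
  let Φ : (Fin n → ℚ) →ₗ[ℚ] (G → ℚ) := LinearMap.pi fun w : G =>
    let p (i : Fin n) : (Fin n → ℚ) →ₗ[ℚ] ℚ := LinearMap.proj i
    p w.1.row + p w.1.col - p o
  have hinj : Function.Injective Φ := by
    rw [← LinearMap.ker_eq_bot, LinearMap.ker_eq_bot']
    exact fun c hc => eq_zero_of_forall_mem_facet hm hn hA hF o c fun w hw =>
      congrFun hc (⟨w, hw⟩ : G)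
  have hsurj : Function.Surjective Φ := by
    refine (LinearMap.injective_iff_surjective_of_finrank_eq_finrank ?_).mp hinj
    rw [Module.finrank_fintype_fun_eq_card, Module.finrank_fintype_fun_eq_card, Fintype.card_fin,
      Fintype.card_coe, hF.card_antidiagonal_union hn hA]
  obtain ⟨c, hc⟩ := hsurj fun w => if w.1 = v then 1 else 0
  refine ⟨fun i => c i - c o / 2, fun w hw => ?_⟩
  have : c w.row + c w.col - c o = if w = v then 1 else 0 := congrFun hc (⟨w, hw⟩ : G)
  rw [← this]
  ring

/-- Different standard monomials have different images under `x_{ij} ↦ t_i t_j`. -/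
theorem toricExponent_injOn {n m : ℕ} (hm : 1 ≤ m) (hn : n = 2 * m) :
    Set.InjOn toricExponent {a : Box n →₀ ℕ | IsCompatible a.support} := by
  intro a ha b hb hab
  obtain ⟨height, u, hu⟩ := exists_height_potential hn
  have hw : ∀ u, toricWeight u a = toricWeight u b := fun u => by
    rw [toricWeight_eq, toricWeight_eq, hab]
  obtain ⟨A, hA, F, hF, haF⟩ := IsCompatible.exists_subset_antidiagonal_union hm hn ha
  obtain ⟨B, hB, G, hG, hbG⟩ := IsCompatible.exists_subset_antidiagonal_union hm hn hb
  have heq : ∀ {A : Finset (Fin n)} {F : Finset (Box n)} {c : Box n →₀ ℕ},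
      A ∈ oppositeFreeSets n m → IsPathSet A F → c.support ⊆ antidiagonalFinset n ∪ F →
      toricWeight (u F) c = c.sum fun v k => (k : ℚ) * height v := fun hA hF hc =>
    Finset.sum_congr rfl fun v hv => by
      beta_reduce
      rw [((hu _ hA _ hF v).2).mpr (hc hv)]
  have hterm : ∀ {A : Finset (Fin n)} {F : Finset (Box n)} (c : Box n →₀ ℕ),
      A ∈ oppositeFreeSets n m → IsPathSet A F → ∀ v ∈ c.support,
      (c v : ℚ) * (u F v.row + u F v.col) ≤ (c v : ℚ) * height v := fun c hA hF v _ =>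
    mul_le_mul_of_nonneg_left (hu _ hA _ hF v).1 (Nat.cast_nonneg _)
  -- Both weights depend only on the common toric exponent. Each is the total height of the monomial
  -- on its own facet and a lower bound for that of the other, so all are equal. Equality forces the
  -- support of `b` into the facet of `a`.
  have h1 : toricWeight (u G) a ≤ a.sum fun v k => (k : ℚ) * height v :=
    Finset.sum_le_sum (hterm a hB hG)
  have h2 : toricWeight (u F) b ≤ b.sum fun v k => (k : ℚ) * height v :=
    Finset.sum_le_sum (hterm b hA hF)
  have h3 := heq hA hF haF
  have h4 := heq hB hG hbG
  have h5 : toricWeight (u F) b = b.sum fun v k => (k : ℚ) * height v := by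
    refine le_antisymm h2 ?_
    rw [← h4, ← hw, ← hw (u F), h3]
    exact h1
  have hbF : b.support ⊆ antidiagonalFinset n ∪ F := by
    intro v hv
    have h6 := (Finset.sum_eq_sum_iff_of_le (hterm b hA hF)).mp h5 v hv
    have hbv : (b v : ℚ) ≠ 0 := Nat.cast_ne_zero.mpr (Finsupp.mem_support_iff.mp hv)
    exact ((hu A hA F hF v).2).mp (mul_left_cancel₀ hbv h6)
  ext v
  by_cases hv : v ∈ antidiagonalFinset n ∪ F
  · obtain ⟨d, hd⟩ := exists_dual_of_isPathSet hm hn hA hF v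
    have hval : ∀ c : Box n →₀ ℕ, c.support ⊆ antidiagonalFinset n ∪ F →
        toricWeight d c = c v := by
      intro c hc
      rw [toricWeight, Finsupp.sum, Finset.sum_congr rfl (g := fun w => if w = v then (c w : ℚ)
        else 0) fun w hw => by rw [hd w (hc hw), mul_ite, mul_one, mul_zero]]
      rw [Finset.sum_ite_eq', ite_eq_left_iff, Finsupp.notMem_support_iff]
      exact fun h => by rw [h, Nat.cast_zero]
    exact_mod_cast (hval a haF).symm.trans ((hw d).trans (hval b hbF))
  · rw [Finsupp.notMem_support_iff.mp fun h => hv (haF h),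
      Finsupp.notMem_support_iff.mp fun h => hv (hbF h)]

/-- The parametrization `x_{ij} ↦ t_i t_j` of the symmetric matrices of rank at most one. -/
noncomputable def veroneseHom (n : ℕ) (K : Type u) [Field K] :
    MvPolynomial (Box n) K →ₐ[K] MvPolynomial (Fin n) K :=
  aeval fun v => X v.row * X v.col

theorem veroneseHom_box {n : ℕ} {K : Type u} [Field K] (i j : Fin n) :
    veroneseHom n K (X (box i j)) = X i * X j := by
  rw [veroneseHom, aeval_X]
  rcases le_total i j with h | h
  · rw [box_row_of_le h, box_col_of_le h]
  · rw [box_comm, box_row_of_le h, box_col_of_le h, mul_comm]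

theorem veroneseHom_monomial {n : ℕ} {K : Type u} [Field K] (a : Box n →₀ ℕ) (c : K) :
    veroneseHom n K (monomial a c) = monomial (toricExponent a) c := by
  rw [veroneseHom, aeval_monomial, toricExponent, algebraMap_eq,
    ← mul_one c, ← C_mul_monomial, mul_one, Finsupp.sum, monomial_sum_one, Finsupp.prod]
  refine congrArg _ (Finset.prod_congr rfl fun v _ => ?_)
  rw [X, X, monomial_mul, monomial_pow, one_mul, one_pow]

/-- The standard monomials map to distinct monomials, so no cancellation can occur. -/
theorem eq_zero_of_veroneseHom_eq_zero {n m : ℕ} (hm : 1 ≤ m) (hn : n = 2 * m) {K : Type u}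
    [Field K] {r : MvPolynomial (Box n) K} (hr : veroneseHom n K r = 0)
    (hs : ∀ a ∈ r.support, IsCompatible a.support) : r = 0 := by
  classical
  by_contra h
  obtain ⟨a, ha⟩ := support_nonempty.mpr h
  have h1 : coeff (toricExponent a) (veroneseHom n K r) = coeff a r := by
    conv_lhs => rw [r.as_sum, map_sum]
    simp only [veroneseHom_monomial, coeff_sum, coeff_monomial]
    rw [Finset.sum_eq_single a, if_pos rfl]
    · intro b hb hba
      exact if_neg fun h => hba (toricExponent_injOn hm hn (hs b hb) (hs a ha) h)
    · exact fun h => absurd ha h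
  rw [hr, coeff_zero] at h1
  exact mem_support_iff.mp ha h1.symm

theorem symMinorIdeal_le_ker (n : ℕ) (K : Type u) [Field K] :
    symMinorIdeal n K ≤ RingHom.ker (veroneseHom n K) := by
  rw [symMinorIdeal, Ideal.span_le]
  rintro _ ⟨r, c, -, -, rfl⟩
  change veroneseHom n K _ = 0
  rw [Matrix.det_fin_two]
  simp only [symMatrix, Matrix.submatrix_apply, Matrix.of_apply, map_sub, map_mul, veroneseHom_box]
  ring

theorem minor_mem_symMinorIdeal {n : ℕ} (K : Type u) [Field K] (i j h k : Fin n) :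
    (X (box i h) * X (box j k) - X (box i k) * X (box j h) : MvPolynomial (Box n) K) ∈
      symMinorIdeal n K := by
  have key : ∀ i j h k : Fin n, i < j → h < k →
      (X (box i h) * X (box j k) - X (box i k) * X (box j h) : MvPolynomial (Box n) K) ∈
        symMinorIdeal n K := by
    intro i j h k hij hhk
    refine Ideal.subset_span ⟨![i, j], ![h, k], ?_, ?_, ?_⟩
    · intro a b hab
      fin_cases a <;> fin_cases b <;> simp_all
    · intro a b hab
      fin_cases a <;> fin_cases b <;> simp_all
    · rw [Matrix.det_fin_two]
      rfl
  rcases lt_trichotomy i j with hij | rfl | hij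
  · rcases lt_trichotomy h k with hhk | rfl | hhk
    · exact key i j h k hij hhk
    · rw [sub_self]
      exact zero_mem _
    · convert neg_mem (key i j k h hij hhk) using 1
      ring
  · convert zero_mem (symMinorIdeal n K) using 1
    ring
  · rcases lt_trichotomy h k with hhk | rfl | hhk
    · convert neg_mem (key j i h k hij hhk) using 1
      ring
    · rw [sub_self]
      exact zero_mem _
    · convert key j i k h hij hhk using 1
      ring

/-- A quadratic binomial one of whose variables is smaller than the two of the other term. -/
theorem toRevLex_single_add_single_lt {σ : Type} [Finite σ] (ord : LinearOrder σ) {x y z w : σ}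
    (hzx : ord.lt z x) (hzy : ord.lt z y) :
    toRevLex ord (Finsupp.single z 1 + Finsupp.single w 1) <
      toRevLex ord (Finsupp.single x 1 + Finsupp.single y 1) := by
  classical
  rw [toRevLex_lt_iff]
  refine Or.inr ⟨by simp, ?_⟩
  let := ord
  change z < x at hzx
  change z < y at hzy
  -- The smallest variable at which the exponents differ may be `w` instead of `z`; in both cases it
  -- is below `x` and `y`.
  refine ⟨min z w, fun u hu => ?_, ?_⟩
  · change u < min z w at hu
    have h1 := lt_min_iff.mp hu
    simp [h1.1.ne', h1.2.ne', (h1.1.trans hzx).ne', (h1.1.trans hzy).ne']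
  · have hx : min z w ≠ x := ((min_le_left z w).trans_lt hzx).ne
    have hy : min z w ≠ y := ((min_le_left z w).trans_lt hzy).ne
    simp only [Finsupp.add_apply, Finsupp.single_apply, if_neg hx.symm, if_neg hy.symm]
    rcases min_choice z w with h | h <;> rw [h] <;> simp

/-- The small variable `z` is the antidiagonal box `(a, b)` in case (1). In case (2) it is `(x.row,
y.col)`, which lies farther from the diagonal than `x` and `y`, or on the antidiagonal. -/
theorem IsBadPair.exists_minor {n : ℕ} {x y : Box n} (h : IsBadPair x y) (K : Type u) [Field K]
    {ord : LinearOrder (Box n)} (ho : IsAdmissibleOrder ord) :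
    ∃ z w, (X x * X y - X z * X w : MvPolynomial (Box n) K) ∈ symMinorIdeal n K ∧
      ord.lt z x ∧ ord.lt z y := by
  obtain ⟨hx, hy, ⟨a, b, ha, hb, hab⟩ | ⟨h1, h2⟩⟩ := h
  · obtain ⟨j, rfl⟩ : ∃ j, x = box a j := by
      rcases ha with rfl | rfl
      exacts [⟨x.col, (box_row_col x).symm⟩, ⟨x.row, by rw [box_comm, box_row_col]⟩]
    obtain ⟨k, rfl⟩ : ∃ k, y = box k b := by
      rcases hb with rfl | rfl
      exacts [⟨y.col, by rw [box_comm, box_row_col]⟩, ⟨y.row, (box_row_col y).symm⟩]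
    have hz : box a b ∈ antidiagonalBoxes n := by
      change IsOpposite _ _
      rcases le_total a b with h | h
      · rwa [box_row_of_le h, box_col_of_le h]
      · rw [box_comm, box_row_of_le h, box_col_of_le h]
        exact hab.symm
    exact ⟨box a b, box k j, minor_mem_symMinorIdeal K a k j b, ho.1 _ hz _ hx, ho.1 _ hz _ hy⟩
  · refine ⟨box x.row y.col, box y.row x.col, ?_, ?_⟩
    · have := minor_mem_symMinorIdeal K x.row y.row x.col y.col
      rwa [box_row_col, box_row_col] at this
    · have hle : x.row ≤ y.col := x.row_le_col.trans h2.le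
      by_cases hz : box x.row y.col ∈ antidiagonalBoxes n
      · exact ⟨ho.1 _ hz _ hx, ho.1 _ hz _ hy⟩
      · have h3 := x.row_le_col
        have h4 := y.row_le_col
        rw [Fin.lt_def] at h1 h2
        rw [Fin.le_def] at h3 h4
        refine ⟨ho.2 _ hx _ hz ?_, ho.2 _ hy _ hz ?_⟩ <;>
          rw [box_row_of_le hle, box_col_of_le hle] <;> omega

theorem IsBadPair.exists_degree_eq {n : ℕ} {x y : Box n} (h : IsBadPair x y) (K : Type u)
    [Field K] {ord : LinearOrder (Box n)} (ho : IsAdmissibleOrder ord) :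
    ∃ f ∈ symMinorIdeal n K, f ≠ 0 ∧
      (degRevLex ord).degree f = Finsupp.single x 1 + Finsupp.single y 1 := by
  classical
  obtain ⟨z, w, hmem, hzx, hzy⟩ := h.exists_minor K ho
  have hX : ∀ s t : Box n, (X s * X t : MvPolynomial (Box n) K) =
      monomial (Finsupp.single s 1 + Finsupp.single t 1) 1 := fun s t => by
    rw [X, X, monomial_mul, one_mul]
  have hdeg : ∀ s t : Box n, (degRevLex ord).degree (X s * X t : MvPolynomial (Box n) K) =
      Finsupp.single s 1 + Finsupp.single t 1 := fun s t => by
    rw [hX, MonomialOrder.degree_monomial, if_neg one_ne_zero]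
  have hlt := toRevLex_single_add_single_lt ord (w := w) hzx hzy
  have hd : (degRevLex ord).degree (X x * X y - X z * X w : MvPolynomial (Box n) K) =
      Finsupp.single x 1 + Finsupp.single y 1 := by
    rw [MonomialOrder.degree_sub_of_lt, hdeg]
    rw [hdeg, hdeg]
    exact hlt
  refine ⟨_, hmem, fun h0 => ?_, hd⟩
  rw [h0, MonomialOrder.degree_zero] at hd
  have := DFunLike.congr_fun hd x
  rw [Finsupp.add_apply, Finsupp.single_eq_same, Finsupp.zero_apply] at this
  omega

theorem initialIdeal_symMinorIdeal (K : Type u) [Field K] {n m : ℕ} (hm : 1 ≤ m)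
    (hn : n = 2 * m) {ord : LinearOrder (Box n)} (ho : IsAdmissibleOrder ord) :
    initialIdeal (degRevLex ord) (symMinorIdeal n K) = symMonomialIdeal n K := by
  classical
  refine le_antisymm ?_ ?_
  · rw [initialIdeal, Ideal.span_le]
    rintro _ ⟨f, hf, hf0, rfl⟩
    rw [SetLike.mem_coe, mem_symMonomialIdeal_iff hn, support_monomial, if_neg one_ne_zero]
    simp only [Finset.mem_singleton, forall_eq]
    set mo := degRevLex ord with hmo
    set B : Set (MvPolynomial (Box n) K) := {p | p ∈ symMinorIdeal n K ∧ p ≠ 0 ∧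
      ∃ x y, IsBadPair x y ∧ mo.degree p = Finsupp.single x 1 + Finsupp.single y 1} with hB
    obtain ⟨g, r, hfg, hdeg, hr⟩ := mo.div_set (B := B)
      (fun b hb => (mo.leadingCoeff_ne_zero_iff.mpr hb.2.1).isUnit) f
    have hbad : ∀ b ∈ B, ∀ a, mo.degree b ≤ a → ¬ IsCompatible a.support := by
      rintro b ⟨-, -, x, y, hxy, hb⟩ a hle hc
      rw [hb, single_add_single_le_iff (hxy.ne hn)] at hle
      exact hc x hle.1 y hle.2 hxy
    have hcomb : Finsupp.linearCombination _ (fun b : B => (b : MvPolynomial (Box n) K)) g ∈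
        symMinorIdeal n K := by
      rw [Finsupp.linearCombination_apply]
      exact Ideal.sum_mem _ fun b _ => Ideal.mul_mem_left _ _ b.2.1
    have hrmem : r ∈ symMinorIdeal n K := by
      rw [← sub_eq_of_eq_add' hfg]
      exact sub_mem hf hcomb
    -- The remainder lies in `J(2,n)`, hence in the kernel of the parametrization, and has only
    -- standard monomials.
    have hr0 : r = 0 := eq_zero_of_veroneseHom_eq_zero hm hn (symMinorIdeal_le_ker n K hrmem)
      fun a ha x hx y hy hxy => by
        obtain ⟨p, hp, hp0, hpd⟩ := hxy.exists_degree_eq K ho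
        refine hr a ha p ⟨hp, hp0, x, y, hxy, hpd⟩ ?_
        rw [hpd, single_add_single_le_iff (hxy.ne hn)]
        exact ⟨hx, hy⟩
    rw [hr0, add_zero, Finsupp.linearCombination_apply, Finsupp.sum] at hfg
    have hcoeff : coeff (mo.degree f) f ≠ 0 := mo.leadingCoeff_ne_zero_iff.mpr hf0
    -- Some summand carries the leading monomial of `f`. By the degree bound of the division this is
    -- also the leading monomial of the summand, so that of `b` divides it.
    obtain ⟨b, -, hb⟩ : ∃ b ∈ g.support,
        coeff (mo.degree f) (g b • (b : MvPolynomial (Box n) K)) ≠ 0 := by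
      by_contra! hall
      refine hcoeff ?_
      conv_lhs => rw [hfg, coeff_sum]
      rw [← hfg]
      exact Finset.sum_eq_zero hall
    rw [smul_eq_mul, mul_comm] at hb
    have hne : (b : MvPolynomial (Box n) K) * g b ≠ 0 := fun h => hb (by rw [h, coeff_zero])
    have hle := mo.le_degree (mem_support_iff.mpr hb)
    have heq : mo.degree ((b : MvPolynomial (Box n) K) * g b) = mo.degree f :=
      mo.toSyn.injective (le_antisymm (hdeg b) hle)
    rw [mo.degree_mul' hne] at heq
    exact hbad b b.2 _ (heq ▸ le_self_add)
  · rw [symMonomialIdeal_eq, Ideal.span_le]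
    rintro _ ⟨_, ⟨x, y, hxy, rfl⟩, rfl⟩
    obtain ⟨p, hp, hp0, hpd⟩ := hxy.exists_degree_eq K ho
    exact Ideal.subset_span ⟨p, hp, hp0, by rw [hpd]⟩

theorem symMonomialIdeal_eq_span_prod (K : Type u) [Field K] {n m : ℕ} (hn : n = 2 * m) :
    ∃ S : Set (Finset (Box n)), (∀ F ∈ S, F.card = 2) ∧
      symMonomialIdeal n K =
        Ideal.span {f | ∃ F ∈ S, f = ∏ v ∈ F, (X v : MvPolynomial (Box n) K)} := by
  refine ⟨{F | ∃ x y, IsBadPair x y ∧ F = {x, y}}, ?_, ?_⟩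
  · rintro _ ⟨x, y, hxy, rfl⟩
    exact Finset.card_pair (hxy.ne hn)
  · rw [symMonomialIdeal]
    congr 1
    ext f
    constructor
    · rintro ⟨x, y, h1, h2, h3, rfl⟩
      have hxy : IsBadPair x y := ⟨h1, h2, h3⟩
      exact ⟨_, ⟨x, y, hxy, rfl⟩, (Finset.prod_pair (hxy.ne hn)).symm⟩
    · rintro ⟨_, ⟨x, y, hxy, rfl⟩, rfl⟩
      exact ⟨x, y, hxy.1, hxy.2.1, hxy.2.2, Finset.prod_pair (hxy.ne hn)⟩

theorem mainTheorem8 (K : Type u) [Field K] (m n : ℕ) (hm : 1 ≤ m) (hn : n = 2 * m) :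
    -- the cone points are the antidiagonal variables
    conePoints (stanleyReisnerComplex (symMonomialIdeal n K)) = antidiagonalBoxes n ∧
    -- the core is pure, with `2 ^ (n - 1)` facets of size `m`
    IsPureComplex (coreComplex (stanleyReisnerComplex (symMonomialIdeal n K))) ∧
    (facets (coreComplex (stanleyReisnerComplex (symMonomialIdeal n K)))).ncard = 2 ^ (n - 1) ∧
    (∀ F ∈ facets (coreComplex (stanleyReisnerComplex (symMonomialIdeal n K))), F.card = m) ∧
    -- the part of the core over each index set `A` is the classical path complex over `A`,
    -- whose facets are exactly the paths
    (∀ A ∈ oppositeFreeSets n m,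
      restrictComplex (coreComplex (stanleyReisnerComplex (symMonomialIdeal n K))) (triangle A) =
        pathComplex A ∧
      facets (pathComplex A) = {F | ∃ l, IsTrianglePath A l ∧ F = l.toFinset}) ∧
    -- the facets of the core are the disjoint union of those of the path complexes
    facets (coreComplex (stanleyReisnerComplex (symMonomialIdeal n K))) =
      ⋃ A ∈ oppositeFreeSets n m, facets (pathComplex A) ∧
    (oppositeFreeSets n m).PairwiseDisjoint (fun A => facets (pathComplex A)) ∧
    -- `K(2,n)` is the initial ideal of `J(2,n)`
    (∀ ord : LinearOrder (Box n), IsAdmissibleOrder ord →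
      initialIdeal (degRevLex ord) (symMinorIdeal n K) = symMonomialIdeal n K) ∧
    -- and it is squarefree, quadratic and Gorenstein
    (∃ S : Set (Finset (Box n)), (∀ F ∈ S, F.card = 2) ∧
      symMonomialIdeal n K =
        Ideal.span {f | ∃ F ∈ S, f = ∏ v ∈ F, (X v : MvPolynomial (Box n) K)}) ∧
    IsGorensteinRing (MvPolynomial (Box n) K ⧸ symMonomialIdeal n K) := by
  refine ⟨conePoints_stanleyReisnerComplex hm hn, fun F hF G hG => ?_,
    ncard_facets_coreComplex hm hn, fun F hF => card_of_mem_facets_coreComplex hm hn hF,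
    fun A hA => ⟨restrictComplex_coreComplex_triangle hm hn hA, ?_⟩, ?_, ?_,
    fun ord ho => initialIdeal_symMinorIdeal K hm hn ho, symMonomialIdeal_eq_span_prod K hn,
    isGorensteinRing_symMonomialIdeal K hm hn⟩
  · rw [card_of_mem_facets_coreComplex hm hn hF, card_of_mem_facets_coreComplex hm hn hG]
  · rw [facets_pathComplex]
    exact Set.ext fun F => isPathSet_iff
  · simp only [facets_pathComplex]
    exact facets_coreComplex hm hn
  · simp only [facets_pathComplex]
    exact pairwiseDisjoint_isPathSet _
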